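/- **Setting.** Let $A_{11},A_{12},A_{21},A_{22}\in\mathbb{R}^{d\times d}$ have spectral norm at most $1$. Assume that all (complex) eigenvalues of $A_{11}$ and of $\Delta=A_{22}-A_{21}A_{11}^{-1}A_{12}$ have strictly positive real part (in particular, strictly positive real eigenvalues are allowed; no symmetry is assumed). There are $N$ nodes. Node $i$ has vectors $b_1^i,b_2^i\in\mathbb{R}^d$ with $\max\{\|b_1^i\|,\|b_2^i\|\}\le R$, where $R>0$, and $(x^*,y^*)$ solves $$A_{11}x^*+A_{12}y^*=\frac1N\sum_{i=1}^N b_1^i,\qquad A_{21}x^*+A_{22}y^*=\frac1N\sum_{i=1}^N b_2^i .$$ Let $W=[w_{ij}]$ and $V=[v_{ij}]$ be doubly stochastic $N\times N$ matrices with positive diagonal whose associated graphs (join $i\ne j$ if $w_{ij}>0$ or $w_{ji}>0$; similarly for $V$) are connected. Let $\sigma$ be the larger of the second largest singular values of $W$ and $V$; assume $\sigma>0$ and $\sigma^k\le 1/(k+1)$ for all $k\ge0$. The noise pairs $(\xi_k^i,\psi_k^i)$, $k\ge0$, $1\le i\le N$, are mutually independent random vectors in $\mathbb{R}^d\times\mathbb{R}^d$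 with zero mean, satisfy $\max\{\|\xi_k^i\|,\|\psi_k^i\|\}\le C$ almost surely for some $C>0$, and have common second moments $\mathbb{E}[(\xi_k^i)^T\xi_k^i]=\Gamma_{11}$, $\mathbb{E}[(\xi_k^i)^T\psi_k^i]=\Gamma_{12}$, $\mathbb{E}[(\psi_k^i)^T\psi_k^i]=\Gamma_{22}$. The iterates satisfy $x_0^i=y_0^i=0$ and $$x_{k+1}^i=\sum_{j}w_{ij}x_k^j-\alpha_k\big(A_{11}x_k^i+A_{12}y_k^i-b_1^i+\xi_k^i\big),\qquad y_{k+1}^i=\sum_{j}v_{ij}y_k^j-\beta_k\big(A_{21}x_k^i+A_{22}y_k^i-b_2^i+\psi_k^i\big),$$ with step sizes $\alpha_k=\alpha_0/(k+1)^{2/3}$ and $\beta_k=\beta_0/(k+1)$, where $0<\beta_0\le\alpha_0$ and every eigenvalue $\lambda$ of $\Delta$ satisfies $\beta_0\operatorname{Re}\lambda>1/3$. Let $\delta\in(\sigma,1)$, let $\mathcal K^*$ be a positive integer with $\mathcal K^*\ge\lceil(\alpha_0/(\delta-\sigma))^{3/2}\rceil$, and put $$\mathcal D=\frac{2\sqrt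 N\,(R+C)(6\alpha_0+1)(\mathcal K^*)^{1/3}}{1-\delta}.$$ **Theorem.** There are constants $\mathcal D_0,\mathcal D_1\ge0$, depending only on $d$, the matrices $A_{\ell u}$, $x^*$, $y^*$, $\Gamma_{11},\Gamma_{12},\Gamma_{22}$, $\alpha_0$ and $\beta_0$ (not on $N$, $W$, $V$, the individual $b_\ell^i$, $R$, $C$, the law of the noise, $\delta$, $\mathcal K^*$ or $k$), such that all iterates have finite second moments and, for every $k\ge0$, the averages $\bar x_k=\frac1N\sum_i x_k^i$, $\bar y_k=\frac1N\sum_i y_k^i$ satisfy $$\mathbb{E}\|\bar y_k-y^*\|^2+\frac{\beta_k}{\alpha_k}\mathbb{E}\|\bar x_k-x^*\|^2\le\frac{\mathcal D_0}{(k+1)^{2/3}}+\frac{\mathcal D_1\ln(k+1)}{k+1}$$ and $$\frac1N\sum_{i=1}^N\Big(\mathbb{E}\|y_k^i-y^*\|^2+\frac{\beta_k}{\alpha_k}\mathbb{E}\|x_k^i-x^*\|^2\Big)\le\frac{16\mathcal D^2\beta_0\alpha_0\ln^2(\mathcal K^*)\,\sigma^{-2\mathcal K^*}}{N(1-\sigma)^2(k+1)^{2/3}}+\frac{16\mathcal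 D^2\beta_0\alpha_0}{N(1-\sigma)^2(k+2)^{5/3}}+\frac{2\mathcal D_0}{(k+1)^{2/3}}+\frac{2\mathcal D_1\ln(k+1)}{k+1}.$$ -/

import Mathlib

open MeasureTheory ProbabilityTheory
open scoped Matrix Matrix.Norms.L2Operator

noncomputable section

/-- `ℝ^d` with the Euclidean norm. -/
abbrev Vec (d : ℕ) : Type := EuclideanSpace ℝ (Fin d)

/-- Matrix-vector product on Euclidean space. -/
def act {d : ℕ} (A : Matrix (Fin d) (Fin d) ℝ) (v : Vec d) : Vec d :=
  WithLp.toLp 2 (A *ᵥ v.ofLp)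

/-- The Schur complement `Δ = A₂₂ - A₂₁ A₁₁⁻¹ A₁₂`. -/
def schurCompl {d : ℕ} (A₁₁ A₁₂ A₂₁ A₂₂ : Matrix (Fin d) (Fin d) ℝ) :
    Matrix (Fin d) (Fin d) ℝ :=
  A₂₂ - A₂₁ * A₁₁⁻¹ * A₁₂

/-- Every complex eigenvalue of the real matrix `A` has real part greater than `c`. -/
def EigenvaluesReGT {d : ℕ} (A : Matrix (Fin d) (Fin d) ℝ) (c : ℝ) : Prop :=
  ∀ z ∈ spectrum ℂ (A.map (algebraMap ℝ ℂ)), c < z.re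

/-- The fast step size `α_k = α₀ / (k+1)^{2/3}`. -/
def fastStep (α₀ : ℝ) (k : ℕ) : ℝ := α₀ / ((k : ℝ) + 1) ^ (2 / 3 : ℝ)

/-- The slow step size `β_k = β₀ / (k+1)`. -/
def slowStep (β₀ : ℝ) (k : ℕ) : ℝ := β₀ / ((k : ℝ) + 1)

/-- Average over the nodes. -/
def nodeAvg {N d : ℕ} (z : Fin N → Vec d) : Vec d := (N : ℝ)⁻¹ • ∑ i, z i

/-- A communication matrix: doubly stochastic, with positive diagonal, and such that the graph
whose edges are the pairs of distinct nodes joined by a positive weight (in at least one of the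
two directions) is connected. -/
structure IsCommMatrix {N : ℕ} (W : Matrix (Fin N) (Fin N) ℝ) : Prop where
  doublyStochastic : W ∈ doublyStochastic ℝ (Fin N)
  diag_pos : ∀ i, 0 < W i i
  connected : (SimpleGraph.fromRel fun i j => 0 < W i j).Connected

/-- The second largest singular value (counted with multiplicity; Mathlib indexes from `0`). -/
def secondSingularValue {N : ℕ} (W : Matrix (Fin N) (Fin N) ℝ) : ℝ :=
  (Matrix.toEuclideanLin W).singularValues 1

/-- `σ`, the larger of the second singular values of `W` and `V`. -/
def mixingRate {N : ℕ} (W V : Matrix (Fin N) (Fin N) ℝ) : ℝ :=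
  max (secondSingularValue W) (secondSingularValue V)

/-- The noise: the pairs `(ξ_k^i, ψ_k^i)` are mutually independent over all `k` and `i`, have zero
mean, are bounded by `C`, and have common second moments `Γ₁₁, Γ₁₂, Γ₂₂`. -/
structure IsNoise {Ω : Type*} [MeasurableSpace Ω] (P : Measure Ω) {N d : ℕ}
    (ξ ψ : ℕ → Fin N → Ω → Vec d) (C Γ₁₁ Γ₁₂ Γ₂₂ : ℝ) : Prop where
  measurable_fst : ∀ k i, Measurable (ξ k i)
  measurable_snd : ∀ k i, Measurable (ψ k i)
  indep : iIndepFun (fun (p : ℕ × Fin N) (ω : Ω) => (ξ p.1 p.2 ω, ψ p.1 p.2 ω)) P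
  mean_fst : ∀ k i, ∫ ω, ξ k i ω ∂P = 0
  mean_snd : ∀ k i, ∫ ω, ψ k i ω ∂P = 0
  bounded : ∀ k i, ∀ᵐ ω ∂P, max ‖ξ k i ω‖ ‖ψ k i ω‖ ≤ C
  moment_fst : ∀ k i, ∫ ω, inner ℝ (ξ k i ω) (ξ k i ω) ∂P = Γ₁₁
  moment_mixed : ∀ k i, ∫ ω, inner ℝ (ξ k i ω) (ψ k i ω) ∂P = Γ₁₂
  moment_snd : ∀ k i, ∫ ω, inner ℝ (ψ k i ω) (ψ k i ω) ∂P = Γ₂₂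

/-- `x, y` are the iterates of the distributed linear two-time-scale stochastic approximation
started at zero, with step sizes `α, β`. -/
structure IsDistributedSA {Ω : Type*} {N d : ℕ}
    (A₁₁ A₁₂ A₂₁ A₂₂ : Matrix (Fin d) (Fin d) ℝ) (b₁ b₂ : Fin N → Vec d)
    (W V : Matrix (Fin N) (Fin N) ℝ) (α β : ℕ → ℝ) (ξ ψ x y : ℕ → Fin N → Ω → Vec d) : Prop where
  init_fst : ∀ i ω, x 0 i ω = 0
  init_snd : ∀ i ω, y 0 i ω = 0
  step_fst : ∀ k i ω, x (k + 1) i ω = ∑ j, W i j • x k j ω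
    - α k • (act A₁₁ (x k i ω) + act A₁₂ (y k i ω) - b₁ i + ξ k i ω)
  step_snd : ∀ k i ω, y (k + 1) i ω = ∑ j, V i j • y k j ω
    - β k • (act A₂₁ (x k i ω) + act A₂₂ (y k i ω) - b₂ i + ψ k i ω)

/-- The constant `𝒟` of the consensus terms. -/
def consensusConst (N : ℕ) (R C α₀ δ : ℝ) (K : ℕ) : ℝ :=
  2 * √(N : ℝ) * (R + C) * (6 * α₀ + 1) * (K : ℝ) ^ (1 / 3 : ℝ) / (1 - δ)

end

/-! The nodes' mean square error splits exactly (Pythagoras, `sum_norm_sub_sq`) into the error of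
the node average and the consensus error, that is, the deviation from the average. The two are
bounded separately.

Averages. Since `W` and `V` are doubly stochastic, the averages follow a centralized two-time-scale
recursion. In the coordinates `x̂ = x̄ - x* + A₁₁⁻¹A₁₂(ȳ - y*)` and `ŷ = ȳ - y*` the fast drift is
`A₁₁ x̂` and the slow drift is `Δ ŷ + A₂₁ x̂`, so each variable is contracted by its own matrix.
These matrices are not symmetric, and contraction at a rate just below the spectral bound holds only
in an adapted Euclidean norm (`exists_contracting_norm`). That norm comes from an inner product, so
the centered noise, independent of the past, contributes no cross term to the expected square. The
Lyapunov function `E‖ŷ‖² + M (β/α) E‖x̂‖²` then contracts by `1 - s/(k+1)` with `s > 2/3`, because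
`β₀ Re λ > 1/3` on the spectrum of `Δ`; its forcing is of order `αβ ~ (k+1)^{-5/3}`. Hence it decays
like `(k+1)^{-2/3}` (`exists_decay_bound`, `exists_two_time_scale_bound`), and `D₁ = 0` suffices.
All constants are fixed before the network, the noise and the probability space.

Consensus. Pathwise, for almost every noise, the deviation norms `X`, `Y` obey `X' ≤ σX + α(X+Y+G)`
and `Y' ≤ σY + β(X+Y+G)` with `G = √N (R+C)`, since mixing contracts deviations by the second
singular value (`norm_deviation_mix_le`). The sum `X+Y+G` is dominated by `G` times the scalar
sequence `growth`. The explicit bound `growth_le` is the delicate part: up to time `K` the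
multipliers may exceed one and their product is compared with `σ^{-K}` through Stirling's formula,
while after `K` they are at most `δ` up to a summable excess. Feeding the bound back gives `X ~
(k+1)^{-2/3}` and `Y ~ (k+1)^{-1}` (`consensus_bound`). -/

/-! ### Euclidean norms adapted to a matrix with spectrum in a half plane. -/

lemma act_eq_toEuclideanCLM {d : ℕ} (A : Matrix (Fin d) (Fin d) ℝ) (v : Vec d) :
    act A v = Matrix.toEuclideanCLM (𝕜 := ℝ) A v := rfl

lemma norm_act_le {d : ℕ} (A : Matrix (Fin d) (Fin d) ℝ) (v : Vec d) :
    ‖act A v‖ ≤ ‖A‖ * ‖v‖ :=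
  Matrix.l2_opNorm_mulVec A v

/-- Spectral theory gives bounds for the complexified matrix; they descend because `ℝ^d` embeds
isometrically into `ℂ^d`. -/
lemma norm_act_le_of_norm_map_le {d : ℕ} (A : Matrix (Fin d) (Fin d) ℝ) {r : ℝ}
    (hA : ‖A.map (algebraMap ℝ ℂ)‖ ≤ r) (v : Vec d) : ‖act A v‖ ≤ r * ‖v‖ := by
  have h := Matrix.l2_opNorm_mulVec (A.map (algebraMap ℝ ℂ))
    (WithLp.toLp 2 fun i => (v i : ℂ))
  have h1 : ‖(WithLp.toLp 2 fun i => (v i : ℂ) : EuclideanSpace ℂ (Fin d))‖ = ‖v‖ := by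
    simp [EuclideanSpace.norm_eq]
  have h2 : A.map (algebraMap ℝ ℂ) *ᵥ (fun i => (v i : ℂ)) = fun i => ((act A v i : ℝ) : ℂ) := by
    ext i
    simp [act, Matrix.mulVec, dotProduct]
  have h3 : ‖(WithLp.toLp 2 fun i => ((act A v i : ℝ) : ℂ) : EuclideanSpace ℂ (Fin d))‖
      = ‖act A v‖ := by
    simp [EuclideanSpace.norm_eq]
  rw [h1] at h
  simp only [h2] at h
  exact h3.symm.le.trans (h.trans (by gcongr))

/-- A small step against a matrix with spectrum in a half plane has small spectral radius. -/
lemma exists_norm_pow_le {d : ℕ} {A : Matrix (Fin d) (Fin d) ℂ} {c : ℝ}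
    (hA : ∀ z ∈ spectrum ℂ A, c < z.re) :
    ∃ c' > c, ∃ e > 0, e * c' < 1 ∧ ∃ m : ℕ, ‖(1 - (e : ℂ) • A) ^ m‖ ≤ (1 - e * c') ^ m ∧ 0 < m := by
  -- The spectrum is compact, so the strict bound leaves a gap; the spectrum is empty when `d = 0`.
  obtain ⟨μ, hμc, hμ⟩ : ∃ μ > c, ∀ z ∈ spectrum ℂ A, μ ≤ z.re := by
    rcases (spectrum ℂ A).eq_empty_or_nonempty with h | h
    · exact ⟨c + 1, by linarith, by simp [h]⟩
    · obtain ⟨w, hw, hmin⟩ := (spectrum.isCompact (𝕜 := ℂ) A).exists_isMinOn h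
        Complex.continuous_re.continuousOn
      exact ⟨w.re, hA w hw, fun z hz => hmin hz⟩
  obtain ⟨M, hM0, hM⟩ : ∃ M > 0, ∀ z ∈ spectrum ℂ A, ‖z‖ ≤ M := by
    obtain ⟨M, hM⟩ := (spectrum.isCompact (𝕜 := ℂ) A).isBounded.exists_norm_le
    exact ⟨max M 1, by positivity, fun z hz => (hM z hz).trans (le_max_left _ _)⟩
  obtain ⟨c₁, hc₁, hc₁μ⟩ := exists_between hμc
  obtain ⟨c', hc', hc'c₁⟩ := exists_between hc₁
  -- The first bound gives `e c₁ < 1`. The second gives `|1 - ez|² ≤ 1 - 2eμ + e(μ - c₁) ≤ 1 - 2ec₁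
  -- ≤ (1 - ec₁)²` on the spectrum.
  set e : ℝ := min (1 / (|c₁| + 1)) ((μ - c₁) / M ^ 2) with he
  have he0 : 0 < e := by
    have : 0 < μ - c₁ := by linarith
    positivity
  have he1 : e * (|c₁| + 1) ≤ 1 := by
    rw [← le_div_iff₀ (by positivity)]; exact min_le_left _ _
  have he2 : e * M ^ 2 ≤ μ - c₁ := by
    rw [← le_div_iff₀ (by positivity)]; exact min_le_right _ _
  have hec₁ : e * c₁ < 1 := by nlinarith [le_abs_self c₁]
  have hec' : e * c' < e * c₁ := by gcongr
  refine ⟨c', hc', e, he0, by linarith, ?_⟩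
  have hspec : ∀ z ∈ spectrum ℂ (1 - (e : ℂ) • A), ‖z‖ ≤ 1 - e * c₁ := by
    intro z hz
    have h1 : (1 : Matrix (Fin d) (Fin d) ℂ) - (e : ℂ) • A
        = algebraMap ℂ _ 1 - (e : ℂ) • A := by simp
    rw [h1, ← spectrum.singleton_sub_eq] at hz
    have hu : ((e : ℂ) • A) = (Units.mk0 (e : ℂ) (by exact_mod_cast he0.ne')) • A := rfl
    rw [hu, spectrum.unit_smul_eq_smul] at hz
    obtain ⟨o, ho, w', ⟨w, hw, rfl⟩, rfl⟩ := Set.mem_sub.1 hz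
    obtain rfl : o = 1 := ho
    have hre := hμ w hw
    have hn := hM w hw
    have hsq : ‖(1 : ℂ) - (e : ℂ) * w‖ ^ 2 = 1 - 2 * e * w.re + e ^ 2 * ‖w‖ ^ 2 := by
      rw [← Complex.normSq_eq_norm_sq, ← Complex.normSq_eq_norm_sq, Complex.normSq_apply,
        Complex.normSq_apply]
      simp
      ring
    have hn2 : ‖w‖ ^ 2 ≤ M ^ 2 := by gcongr
    change ‖(1 : ℂ) - (e : ℂ) * w‖ ≤ _
    refine abs_le_of_sq_le_sq' ?_ (by linarith) |>.2
    rw [hsq]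
    have a1 : e * w.re ≥ e * μ := by gcongr
    have a2 : e ^ 2 * ‖w‖ ^ 2 ≤ e * (μ - c₁) := by
      calc e ^ 2 * ‖w‖ ^ 2 ≤ e ^ 2 * M ^ 2 := by gcongr
        _ = e * (e * M ^ 2) := by ring
        _ ≤ _ := by gcongr
    nlinarith [sq_nonneg (e * c₁), mul_pos he0 (sub_pos.2 hc₁μ)]
  have hrad : spectralRadius ℂ (1 - (e : ℂ) • A) < ENNReal.ofReal (1 - e * c') := by
    refine lt_of_le_of_lt (b := ENNReal.ofReal (1 - e * c₁)) ?_ ?_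
    · refine iSup₂_le fun z hz => ?_
      exact (ofReal_norm z).symm.le.trans (ENNReal.ofReal_le_ofReal (hspec z hz))
    · exact (ENNReal.ofReal_lt_ofReal_iff (by linarith)).2 (by linarith)
  -- Gelfand's formula turns the bound on the spectral radius into a norm bound for some power.
  have hg := spectrum.pow_norm_pow_one_div_tendsto_nhds_spectralRadius (1 - (e : ℂ) • A)
  obtain ⟨m, hm, hm0⟩ := ((hg.eventually (gt_mem_nhds hrad)).and
    (Filter.eventually_gt_atTop 0)).exists
  refine ⟨m, ?_, hm0⟩
  have hlt : ‖(1 - (e : ℂ) • A) ^ m‖ ^ (1 / m : ℝ) < 1 - e * c' :=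
    (ENNReal.ofReal_lt_ofReal_iff (by linarith)).1 hm
  calc ‖(1 - (e : ℂ) • A) ^ m‖ = (‖(1 - (e : ℂ) • A) ^ m‖ ^ (1 / m : ℝ)) ^ m := by
        rw [← Real.rpow_natCast, ← Real.rpow_mul (norm_nonneg _), one_div,
          inv_mul_cancel₀ (by positivity), Real.rpow_one]
    _ ≤ _ := by gcongr

lemma act_mul {d : ℕ} (A B : Matrix (Fin d) (Fin d) ℝ) (v : Vec d) :
    act (A * B) v = act A (act B v) := by
  simp [act, Matrix.mulVec_mulVec]

/-- A Euclidean norm on `ℝ^d` that contracts under small steps against a matrix whose spectrum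
lies in a half plane. -/
theorem exists_contracting_norm {d : ℕ} {A : Matrix (Fin d) (Fin d) ℝ} {c : ℝ}
    (hA : EigenvaluesReGT A c) :
    ∃ (m : ℕ) (Φ : Vec d →L[ℝ] PiLp 2 (fun _ : Fin m => Vec d)) (c' e : ℝ), c < c' ∧ 0 < e ∧
      (∀ v, ‖v‖ ≤ ‖Φ v‖) ∧
      ∀ t, 0 ≤ t → t ≤ e → ∀ v, ‖Φ (v - t • act A v)‖ ≤ (1 - t * c') * ‖Φ v‖ := by
  obtain ⟨c', hc', e, he, hec, m, hm, hm0⟩ := exists_norm_pow_le hA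
  set B : Matrix (Fin d) (Fin d) ℝ := 1 - e • A with hB
  set r := 1 - e * c' with hr
  have hr0 : 0 < r := by linarith
  have hBmap : (B ^ m).map (algebraMap ℝ ℂ)
      = (1 - (e : ℂ) • A.map (algebraMap ℝ ℂ)) ^ m := by
    change (algebraMap ℝ ℂ).mapMatrix (B ^ m) = _
    rw [map_pow, hB, map_sub, map_one]
    congr 2
    ext i j
    simp
  have hBm : ∀ v, ‖act (B ^ m) v‖ ≤ r ^ m * ‖v‖ := fun v =>
    norm_act_le_of_norm_map_le _ (by rw [hBmap]; exact hm) v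
  -- The adapted norm is `‖Φ v‖² = ∑_{n<m} r^{-2n} ‖Bⁿ v‖²`. Taking values in an `ℓ²` sum keeps it
  -- Euclidean.
  let Φ : Vec d →L[ℝ] PiLp 2 (fun _ : Fin m => Vec d) :=
    (PiLp.continuousLinearEquiv 2 ℝ (fun _ : Fin m => Vec d)).symm.toContinuousLinearMap.comp
      (ContinuousLinearMap.pi fun n : Fin m =>
        (r⁻¹) ^ (n : ℕ) • Matrix.toEuclideanCLM (𝕜 := ℝ) (B ^ (n : ℕ)))
  have hΦ : ∀ v, ‖Φ v‖ ^ 2 = ∑ n ∈ Finset.range m, ((r⁻¹) ^ n * ‖act (B ^ n) v‖) ^ 2 := by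
    intro v
    rw [PiLp.norm_sq_eq_of_L2, ← Fin.sum_univ_eq_sum_range
      (fun n => ((r⁻¹) ^ n * ‖act (B ^ n) v‖) ^ 2)]
    refine Finset.sum_congr rfl fun n _ => ?_
    have : (Φ v) n = (r⁻¹) ^ (n : ℕ) • act (B ^ (n : ℕ)) v := rfl
    rw [this, norm_smul, Real.norm_of_nonneg (by positivity)]
  -- Applying `B` shifts the sum by one index; the new term `n = m` is at most the lost term `n = 0`
  -- since `‖Bᵐ‖ ≤ rᵐ`.
  have hstep : ∀ v, ‖Φ (act B v)‖ ≤ r * ‖Φ v‖ := by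
    intro v
    refine abs_le_of_sq_le_sq' ?_ (by positivity) |>.2
    rw [mul_pow, hΦ, hΦ, Finset.mul_sum]
    have e1 : ∀ n, ((r⁻¹) ^ n * ‖act (B ^ n) (act B v)‖) ^ 2
        = r ^ 2 * ((r⁻¹) ^ (n + 1) * ‖act (B ^ (n + 1)) v‖) ^ 2 := by
      intro n
      rw [← act_mul, ← pow_succ, pow_succ (r⁻¹)]
      field_simp
    simp only [e1]
    rw [← Finset.mul_sum, ← Finset.mul_sum]
    gcongr 1
    have := Finset.sum_range_succ (fun n => ((r⁻¹) ^ n * ‖act (B ^ n) v‖) ^ 2) m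
    rw [Finset.sum_range_succ'] at this
    have hl : ((r⁻¹) ^ m * ‖act (B ^ m) v‖) ^ 2 ≤ ((r⁻¹) ^ 0 * ‖act (B ^ 0) v‖) ^ 2 := by
      have h1 : act (B ^ 0) v = v := by simp [act]
      rw [h1]
      refine pow_le_pow_left₀ (by positivity) ?_ 2
      rw [inv_pow, pow_zero, one_mul, inv_mul_le_iff₀ (by positivity)]
      exact hBm v
    linarith
  refine ⟨m, Φ, c', e, hc', he, fun v => ?_, fun t ht hte v => ?_⟩
  · refine abs_le_of_sq_le_sq' ?_ (norm_nonneg _) |>.2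
    rw [hΦ]
    have := Finset.single_le_sum (f := fun n => ((r⁻¹) ^ n * ‖act (B ^ n) v‖) ^ 2)
      (fun n _ => sq_nonneg _) (Finset.mem_range.2 hm0)
    simpa [act] using this
  -- A step `t ≤ e` is a convex combination of the identity and `B`.
  · have hv : v - t • act A v = (1 - t / e) • v + (t / e) • act B v := by
      have : act B v = v - e • act A v := by
        simp [hB, act, Matrix.sub_mulVec, Matrix.smul_mulVec]
      rw [this, smul_sub, smul_smul, div_mul_cancel₀ _ he.ne', sub_smul, one_smul]
      abel
    have ht1 : t / e ≤ 1 := (div_le_one he).2 hte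
    have ht0 : 0 ≤ t / e := by positivity
    rw [hv, map_add, map_smul, map_smul]
    calc _ ≤ (1 - t / e) * ‖Φ v‖ + (t / e) * (r * ‖Φ v‖) := by
          refine (norm_add_le _ _).trans ?_
          rw [norm_smul, norm_smul, Real.norm_of_nonneg ht0, Real.norm_of_nonneg (by linarith)]
          gcongr
          exact hstep v
      _ = _ := by rw [hr]; field_simp; ring

/-! ### Second singular value and contraction of doubly stochastic matrices. -/

open Module in
/-- If `u` is fixed by `T* T` and the second singular value of `T` is less than one, then that
singular value bounds `T` on the orthogonal complement of `u`. -/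
theorem LinearMap.norm_le_singularValues_one_mul {E F : Type*} [NormedAddCommGroup E]
    [InnerProductSpace ℝ E] [FiniteDimensional ℝ E] [NormedAddCommGroup F]
    [InnerProductSpace ℝ F] [FiniteDimensional ℝ F] (T : E →ₗ[ℝ] F) {u : E} (hu : u ≠ 0)
    (hTu : T.adjoint (T u) = u) (hlt : T.singularValues 1 < 1) {v : E} (hv : inner ℝ u v = 0) :
    ‖T v‖ ≤ T.singularValues 1 * ‖v‖ := by
  set S := T.adjoint ∘ₗ T
  have hS : S.IsSymmetric := T.isSymmetric_adjoint_comp_self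
  set b := hS.eigenvectorBasis rfl with hb
  have hval : ∀ i : Fin (finrank ℝ E), S (b i) = (T.singularValues i ^ 2) • b i := by
    intro i
    have := hS.apply_eigenvectorBasis rfl i
    rw [T.sq_singularValues_fin rfl i]
    exact this
  have hle : ∀ i : Fin (finrank ℝ E), (i : ℕ) ≠ 0 → T.singularValues i ≤ T.singularValues 1 :=
    fun i hi => T.singularValues_antitone (Nat.one_le_iff_ne_zero.2 hi)
  -- Eigenvectors of a symmetric operator for different eigenvalues are orthogonal, and `u` has
  -- eigenvalue one while these have eigenvalue less than one. So `u` is a multiple of `b 0`.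
  have hort : ∀ i : Fin (finrank ℝ E), (i : ℕ) ≠ 0 → inner ℝ (b i) u = 0 := by
    intro i hi
    have h1 : inner ℝ (S (b i)) u = inner ℝ (b i) (S u) := hS (b i) u
    rw [hval, show S u = u from hTu, real_inner_smul_left] at h1
    have h2 : T.singularValues i ^ 2 < 1 :=
      pow_lt_one₀ (T.singularValues_nonneg i) ((hle i hi).trans_lt hlt) two_ne_zero
    by_contra hne
    have : T.singularValues i ^ 2 = 1 := by
      have := mul_right_cancel₀ hne (h1.trans (one_mul _).symm)
      exact this
    linarith
  have hzero : ∀ i : Fin (finrank ℝ E), (i : ℕ) = 0 → inner ℝ (b i) v = 0 := by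
    intro i hi
    have hsum := b.sum_inner_mul_inner u v
    have hsu := b.sum_inner_mul_inner u u
    rw [Finset.sum_eq_single i] at hsum hsu
    · rw [hv] at hsum
      rcases mul_eq_zero.1 hsum with h | h
      · rw [h, zero_mul] at hsu
        exact absurd (inner_self_eq_zero.1 hsu.symm) hu
      · exact h
    · intro j _ hj
      rw [hort j (fun h => hj (Fin.ext (h.trans hi.symm))), mul_zero]
    · simp
    · intro j _ hj
      rw [real_inner_comm, hort j (fun h => hj (Fin.ext (h.trans hi.symm))), zero_mul]
    · simp
  refine abs_le_of_sq_le_sq' ?_ (mul_nonneg (T.singularValues_nonneg 1) (norm_nonneg _)) |>.2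
  have h1 : ‖T v‖ ^ 2 = inner ℝ (S v) v := by
    rw [← real_inner_self_eq_norm_sq]
    exact (LinearMap.adjoint_inner_left T v (T v)).symm
  rw [h1, mul_pow, ← real_inner_self_eq_norm_sq v, ← b.sum_inner_mul_inner (S v) v,
    ← b.sum_inner_mul_inner v v, Finset.mul_sum]
  refine Finset.sum_le_sum fun i _ => ?_
  have h2 : inner ℝ (S v) (b i) = T.singularValues i ^ 2 * inner ℝ v (b i) := by
    rw [hS v (b i), hval, real_inner_smul_right]
  rw [h2, mul_assoc]
  by_cases hi : (i : ℕ) = 0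
  · simp [hzero i hi]
  · have h3 : inner ℝ v (b i) * inner ℝ (b i) v = (inner ℝ (b i) v) ^ 2 := by
      rw [real_inner_comm, sq]
    have := T.singularValues_nonneg i
    have := hle i hi
    rw [h3]
    gcongr

/-- The all-ones vector is fixed by both `W` and `Wᵀ`, so it serves as the fixed vector `u`, and
zero sum is orthogonality to it. -/
lemma mulVec_contract_of_doublyStochastic {N : ℕ} {W : Matrix (Fin N) (Fin N) ℝ}
    (hW : W ∈ doublyStochastic ℝ (Fin N)) (hN : 0 < N) (hlt : secondSingularValue W < 1)
    {v : Fin N → ℝ} (hv : ∑ i, v i = 0) :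
    ∑ i, (∑ j, W i j * v j) ^ 2 ≤ secondSingularValue W ^ 2 * ∑ i, v i ^ 2 := by
  set T := Matrix.toEuclideanLin W with hT
  set u : EuclideanSpace ℝ (Fin N) := WithLp.toLp 2 1 with hu
  have hu0 : u ≠ 0 := by
    intro h
    have := congrArg (fun z : EuclideanSpace ℝ (Fin N) => z ⟨0, hN⟩) h
    simp [hu] at this
  obtain ⟨-, hW1, hW2⟩ := mem_doublyStochastic.1 hW
  have hadj : T.adjoint = Matrix.toEuclideanLin Wᵀ := by
    rw [hT, ← Matrix.conjTranspose_eq_transpose_of_trivial,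
      Matrix.toEuclideanLin_conjTranspose_eq_adjoint]
  have hTu : T.adjoint (T u) = u := by
    rw [hadj]
    have h1 : T u = u := by
      rw [hT, hu, Matrix.toLpLin_toLp, Matrix.toLin'_apply, hW1]
    rw [h1, hu, Matrix.toLpLin_toLp, Matrix.toLin'_apply, Matrix.mulVec_transpose, hW2]
  have hv' : inner ℝ u (WithLp.toLp 2 v : EuclideanSpace ℝ (Fin N)) = 0 := by
    simpa [hu, PiLp.inner_apply] using hv
  have h := T.norm_le_singularValues_one_mul hu0 hTu hlt hv'
  have h2 := pow_le_pow_left₀ (norm_nonneg _) h 2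
  rw [mul_pow, EuclideanSpace.norm_sq_eq, EuclideanSpace.norm_sq_eq] at h2
  simpa [hT, Matrix.toLpLin_toLp, Matrix.mulVec, dotProduct, secondSingularValue] using h2

/-! ### Decay of a scalar recursion. -/

/-- Bernoulli's inequality for the exponent `2/3`, followed by `(1 - y)(1 + y) ≤ 1`. -/
lemma add_one_rpow_two_thirds_mul_le {x : ℝ} (hx : 0 < x) :
    (1 - 2 / 3 / x) * (x + 1) ^ (2 / 3 : ℝ) ≤ x ^ (2 / 3 : ℝ) := by
  have h1 : (1 + 1 / x) ^ (2 / 3 : ℝ) ≤ 1 + 2 / 3 * (1 / x) :=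
    rpow_one_add_le_one_add_mul_self (le_trans (by norm_num) (by positivity : (0 : ℝ) ≤ 1 / x))
      (by norm_num) (by norm_num)
  have h2 : (x + 1) ^ (2 / 3 : ℝ) = x ^ (2 / 3 : ℝ) * (1 + 1 / x) ^ (2 / 3 : ℝ) := by
    rw [← Real.mul_rpow hx.le (by positivity)]
    congr 1
    field_simp
  have h3 : (1 - 2 / 3 / x) * (1 + 1 / x) ^ (2 / 3 : ℝ) ≤ 1 := by
    have h0 : 0 ≤ (1 + 1 / x) ^ (2 / 3 : ℝ) := by positivity
    have h4 : 0 < 1 / x := by positivity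
    have h5 : 2 / 3 / x = 2 / 3 * (1 / x) := by ring
    rw [h5]
    by_cases h : 0 ≤ 1 - 2 / 3 * (1 / x)
    · nlinarith [mul_le_mul_of_nonneg_left h1 h]
    · nlinarith
  have hp : 0 < x ^ (2 / 3 : ℝ) := by positivity
  rw [h2]
  nlinarith

/-- Decay of a scalar recursion whose contraction rate beats `(k+1)^{-2/3}`. -/
theorem exists_decay_bound {s C z₀ : ℝ} {G : ℕ → ℝ} (hs : 2 / 3 < s) (hG : ∀ k, 0 ≤ G k)
    (hz₀ : 0 ≤ z₀) (k₀ : ℕ) :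
    ∃ D : ℝ, 0 ≤ D ∧ ∀ Z : ℕ → ℝ, (∀ k, 0 ≤ Z k) → Z 0 ≤ z₀ →
      (∀ k, Z (k + 1) ≤ G k * Z k + G k) →
      (∀ k, k₀ ≤ k → Z (k + 1) ≤ (1 - s / ((k : ℝ) + 1)) * Z k
        + C / (((k : ℝ) + 1) * ((k : ℝ) + 1) ^ (2 / 3 : ℝ))) →
      ∀ k : ℕ, Z k ≤ D / ((k : ℝ) + 1) ^ (2 / 3 : ℝ) := by
  set k₁ := max k₀ ⌈s⌉₊ with hk₁
  set Q : ℕ → ℝ := fun k => ∏ j ∈ Finset.range k, (G j + 1) with hQ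
  have hQ0 : ∀ k, 0 ≤ Q k := fun k => Finset.prod_nonneg fun j _ => by linarith [hG j]
  have hQm : Monotone Q := monotone_nat_of_le_succ fun k => by
    simp only [hQ, Finset.prod_range_succ]
    exact le_mul_of_one_le_right (hQ0 k) (by linarith [hG k])
  -- The first entry covers the times up to `k₁`, where only the crude growth bound is available;
  -- the second makes the forcing at most the surplus `s - 2/3` of the contraction.
  set D := max ((z₀ + 1) * Q k₁ * ((k₁ : ℝ) + 1) ^ (2 / 3 : ℝ)) (C / (s - 2 / 3)) with hD
  have hD0 : 0 ≤ D := le_max_of_le_left (by have := hQ0 k₁; positivity)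
  refine ⟨D, hD0, fun Z hZ hZ0 hcrude hfine => ?_⟩
  have hearly : ∀ k, Z k + 1 ≤ (z₀ + 1) * Q k := by
    intro k
    induction k with
    | zero => simpa [hQ] using hZ0
    | succ k ih =>
      simp only [hQ, Finset.prod_range_succ]
      have := hcrude k
      have := hZ k
      nlinarith [mul_le_mul_of_nonneg_right ih (by linarith [hG k] : 0 ≤ G k + 1)]
  have hle : ∀ k ≤ k₁, Z k ≤ D / ((k : ℝ) + 1) ^ (2 / 3 : ℝ) := by
    intro k hk
    rw [le_div_iff₀ (by positivity)]
    refine le_trans ?_ (le_max_left _ _)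
    have h1 : Z k ≤ (z₀ + 1) * Q k₁ :=
      calc Z k ≤ (z₀ + 1) * Q k := by linarith [hearly k]
        _ ≤ _ := by gcongr; exact hQm hk
    have := hQ0 k₁
    gcongr
  intro k
  rcases le_total k k₁ with hk | hk
  · exact hle k hk
  induction k, hk using Nat.le_induction with
  | base => exact hle _ le_rfl
  | succ k hk ih =>
    have hf := hfine k ((le_max_left _ _).trans hk)
    have hks : s ≤ k := (Nat.le_ceil s).trans (by exact_mod_cast (le_max_right _ _).trans hk)
    set x : ℝ := (k : ℝ) + 1 with hx
    have hx0 : 0 < x := by positivity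
    have hp : 0 < x ^ (2 / 3 : ℝ) := by positivity
    have hcast : (((k + 1 : ℕ) : ℝ) + 1) = x + 1 := by push_cast; ring
    rw [hcast, le_div_iff₀ (by positivity)]
    have hb := add_one_rpow_two_thirds_mul_le hx0
    have hDC : C ≤ D * (s - 2 / 3) := by
      rw [← div_le_iff₀ (by linarith)]; exact le_max_right _ _
    have hsx : 0 ≤ 1 - s / x := by
      rw [sub_nonneg, div_le_one hx0]; linarith
    have h1 : Z (k + 1) ≤ D / x ^ (2 / 3 : ℝ) * (1 - 2 / 3 / x) := by
      calc Z (k + 1) ≤ (1 - s / x) * (D / x ^ (2 / 3 : ℝ)) + C / (x * x ^ (2 / 3 : ℝ)) :=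
            hf.trans (by gcongr)
        _ ≤ (1 - s / x) * (D / x ^ (2 / 3 : ℝ)) + D * (s - 2 / 3) / (x * x ^ (2 / 3 : ℝ)) := by
            gcongr
        _ = _ := by field_simp; ring
    calc Z (k + 1) * (x + 1) ^ (2 / 3 : ℝ)
        ≤ D / x ^ (2 / 3 : ℝ) * (1 - 2 / 3 / x) * (x + 1) ^ (2 / 3 : ℝ) := by gcongr
      _ = D / x ^ (2 / 3 : ℝ) * ((1 - 2 / 3 / x) * (x + 1) ^ (2 / 3 : ℝ)) := by ring
      _ ≤ D / x ^ (2 / 3 : ℝ) * x ^ (2 / 3 : ℝ) := by gcongr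
      _ = D := by field_simp

/-! ### Sums of powers of cube roots and relative step sizes. -/

/-- The real cube root of a natural number. -/
noncomputable def cbrt (n : ℕ) : ℝ := (n : ℝ) ^ (1 / 3 : ℝ)

lemma cbrt_pow_three (n : ℕ) : cbrt n ^ 3 = n := by
  rw [cbrt, ← Real.rpow_natCast, ← Real.rpow_mul (Nat.cast_nonneg n)]
  norm_num

lemma cbrt_nonneg (n : ℕ) : 0 ≤ cbrt n := by unfold cbrt; positivity

lemma cbrt_mono {m n : ℕ} (h : m ≤ n) : cbrt m ≤ cbrt n := by
  unfold cbrt; gcongr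

lemma cbrt_one : cbrt 1 = 1 := by simp [cbrt]

lemma one_le_cbrt {n : ℕ} (h : 1 ≤ n) : 1 ≤ cbrt n := cbrt_one ▸ cbrt_mono h

lemma cbrt_succ_pow_three (n : ℕ) : cbrt (n + 1) ^ 3 = cbrt n ^ 3 + 1 := by
  rw [cbrt_pow_three, cbrt_pow_three]; push_cast; ring

lemma cbrt_succ_pos (n : ℕ) : 0 < cbrt (n + 1) :=
  zero_lt_one.trans_le (one_le_cbrt (Nat.le_add_left 1 n))

lemma three_mul_log_cbrt {n : ℕ} : 3 * Real.log (cbrt n) = Real.log n := by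
  rw [← cbrt_pow_three n, Real.log_pow]; norm_num

lemma sum_cbrt_sq_le (K : ℕ) :
    ∑ t ∈ Finset.range K, cbrt (t + 1) ^ 2 ≤ 3 / 5 * cbrt K ^ 5 + 1 / 2 * cbrt K ^ 2 := by
  induction K with
  | zero => simp; have := cbrt_nonneg 0; positivity
  | succ n ih =>
    rw [Finset.sum_range_succ]
    have h3 := cbrt_succ_pow_three n
    have hb := cbrt_nonneg n
    have hcb := cbrt_mono (Nat.le_add_right n 1)
    set c := cbrt (n + 1)
    set b := cbrt n
    -- The trapezoidal rule lies below the integral of the concave function `t^{2/3}`; the factor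
    -- `(c - b)³` is its error.
    have key : 0 ≤ (c - b) ^ 3 * (c ^ 2 + 3 * c * b + b ^ 2) := by
      have : 0 ≤ c - b := by linarith
      have : 0 ≤ c := by linarith
      positivity
    have e1 : (c - b) ^ 3 * (c ^ 2 + 3 * c * b + b ^ 2)
        = 6 * (c ^ 5 - b ^ 5) - 5 * (c ^ 2 + b ^ 2) * (c ^ 3 - b ^ 3) := by ring
    rw [e1, h3] at key
    nlinarith

lemma sum_inv_cbrt_le {K : ℕ} (hK : 1 ≤ K) :
    ∑ t ∈ Finset.range K, 1 / cbrt (t + 1) ≤ 3 / 2 * cbrt K ^ 2 - 1 / 2 := by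
  induction K, hK using Nat.le_induction with
  | base => simp [cbrt_one]; norm_num
  | succ n hn ih =>
    rw [Finset.sum_range_succ]
    have h3 := cbrt_succ_pow_three n
    have hb := cbrt_nonneg n
    have hc := cbrt_succ_pos n
    have hcb := cbrt_mono (Nat.le_add_right n 1)
    set c := cbrt (n + 1)
    set b := cbrt n
    have : 1 / c ≤ 3 / 2 * (c ^ 2 - b ^ 2) := by
      rw [div_le_iff₀ hc]
      have : 0 ≤ (c - b) ^ 2 * (c + 2 * b) := by positivity
      nlinarith
    linarith

lemma inv_cbrt_sq_le (n : ℕ) : 1 / cbrt (n + 1) ^ 2 ≤ 3 * (cbrt (n + 1) - cbrt n) := by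
  have h3 := cbrt_succ_pow_three n
  have hb := cbrt_nonneg n
  have hc := cbrt_succ_pos n
  have hcb := cbrt_mono (Nat.le_add_right n 1)
  set c := cbrt (n + 1)
  set b := cbrt n
  rw [div_le_iff₀ (by positivity)]
  have : 0 ≤ (c - b) ^ 2 * (2 * c + b) := by positivity
  nlinarith

lemma inv_cbrt_cube_le {n : ℕ} (hn : 1 ≤ n) :
    1 / cbrt (n + 1) ^ 3 ≤ Real.log ((n + 1 : ℕ) : ℝ) - Real.log n := by
  rw [cbrt_pow_three]
  have hn0 : (0 : ℝ) < n := by exact_mod_cast hn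
  have h := Real.one_sub_inv_le_log_of_pos (x := ((n + 1 : ℕ) : ℝ) / n) (by positivity)
  rw [Real.log_div (by positivity) (by positivity)] at h
  refine le_trans (le_of_eq ?_) h
  push_cast
  field_simp
  ring

lemma sum_inv_cbrt_sq_le {K : ℕ} (hK : 1 ≤ K) :
    ∑ t ∈ Finset.range K, 1 / cbrt (t + 1) ^ 2 ≤ 3 * cbrt K - 2 := by
  induction K, hK using Nat.le_induction with
  | base => simp [cbrt_one]; norm_num
  | succ n hn ih =>
    rw [Finset.sum_range_succ]
    linarith [inv_cbrt_sq_le n]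

lemma sum_inv_cbrt_cube_le {K : ℕ} (hK : 1 ≤ K) :
    ∑ t ∈ Finset.range K, 1 / cbrt (t + 1) ^ 3 ≤ 1 + Real.log K := by
  induction K, hK using Nat.le_induction with
  | base => simp [cbrt_one]
  | succ n hn ih =>
    rw [Finset.sum_range_succ]
    linarith [inv_cbrt_cube_le hn]

/-- The relative step size `(K/m)^{2/3} (1 + m^{-1/3})` at the index `m = t + 1`. -/
noncomputable def relStep (K t : ℕ) : ℝ :=
  cbrt K ^ 2 * (1 / cbrt (t + 1) ^ 2 + 1 / cbrt (t + 1) ^ 3)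

lemma relStep_nonneg (K t : ℕ) : 0 ≤ relStep K t := by
  have := cbrt_succ_pos t
  unfold relStep; positivity

lemma relStep_antitone (K : ℕ) : Antitone (relStep K) := by
  intro s t hst
  have h1 := cbrt_succ_pos s
  have h2 : cbrt (s + 1) ≤ cbrt (t + 1) := cbrt_mono (by omega)
  unfold relStep
  gcongr

lemma one_add_inv_le_relStep {K t : ℕ} (h : t < K) : 1 + 1 / cbrt K ≤ relStep K t := by
  have h1 := cbrt_succ_pos t
  have h2 : cbrt (t + 1) ≤ cbrt K := cbrt_mono h
  have h3 : relStep K t = (cbrt K / cbrt (t + 1)) ^ 2 * (1 + 1 / cbrt (t + 1)) := by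
    unfold relStep; field_simp
  have h4 : 1 ≤ cbrt K / cbrt (t + 1) := (one_le_div h1).2 h2
  have h5 : 1 / cbrt K ≤ 1 / cbrt (t + 1) := by gcongr
  have h6 : 0 ≤ 1 / cbrt (t + 1) := by positivity
  rw [h3]
  nlinarith [one_le_pow₀ h4 (n := 2)]

/-- The constant `4` is exactly what makes the exponents in `growth_le_of_le_quarter` sum to at most
zero. -/
lemma sum_relStep_le {K : ℕ} (hK : 1 ≤ K) :
    ∑ t ∈ Finset.range K, relStep K t ≤ 4 * K := by
  have hL := one_le_cbrt hK
  unfold relStep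
  rw [← Finset.mul_sum, Finset.sum_add_distrib, ← cbrt_pow_three K]
  have h1 := sum_inv_cbrt_sq_le hK
  have h2 := sum_inv_cbrt_cube_le hK
  rw [← three_mul_log_cbrt] at h2
  -- The tangent to the logarithm at `4`.
  have h3 : Real.log (cbrt K) ≤ cbrt K / 4 - 1 + 2 * Real.log 2 := by
    have := Real.log_le_sub_one_of_pos (x := cbrt K / 4) (by positivity)
    rw [Real.log_div (by positivity) (by norm_num), show (4 : ℝ) = 2 ^ 2 by norm_num,
      Real.log_pow] at this
    norm_num at this ⊢
    linarith
  have := Real.log_two_lt_d9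
  calc _ ≤ cbrt K ^ 2 * ((3 * cbrt K - 2) + (1 + 3 * Real.log (cbrt K))) := by gcongr
    _ ≤ cbrt K ^ 2 * (4 * cbrt K) := by gcongr; linarith
    _ = _ := by ring

/-- Past time `K` the factor `(K/m)^{2/3}` is below one, but the extra `m^{-1/3}` can keep the
relative step above one for a while; this measures the total excess. -/
lemma sum_relStep_sub_one_le {K : ℕ} (hK : 1 ≤ K) {k : ℕ} (hk : K ≤ k) :
    ∑ t ∈ Finset.Ico K k, max (relStep K t - 1) 0 ≤ 3 / 4 * cbrt K := by
  have hL := one_le_cbrt hK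
  -- An antiderivative of `relStep K - 1`, regarded as a function of the time.
  set ψ : ℕ → ℝ := fun t => 3 * cbrt K ^ 2 * cbrt t + cbrt K ^ 2 * Real.log t - t with hψ
  have hψstep : ∀ t, K ≤ t → relStep K t - 1 ≤ ψ (t + 1) - ψ t := by
    intro t ht
    have h1 := inv_cbrt_sq_le t
    have h2 := inv_cbrt_cube_le (hK.trans ht)
    have h3 : relStep K t ≤ cbrt K ^ 2 * (3 * (cbrt (t + 1) - cbrt t)
        + (Real.log ((t + 1 : ℕ) : ℝ) - Real.log t)) := by
      unfold relStep; gcongr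
    simp only [hψ]
    push_cast at *
    linarith
  -- With `L = cbrt K` and `u = cbrt t - L`, the difference is at most `3L(u - u²) - u³`, and `u -
  -- u² ≤ 1/4`.
  have hψle : ∀ t, K ≤ t → ψ t - ψ K ≤ 3 / 4 * cbrt K := by
    intro t ht
    have hm := cbrt_mono ht
    have ht0 : 0 < cbrt t := by linarith
    have h1 := Real.log_le_sub_one_of_pos (x := cbrt t / cbrt K) (by positivity)
    rw [Real.log_div (by positivity) (by positivity)] at h1
    have h2 : cbrt K ^ 2 * (3 * (Real.log (cbrt t) - Real.log (cbrt K)))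
        ≤ 3 * cbrt K * (cbrt t - cbrt K) := by
      calc _ ≤ cbrt K ^ 2 * (3 * (cbrt t / cbrt K - 1)) := by gcongr
        _ = _ := by field_simp
    simp only [hψ]
    have h3 := cbrt_pow_three K
    rw [← three_mul_log_cbrt, ← three_mul_log_cbrt, ← cbrt_pow_three t]
    nlinarith [sq_nonneg (cbrt t - cbrt K - 1 / 2), pow_nonneg (sub_nonneg.2 hm) 3]
  -- The potential bounds the sum only while the terms are positive. By monotonicity, once `relStep`
  -- drops to one the sum stops growing.
  suffices h : ∑ t ∈ Finset.Ico K k, max (relStep K t - 1) 0 ≤ 3 / 4 * cbrt K ∧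
      (∑ t ∈ Finset.Ico K k, max (relStep K t - 1) 0 ≤ ψ k - ψ K ∨ relStep K k ≤ 1) from h.1
  induction k, hk using Nat.le_induction with
  | base => simp; linarith
  | succ k hk ih =>
    obtain ⟨ih1, ih2⟩ := ih
    rw [Finset.sum_Ico_succ_top hk]
    by_cases hw : relStep K k ≤ 1
    · rw [max_eq_right (by linarith), add_zero]
      exact ⟨ih1, Or.inr ((relStep_antitone K (Nat.le_succ k)).trans hw)⟩
    · have ih2 := ih2.resolve_right hw
      rw [max_eq_left (by linarith)]
      have h1 := hψstep k hk
      have h2 := hψle (k + 1) (by omega)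
      exact ⟨by linarith, Or.inl (by linarith)⟩

/-! ### Growth of the consensus majorant. -/

/-- The growth majorant of the consensus error: `h₀ = 1` and
`h_{k+1} = (σ + a (k+1)^{-2/3} + a (k+1)^{-1}) h_k + 1 - σ`. -/
noncomputable def growth (σ a : ℝ) : ℕ → ℝ
  | 0 => 1
  | k + 1 => (σ + a * (1 / cbrt (k + 1) ^ 2 + 1 / cbrt (k + 1) ^ 3)) * growth σ a k + (1 - σ)

lemma Finset.one_le_prod_real {ι : Type*} {s : Finset ι} {f : ι → ℝ} (h : ∀ i ∈ s, 1 ≤ f i) :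
    1 ≤ ∏ i ∈ s, f i := by
  simpa using Finset.prod_le_prod (s := s) (f := fun _ => (1 : ℝ)) (fun _ _ => zero_le_one) h

lemma Finset.prod_range_le_prod_range {f : ℕ → ℝ} {m n : ℕ} (hmn : m ≤ n)
    (h : ∀ i < n, 1 ≤ f i) : ∏ i ∈ Finset.range m, f i ≤ ∏ i ∈ Finset.range n, f i := by
  rw [← Finset.prod_range_mul_prod_Ico _ hmn]
  refine le_mul_of_one_le_right (Finset.prod_nonneg fun t ht => ?_)
    (Finset.one_le_prod_real fun t ht => h t (Finset.mem_Ico.1 ht).2)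
  linarith [h t (by have := Finset.mem_range.1 ht; omega)]

section

variable {σ δ a : ℝ}

lemma rho_nonneg (ha : 0 ≤ a) (k : ℕ) :
    0 ≤ a * (1 / cbrt (k + 1) ^ 2 + 1 / cbrt (k + 1) ^ 3) := by
  have := cbrt_succ_pos k
  positivity

lemma one_le_growth (hσ : 0 ≤ σ) (ha : 0 ≤ a) (k : ℕ) : 1 ≤ growth σ a k := by
  induction k with
  | zero => simp [growth]
  | succ k ih =>
    have := rho_nonneg ha k
    rw [growth]
    nlinarith

lemma rho_le_relStep {K : ℕ} {η : ℝ} (h : a ≤ η * cbrt K ^ 2) (k : ℕ) :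
    a * (1 / cbrt (k + 1) ^ 2 + 1 / cbrt (k + 1) ^ 3) ≤ η * relStep K k := by
  have := cbrt_succ_pos k
  have h1 : 0 ≤ 1 / cbrt (k + 1) ^ 2 + 1 / cbrt (k + 1) ^ 3 := by positivity
  unfold relStep
  rw [← mul_assoc]
  gcongr

/-- Growth bound when the first step is already contracting up to the slow step. -/
lemma growth_le_of_le_sub (hσ : 0 < σ) (hσ2 : σ ≤ 1 / 2) (ha : 0 ≤ a) (hδ : δ < 1)
    (haδ : a ≤ δ - σ) (k : ℕ) : growth σ a k ≤ (1 + 6 * a) / (1 - δ) := by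
  have hδ0 : 0 < 1 - δ := by linarith
  rw [le_div_iff₀ hδ0]
  have ha1 : a ≤ 1 := by linarith
  have hg1 : growth σ a 1 = 1 + 2 * a := by
    simp [growth, cbrt_one]; ring
  have hc2 : cbrt 2 ^ 3 = 2 := by rw [cbrt_pow_three]; norm_num
  have hc3 : cbrt 3 ^ 3 = 3 := by rw [cbrt_pow_three]; norm_num
  have hc2' : 5 / 4 ≤ cbrt 2 := by
    by_contra! h
    have := pow_lt_pow_left₀ h (cbrt_nonneg 2) three_ne_zero
    rw [hc2] at this; norm_num at this
  have hc3' : 10 / 7 ≤ cbrt 3 := by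
    by_contra! h
    have := pow_lt_pow_left₀ h (cbrt_nonneg 3) three_ne_zero
    rw [hc3] at this; norm_num at this
  have hi2 : 1 / cbrt 2 ^ 2 ≤ 2 / 3 := by
    rw [div_le_iff₀ (by positivity)]; nlinarith
  have hi3 : 1 / cbrt 3 ^ 2 ≤ 1 / 2 := by
    rw [div_le_iff₀ (by positivity)]; nlinarith
  have hg2 : growth σ a 2 ≤ 1 + 9 / 2 * a := by
    rw [growth, hg1, show (1 + 1 : ℕ) = 2 from rfl, hc2]
    have h1 : a * (1 / cbrt 2 ^ 2 + 1 / 2) ≤ a * (7 / 6) := by gcongr; linarith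
    nlinarith [mul_nonneg ha (sub_nonneg.2 ha1), mul_nonneg ha (sub_nonneg.2 hσ2)]
  -- From `k = 2` on, `(k+1)^{-2/3} + (k+1)^{-1} ≤ 1/2 + 1/3`, so the multiplier is at most `σ + a ≤
  -- δ`.
  have hlate : ∀ k, 2 ≤ k → growth σ a k * (1 - δ) ≤ 1 + 6 * a := by
    intro k hk
    induction k, hk using Nat.le_induction with
    | base => nlinarith [one_le_growth hσ.le ha 2]
    | succ k hk ih =>
      have hcm : cbrt 3 ≤ cbrt (k + 1) := cbrt_mono (by omega)
      have hρ : 1 / cbrt (k + 1) ^ 2 + 1 / cbrt (k + 1) ^ 3 ≤ 1 := by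
        have h1 : 1 / cbrt (k + 1) ^ 2 ≤ 1 / cbrt 3 ^ 2 := by gcongr
        have h2 : 1 / cbrt (k + 1) ^ 3 ≤ 1 / cbrt 3 ^ 3 := by gcongr
        rw [hc3] at h2
        linarith
      have hg : σ + a * (1 / cbrt (k + 1) ^ 2 + 1 / cbrt (k + 1) ^ 3) ≤ δ := by
        nlinarith [mul_le_mul_of_nonneg_left hρ ha]
      have h0 := one_le_growth hσ.le ha k
      rw [growth]
      have h1 : (σ + a * (1 / cbrt (k + 1) ^ 2 + 1 / cbrt (k + 1) ^ 3)) * growth σ a k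
          ≤ δ * growth σ a k := by gcongr
      nlinarith
  rcases lt_or_ge k 2 with hk | hk
  · interval_cases k
    · simp [growth]; nlinarith
    · rw [hg1]; nlinarith
  · exact hlate k hk

/-- The inhomogeneous term `1 - σ` is absorbed by raising `σ` to one in the multiplier, as `growth ≥
1`. -/
lemma growth_le_prod (hσ : 0 ≤ σ) (hσ1 : σ ≤ 1) (ha : 0 ≤ a) (k : ℕ) :
    growth σ a k ≤
      ∏ t ∈ Finset.range k, (1 + a * (1 / cbrt (t + 1) ^ 2 + 1 / cbrt (t + 1) ^ 3)) := by
  induction k with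
  | zero => simp [growth]
  | succ k ih =>
    rw [Finset.prod_range_succ, growth]
    have h0 := one_le_growth hσ ha k
    have := rho_nonneg ha k
    have h2 : growth σ a k * (1 + a * (1 / cbrt (k + 1) ^ 2 + 1 / cbrt (k + 1) ^ 3)) ≤ _ :=
      mul_le_mul_of_nonneg_right ih (by linarith)
    nlinarith

/-- For moderate `a` the bound is free of `δ`: the product of the first `K` multipliers is at most
`σ^{-K}`, and afterwards the recursion is a contraction. -/
lemma growth_le_of_le_quarter (hσ : 0 < σ) (hσ2 : σ ≤ 1 / 2) (ha : 0 ≤ a) {K : ℕ} (hK : 2 ≤ K)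
    (haK : a ≤ 1 / 4 * cbrt K ^ 2) (k : ℕ) : growth σ a k ≤ 7 / 4 * (σ⁻¹) ^ K := by
  have hσi : 2 ≤ σ⁻¹ := by
    rw [le_inv_comm₀ (by norm_num) hσ]; linarith
  have hσK : 4 ≤ (σ⁻¹) ^ K :=
    calc (4 : ℝ) = 2 ^ 2 := by norm_num
      _ ≤ 2 ^ K := pow_le_pow_right₀ (by norm_num) hK
      _ ≤ _ := by gcongr
  have hρ : ∀ t, a * (1 / cbrt (t + 1) ^ 2 + 1 / cbrt (t + 1) ^ 3) ≤ 1 / 4 * relStep K t :=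
    rho_le_relStep haK
  have hprod : ∏ t ∈ Finset.range K, (1 + a * (1 / cbrt (t + 1) ^ 2 + 1 / cbrt (t + 1) ^ 3))
      ≤ (σ⁻¹) ^ K := by
    have h1 : ∏ t ∈ Finset.range K,
        (σ * (1 + a * (1 / cbrt (t + 1) ^ 2 + 1 / cbrt (t + 1) ^ 3))) ≤ 1 := by
      -- With `σ ≤ 1/2`, `σ(1 + ρ) ≤ 1 + (relStep/8 - 1/2)`, and the exponents sum to at most `4K/8
      -- - K/2`.
      calc _ ≤ ∏ t ∈ Finset.range K, Real.exp (relStep K t / 8 - 1 / 2) := by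
            refine Finset.prod_le_prod (fun t _ => ?_) fun t _ => ?_
            · have := rho_nonneg ha t
              positivity
            · refine le_trans ?_ (Real.add_one_le_exp _)
              have h1 := hρ t
              have h2 := rho_nonneg ha t
              nlinarith
        _ = Real.exp (∑ t ∈ Finset.range K, (relStep K t / 8 - 1 / 2)) :=
            (Real.exp_sum _ _).symm
        _ ≤ 1 := by
            rw [Real.exp_le_one_iff, Finset.sum_sub_distrib, ← Finset.sum_div]
            have := sum_relStep_le (one_le_two.trans hK)
            simp
            linarith
    rw [Finset.prod_mul_distrib] at h1
    simp only [Finset.prod_const, Finset.card_range] at h1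
    rw [inv_pow, ← one_div, le_div_iff₀ (by positivity), mul_comm]
    exact h1
  have hearly : ∀ k ≤ K, growth σ a k ≤ (σ⁻¹) ^ K := by
    intro k hk
    refine (growth_le_prod hσ.le (by linarith) ha k).trans (le_trans ?_ hprod)
    exact Finset.prod_range_le_prod_range hk fun t _ => by linarith [rho_nonneg ha t]
  rcases le_total k K with hk | hk
  · linarith [hearly k hk]
  induction k, hk using Nat.le_induction with
  | base => linarith [hearly K le_rfl]
  | succ k hk ih =>
    -- Here `k + 1 ≥ 3`. The multiplier is then at most `σ + 17/40 < 1`, and `7/4 · σ^{-K}` is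
    -- preserved because `σ ≤ 1/2` and `σ^{-K} ≥ 4`.
    have hw : relStep K k ≤ 17 / 10 := by
      have h1 : cbrt K ≤ cbrt (k + 1) := cbrt_mono (by omega)
      have h0 := cbrt_succ_pos k
      have hc : 10 / 7 ≤ cbrt (k + 1) := by
        by_contra! h
        have := pow_lt_pow_left₀ h h0.le three_ne_zero
        rw [cbrt_pow_three] at this
        have h3 : (3 : ℝ) ≤ ((k + 1 : ℕ) : ℝ) := by exact_mod_cast (by omega : 3 ≤ k + 1)
        norm_num at this h3; linarith
      calc relStep K k ≤ cbrt (k + 1) ^ 2 * (1 / cbrt (k + 1) ^ 2 + 1 / cbrt (k + 1) ^ 3) := by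
            unfold relStep; have := cbrt_nonneg K; gcongr
        _ = 1 + 1 / cbrt (k + 1) := by field_simp
        _ ≤ 17 / 10 := by
            have : 1 / cbrt (k + 1) ≤ 7 / 10 := by
              rw [div_le_iff₀ h0]; linarith
            linarith
    rw [growth]
    have h1 := hρ k
    have h2 := one_le_growth hσ.le ha k
    have h3 : (σ + a * (1 / cbrt (k + 1) ^ 2 + 1 / cbrt (k + 1) ^ 3)) * growth σ a k
        ≤ (σ + 17 / 40) * growth σ a k := by gcongr; linarith
    have h4 : (σ + 17 / 40) * growth σ a k ≤ (σ + 17 / 40) * (7 / 4 * (σ⁻¹) ^ K) := by gcongr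
    nlinarith

/-- After time `K` the multiplier is at most `δ(1 + p)` with `p` the excess of the relative step
over one. The factors `1 + p` multiply to at most `exp(3/4 · cbrt K)`, and `M(1 - δ) ≥ 1` absorbs
the term `1 - σ`. -/
lemma growth_le_of_early_of_late (hσ : 0 < σ) (ha : 0 ≤ a) (hσδ : σ < δ) (hδ : δ < 1) {K : ℕ}
    (hK : 1 ≤ K) (haK : a ≤ (δ - σ) * cbrt K ^ 2) {M : ℝ} (hM : 1 / (1 - δ) ≤ M)
    (hMK : ∀ k ≤ K, growth σ a k ≤ M) (k : ℕ) :
    growth σ a k ≤ M * Real.exp (3 / 4 * cbrt K) := by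
  have hδ0 : 0 < 1 - δ := by linarith
  have hM0 : 0 < M := lt_of_lt_of_le (by positivity) hM
  have hL := cbrt_nonneg K
  rcases le_total k K with hk | hk
  · exact (hMK k hk).trans (le_mul_of_one_le_right hM0.le (Real.one_le_exp (by positivity)))
  have hprod : ∀ k, K ≤ k →
      growth σ a k ≤ M * ∏ t ∈ Finset.Ico K k, (1 + max (relStep K t - 1) 0) := by
    intro k hk
    induction k, hk using Nat.le_induction with
    | base => simpa using hMK K le_rfl
    | succ k hk ih =>
      rw [Finset.prod_Ico_succ_top hk, growth]
      set E := ∏ t ∈ Finset.Ico K k, (1 + max (relStep K t - 1) 0) with hE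
      have hE1 : 1 ≤ E := by
        rw [hE]
        exact Finset.one_le_prod_real fun t _ => by linarith [le_max_right (relStep K t - 1) 0]
      set p := max (relStep K k - 1) 0
      have hp0 : 0 ≤ p := le_max_right _ _
      have hp1 : relStep K k - 1 ≤ p := le_max_left _ _
      have hρ := rho_le_relStep haK k
      have hg0 := one_le_growth hσ.le ha k
      have hρ0 := rho_nonneg ha k
      have hg : σ + a * (1 / cbrt (k + 1) ^ 2 + 1 / cbrt (k + 1) ^ 3) ≤ δ * (1 + p) := by
        nlinarith [mul_nonneg hσ.le hp0, mul_le_mul_of_nonneg_left hp1 (sub_pos.2 hσδ).le]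
      have hδp : 0 ≤ δ * (1 + p) := by nlinarith
      have hM1 : 1 ≤ M * (1 - δ) := by rwa [div_le_iff₀ hδ0] at hM
      calc _ ≤ δ * (1 + p) * (M * E) + (1 - σ) := by gcongr
        _ ≤ δ * (1 + p) * (M * E) + (M * (1 - δ)) * (E * (1 + p)) := by
            have : 1 ≤ E * (1 + p) := by nlinarith
            nlinarith
        _ = _ := by ring
  refine (hprod k hk).trans ?_
  gcongr
  calc _ ≤ ∏ t ∈ Finset.Ico K k, Real.exp (max (relStep K t - 1) 0) := by
        refine Finset.prod_le_prod (fun t _ => ?_) fun t _ => ?_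
        · have := le_max_right (relStep K t - 1) 0
          linarith
        · rw [add_comm]; exact Real.add_one_le_exp _
    _ = Real.exp (∑ t ∈ Finset.Ico K k, max (relStep K t - 1) 0) := (Real.exp_sum _ _).symm
    _ ≤ _ := by gcongr; exact sum_relStep_sub_one_le hK hk

/-- Adding `cbrt K` makes the recursion homogeneous: since the relative step is at least `1 + 1/cbrt
K` before time `K`, multiplying the added constant already produces `1 - σ`. -/
lemma growth_le_early (hσ : 0 < σ) (hσ1 : σ < 1) (ha : 0 ≤ a) {K : ℕ} (hK : 1 ≤ K)
    (haK : a ≤ (1 - σ) * cbrt K ^ 2) {k : ℕ} (hk : k ≤ K) :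
    growth σ a k ≤ (1 + cbrt K) * ∏ t ∈ Finset.range K, (σ + (1 - σ) * relStep K t) := by
  have hL := one_le_cbrt hK
  have hw1 : ∀ t < K, 1 ≤ relStep K t := fun t ht =>
    le_trans (by have : 0 ≤ 1 / cbrt K := by positivity
                 linarith) (one_add_inv_le_relStep ht)
  have hG1 : ∀ t < K, 1 ≤ σ + (1 - σ) * relStep K t := fun t ht => by
    nlinarith [hw1 t ht]
  have key : ∀ k ≤ K, growth σ a k + cbrt K
      ≤ (1 + cbrt K) * ∏ t ∈ Finset.range k, (σ + (1 - σ) * relStep K t) := by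
    intro k hk
    induction k with
    | zero => simp [growth]
    | succ k ih =>
      have ih := ih (by omega)
      rw [Finset.prod_range_succ, growth, ← mul_assoc]
      have hg := one_le_growth hσ.le ha k
      have hw : 1 + cbrt K ≤ relStep K k * cbrt K := by
        have := one_add_inv_le_relStep (show k < K by omega)
        calc 1 + cbrt K = (1 + 1 / cbrt K) * cbrt K := by field_simp; ring
          _ ≤ _ := by gcongr
      have hρ := rho_le_relStep haK k
      set ρ := a * (1 / cbrt (k + 1) ^ 2 + 1 / cbrt (k + 1) ^ 3)
      set w := relStep K k
      have hG := hG1 k (by omega)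
      calc (σ + ρ) * growth σ a k + (1 - σ) + cbrt K
          ≤ (σ + (1 - σ) * w) * growth σ a k + (1 - σ) + cbrt K := by gcongr
        _ ≤ (σ + (1 - σ) * w) * (growth σ a k + cbrt K) := by
            nlinarith [mul_le_mul_of_nonneg_left hw (sub_pos.2 hσ1).le]
        _ ≤ _ := by rw [mul_comm]; gcongr
  have h1 := key k hk
  have h2 : ∏ t ∈ Finset.range k, (σ + (1 - σ) * relStep K t)
      ≤ ∏ t ∈ Finset.range K, (σ + (1 - σ) * relStep K t) :=
    Finset.prod_range_le_prod_range hk hG1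
  nlinarith

end

/-! ### Explicit numerical bound for the growth. -/

/-- The tangent to the logarithm at `√e`, with slope `e^{-1/2} ≤ 0.6066`. -/
lemma le_exp_mul_sub_half {x : ℝ} (hx : 0 ≤ x) : x ≤ Real.exp (6066 / 10000 * x - 1 / 2) := by
  have h1 := Real.add_one_le_exp (x * Real.exp (-(1 / 2)) - 1)
  have h2 : Real.exp (-(1 / 2)) ≤ 6066 / 10000 := by
    have h3 : Real.exp (-(1 / 2)) ^ 2 ≤ (6066 / 10000) ^ 2 := by
      rw [← Real.exp_nat_mul]
      norm_num
      rw [Real.exp_neg]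
      refine inv_le_of_inv_le₀ (by norm_num) ?_
      have := Real.exp_one_gt_d9
      norm_num at this ⊢
      linarith
    exact le_of_sq_le_sq h3 (by norm_num)
  have h4 : x ≤ Real.exp (x * Real.exp (-(1 / 2)) - 1 / 2) := by
    have e : Real.exp (x * Real.exp (-(1 / 2)) - 1 / 2)
        = Real.exp (x * Real.exp (-(1 / 2)) - 1) * Real.exp (1 / 2) := by
      rw [← Real.exp_add]; ring_nf
    rw [e]
    calc x = x * Real.exp (-(1 / 2)) * Real.exp (1 / 2) := by
          rw [mul_assoc, ← Real.exp_add]; norm_num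
      _ ≤ _ := by gcongr; linarith
  refine h4.trans (Real.exp_le_exp.2 ?_)
  nlinarith

/-- The sum is `2/3 (K log K - log K!)`, so this is Stirling's lower bound together with `(9/5)³ ≤
2π`. -/
lemma sum_log_ratio_cbrt_le {K : ℕ} (hK : 1 ≤ K) :
    ∑ t ∈ Finset.range K, 2 * (Real.log (cbrt K) - Real.log (cbrt (t + 1)))
      ≤ 2 / 3 * K - Real.log (9 / 5 * cbrt K) := by
  have hL := one_le_cbrt hK
  have hfac : ∑ t ∈ Finset.range K, 3 * Real.log (cbrt (t + 1)) = Real.log (K.factorial) := by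
    rw [← Finset.prod_range_add_one_eq_factorial, Nat.cast_prod, Real.log_prod]
    · exact Finset.sum_congr rfl fun t _ => three_mul_log_cbrt
    · intro t _; positivity
  have hst := Stirling.le_log_factorial_stirling (n := K) (by omega)
  have h1 : ∑ t ∈ Finset.range K, 2 * (Real.log (cbrt K) - Real.log (cbrt (t + 1)))
      = 2 / 3 * (K * Real.log K - Real.log (K.factorial)) := by
    rw [← hfac, ← three_mul_log_cbrt (n := K), ← Finset.mul_sum, ← Finset.mul_sum,
      Finset.sum_sub_distrib]
    simp
    ring
  have h2 : 3 * Real.log (9 / 5 * cbrt K) ≤ Real.log K + Real.log (2 * Real.pi) := by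
    rw [← Real.log_mul (by positivity) (by positivity)]
    have : 3 * Real.log (9 / 5 * cbrt K) = Real.log ((9 / 5 * cbrt K) ^ 3) := by
      rw [Real.log_pow]; norm_num
    rw [this]
    refine Real.log_le_log (by positivity) ?_
    rw [mul_pow, cbrt_pow_three]
    have := Real.pi_gt_three
    have hK0 : (0 : ℝ) < K := by exact_mod_cast hK
    nlinarith
  rw [h1]
  linarith

/-- With `L = cbrt K` and `c = cbrt (t+1)`, write `1 + relStep = (L/c)² (c²/L² + 1 + 1/c)`. The
first factor is summed by Stirling; the second varies little and is replaced by its exponential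
tangent bound. -/
lemma prod_ratio_le {K : ℕ} (hK : 1 ≤ K) :
    ∏ t ∈ Finset.range K, ((1 + relStep K t) / 4) ≤
      Real.exp (-(249 / 1000) * cbrt K ^ 3 + 91 / 100 * cbrt K ^ 2) / (9 / 5 * cbrt K) := by
  have hL := one_le_cbrt hK
  have hL0 : 0 < cbrt K := by linarith
  have hfac : ∀ t ∈ Finset.range K, (1 + relStep K t) / 4 ≤
      Real.exp (2 * (Real.log (cbrt K) - Real.log (cbrt (t + 1)))
        + (6066 / 10000 * (cbrt (t + 1) ^ 2 / cbrt K ^ 2 + 1 + 1 / cbrt (t + 1)) - 1 / 2)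
        - 2 * Real.log 2) := by
    intro t _
    have hc := cbrt_succ_pos t
    have e1 : (1 + relStep K t) / 4
        = (cbrt K / cbrt (t + 1)) ^ 2 * (cbrt (t + 1) ^ 2 / cbrt K ^ 2 + 1 + 1 / cbrt (t + 1)) / 4 := by
      unfold relStep; field_simp; ring
    have e2 : Real.exp (2 * (Real.log (cbrt K) - Real.log (cbrt (t + 1))))
        = (cbrt K / cbrt (t + 1)) ^ 2 := by
      rw [← Real.log_div hL0.ne' hc.ne', mul_comm, Real.exp_mul, Real.exp_log (by positivity)]
      norm_num
    have e3 : Real.exp (2 * Real.log 2) = 4 := by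
      rw [mul_comm, Real.exp_mul, Real.exp_log (by norm_num)]; norm_num
    rw [Real.exp_sub, Real.exp_add, e1, e2, e3]
    gcongr
    exact le_exp_mul_sub_half (by positivity)
  refine (Finset.prod_le_prod (fun t _ => ?_) hfac).trans ?_
  · have := relStep_nonneg K t
    positivity
  rw [← Real.exp_sum]
  have hs1 := sum_log_ratio_cbrt_le hK
  have hs2 : ∑ t ∈ Finset.range K, cbrt (t + 1) ^ 2 / cbrt K ^ 2 ≤ 3 / 5 * K + 1 / 2 := by
    rw [← Finset.sum_div, div_le_iff₀ (by positivity), ← cbrt_pow_three K]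
    refine (sum_cbrt_sq_le K).trans (le_of_eq (by ring))
  have hs3 := sum_inv_cbrt_le hK
  have hsum : ∑ t ∈ Finset.range K, (2 * (Real.log (cbrt K) - Real.log (cbrt (t + 1)))
        + (6066 / 10000 * (cbrt (t + 1) ^ 2 / cbrt K ^ 2 + 1 + 1 / cbrt (t + 1)) - 1 / 2)
        -- The coefficient of `K` is `2/3 + 0.6066 · 8/5 - 1/2 - 2 log 2`, slightly below `-0.249`:
        -- a decay that comes from comparing with `4^K`.
        - 2 * Real.log 2) ≤ (-(249 / 1000) * cbrt K ^ 3 + 91 / 100 * cbrt K ^ 2)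
          - Real.log (9 / 5 * cbrt K) := by
    have e : ∑ t ∈ Finset.range K, (2 * (Real.log (cbrt K) - Real.log (cbrt (t + 1)))
        + (6066 / 10000 * (cbrt (t + 1) ^ 2 / cbrt K ^ 2 + 1 + 1 / cbrt (t + 1)) - 1 / 2)
        - 2 * Real.log 2) = ∑ t ∈ Finset.range K, 2 * (Real.log (cbrt K) - Real.log (cbrt (t + 1)))
        + 6066 / 10000 * (∑ t ∈ Finset.range K, cbrt (t + 1) ^ 2 / cbrt K ^ 2 + K
          + ∑ t ∈ Finset.range K, 1 / cbrt (t + 1)) - K / 2 - K * (2 * Real.log 2) := by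
      simp only [Finset.sum_add_distrib, Finset.sum_sub_distrib, ← Finset.mul_sum]
      simp
      ring
    rw [e, cbrt_pow_three]
    have h2 := Real.log_two_gt_d9
    have hK0 : (1 : ℝ) ≤ K := by exact_mod_cast hK
    nlinarith [mul_le_mul_of_nonneg_left h2.le (by linarith : (0 : ℝ) ≤ K), sq_nonneg (cbrt K)]
  calc _ ≤ Real.exp _ := Real.exp_le_exp.2 hsum
    _ = _ := by rw [Real.exp_sub, Real.exp_log (by positivity)]

lemma exp_seven_fifths_le : Real.exp (7 / 5) ≤ 203 / 50 := by
  have h : Real.exp (7 / 5) ^ 5 ≤ (203 / 50) ^ 5 := by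
    rw [← Real.exp_nat_mul]
    have h1 : Real.exp ((5 : ℕ) * (7 / 5)) = Real.exp 1 ^ 7 := by
      rw [← Real.exp_nat_mul]; norm_num
    rw [h1]
    calc Real.exp 1 ^ 7 ≤ 2.7182818286 ^ 7 := by
          gcongr; exact Real.exp_one_lt_d9.le
      _ ≤ _ := by norm_num
  exact le_of_pow_le_pow_left₀ (by norm_num) (by norm_num) h

lemma five_fourths_le_cbrt {K : ℕ} (hK : 2 ≤ K) : 5 / 4 ≤ cbrt K := by
  by_contra! h
  have := pow_lt_pow_left₀ h (cbrt_nonneg K) three_ne_zero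
  rw [cbrt_pow_three] at this
  have h2 : (2 : ℝ) ≤ K := by exact_mod_cast hK
  norm_num at this; linarith

lemma exp_poly_le {L : ℝ} (hL : 5 / 4 ≤ L) :
    (1 + L) * (Real.exp (-(249 / 1000) * L ^ 3 + 91 / 100 * L ^ 2) / (9 / 5 * L))
      * Real.exp (3 / 4 * L) ≤ 2 * L + 3 * L ^ 3 := by
  have hL0 : 0 < L := by linarith
  have hlog : 2 * (L - 1) / (L + 1) ≤ Real.log L := by
    have := Real.le_log_one_add_of_nonneg (x := L - 1) (by linarith)
    rw [show 1 + (L - 1) = L by ring, show L - 1 + 2 = L + 1 by ring] at this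
    exact this
  -- The lower bound for `log L` makes the comparison of the exponent with `7/5 + 3 log L` a
  -- polynomial inequality.
  have hpoly : -(249 / 1000) * L ^ 3 + 91 / 100 * L ^ 2 + 3 / 4 * L
      ≤ 7 / 5 + 3 * (2 * (L - 1) / (L + 1)) := by
    have : 7 / 5 + 3 * (2 * (L - 1) / (L + 1))
        = (7 / 5 * (L + 1) + 6 * (L - 1)) / (L + 1) := by field_simp; ring
    rw [this, le_div_iff₀ (by linarith)]
    nlinarith [sq_nonneg (L ^ 2 - 133 / 100 * L - 23 / 10), sq_nonneg (L - 2), sq_nonneg (L - 3 / 2)]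
  have hexp : Real.exp (-(249 / 1000) * L ^ 3 + 91 / 100 * L ^ 2) * Real.exp (3 / 4 * L)
      ≤ 203 / 50 * L ^ 3 := by
    rw [← Real.exp_add]
    calc _ ≤ Real.exp (7 / 5 + 3 * Real.log L) := Real.exp_le_exp.2 (by linarith)
      _ = Real.exp (7 / 5) * L ^ 3 := by
          rw [Real.exp_add, mul_comm 3, Real.exp_mul, Real.exp_log hL0]; norm_num
      _ ≤ _ := by gcongr; exact exp_seven_fifths_le
  calc _ = (1 + L) / (9 / 5 * L) * (Real.exp (-(249 / 1000) * L ^ 3 + 91 / 100 * L ^ 2)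
        * Real.exp (3 / 4 * L)) := by ring
    _ ≤ (1 + L) / (9 / 5 * L) * (203 / 50 * L ^ 3) := by gcongr
    _ = 203 / 90 * (1 + L) * L ^ 2 := by field_simp; ring
    _ ≤ _ := by nlinarith [mul_nonneg hL0.le (sq_nonneg (L - 3 / 2))]

/-- For `a ≤ cbrt K ^ 2 / 4` the bound free of `δ` suffices. Otherwise `δ - σ` exceeds `1/4`, which
makes `1/(1 - δ)` at least `4/3` and `a` large, and the early product must be estimated precisely.
-/
theorem growth_le {σ δ a : ℝ} (hσ : 0 < σ) (hσ2 : σ ≤ 1 / 2) (ha : 0 ≤ a) (hσδ : σ < δ)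
    (hδ : δ < 1) {K : ℕ} (hK : 2 ≤ K) (haK : a ≤ (δ - σ) * cbrt K ^ 2) (k : ℕ) :
    growth σ a k ≤ 3 / 2 * (6 * a + 1) * cbrt K * (σ⁻¹) ^ K / (1 - δ) := by
  have hδ0 : 0 < 1 - δ := by linarith
  have hL := five_fourths_le_cbrt hK
  have hσi : 0 < (σ⁻¹) ^ K := by positivity
  rcases le_or_gt a (1 / 4 * cbrt K ^ 2) with hs | hs
  · refine (growth_le_of_le_quarter hσ hσ2 ha hK hs k).trans ?_
    rw [le_div_iff₀ hδ0]
    calc 7 / 4 * σ⁻¹ ^ K * (1 - δ) ≤ 7 / 4 * σ⁻¹ ^ K * 1 := by gcongr; linarith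
      _ ≤ (3 / 2 * 1 * (5 / 4)) * σ⁻¹ ^ K := by nlinarith
      _ ≤ _ := by gcongr; linarith
  have hK1 : 1 ≤ K := by omega
  have haK1 : a ≤ (1 - σ) * cbrt K ^ 2 := haK.trans (by gcongr)
  have hδ4 : 1 / 4 ≤ δ - σ := by
    by_contra! h
    have : (δ - σ) * cbrt K ^ 2 ≤ 1 / 4 * cbrt K ^ 2 := by gcongr
    linarith
  set P := ∏ t ∈ Finset.range K, (σ + (1 - σ) * relStep K t) with hP
  -- Factor by factor the worst case is `σ = 1/2`: the gap is `(1/2 - σ)²(w - 1) + (1/2 - σ)` with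
  -- `w` the relative step.
  have hPσ : σ ^ K * P ≤ ∏ t ∈ Finset.range K, ((1 + relStep K t) / 4) := by
    have : σ ^ K * P = ∏ t ∈ Finset.range K, (σ * (σ + (1 - σ) * relStep K t)) := by
      rw [Finset.prod_mul_distrib]; simp [hP]
    rw [this]
    refine Finset.prod_le_prod (fun t _ => ?_) fun t ht => ?_
    · have := relStep_nonneg K t
      have : 0 ≤ 1 - σ := by linarith
      positivity
    · have h1 := one_add_inv_le_relStep (Finset.mem_range.1 ht)
      have h2 : 0 ≤ 1 / cbrt K := by positivity
      have h3 : 0 ≤ 1 / 2 - σ := by linarith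
      have h4 : 0 ≤ relStep K t - 1 := by linarith
      nlinarith [mul_nonneg (mul_nonneg h3 h3) h4]
  have hmain : (1 + cbrt K) * P * Real.exp (3 / 4 * cbrt K)
      ≤ 3 / 2 * (6 * a + 1) * cbrt K * (σ⁻¹) ^ K / (1 - δ) := by
    have h1 := prod_ratio_le hK1
    have h2 := exp_poly_le hL
    have hPle : P ≤ (σ⁻¹) ^ K * (Real.exp (-(249 / 1000) * cbrt K ^ 3 + 91 / 100 * cbrt K ^ 2)
        / (9 / 5 * cbrt K)) := by
      have e : P = (σ⁻¹) ^ K * (σ ^ K * P) := by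
        rw [← mul_assoc, ← mul_pow, inv_mul_cancel₀ hσ.ne', one_pow, one_mul]
      rw [e]
      gcongr
      exact hPσ.trans h1
    calc _ ≤ (1 + cbrt K) * ((σ⁻¹) ^ K * (Real.exp (-(249 / 1000) * cbrt K ^ 3
          + 91 / 100 * cbrt K ^ 2) / (9 / 5 * cbrt K))) * Real.exp (3 / 4 * cbrt K) := by gcongr
      _ = (σ⁻¹) ^ K * ((1 + cbrt K) * (Real.exp (-(249 / 1000) * cbrt K ^ 3
          + 91 / 100 * cbrt K ^ 2) / (9 / 5 * cbrt K)) * Real.exp (3 / 4 * cbrt K)) := by ring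
      _ ≤ (σ⁻¹) ^ K * (2 * cbrt K + 3 * cbrt K ^ 3) := by gcongr
      _ ≤ _ := by
          rw [le_div_iff₀ hδ0]
          -- Using `1 - δ ≤ 3/4` and `a > cbrt K ^ 2 / 4` turns `2L + 3L³` into exactly the claimed
          -- right-hand side.
          calc (σ⁻¹) ^ K * (2 * cbrt K + 3 * cbrt K ^ 3) * (1 - δ)
              ≤ (σ⁻¹) ^ K * (2 * cbrt K + 3 * cbrt K ^ 3) * (3 / 4) := by gcongr; linarith
            _ = 3 / 2 * (6 * (1 / 4 * cbrt K ^ 2) + 1) * cbrt K * (σ⁻¹) ^ K := by ring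
            _ ≤ _ := by gcongr
  have hM : ∀ k, growth σ a k
      ≤ max ((1 + cbrt K) * P) (1 / (1 - δ)) * Real.exp (3 / 4 * cbrt K) :=
    growth_le_of_early_of_late hσ ha hσδ hδ hK1 haK (le_max_right _ _)
      fun k hk => (growth_le_early hσ (by linarith) ha hK1 haK1 hk).trans (le_max_left _ _)
  refine (hM k).trans ?_
  rw [max_mul_of_nonneg _ _ (Real.exp_pos _).le]
  refine max_le hmain ?_
  rw [div_mul_eq_mul_div, one_mul]
  gcongr
  have h2K : Real.exp (3 / 4 * cbrt K) ≤ (σ⁻¹) ^ K := by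
    have h2 : (2 : ℝ) ≤ σ⁻¹ := by rw [le_inv_comm₀ (by norm_num) hσ]; linarith
    calc Real.exp (3 / 4 * cbrt K) ≤ Real.exp (Real.log 2 * K) := by
          rw [← cbrt_pow_three K]
          have := Real.log_two_gt_d9
          refine Real.exp_le_exp.2 ?_
          have h3 : 25 / 16 ≤ cbrt K ^ 2 := by nlinarith
          have h4 : 3 / 4 ≤ Real.log 2 * cbrt K ^ 2 := by nlinarith
          calc 3 / 4 * cbrt K ≤ Real.log 2 * cbrt K ^ 2 * cbrt K := by gcongr
            _ = _ := by ring
      _ = 2 ^ K := by rw [Real.exp_mul, Real.exp_log (by norm_num), Real.rpow_natCast]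
      _ ≤ _ := by gcongr
  calc _ ≤ 1 * (σ⁻¹) ^ K := by rw [one_mul]; exact h2K
    _ ≤ _ := by gcongr; nlinarith

/-! ### The scalar consensus recursion. -/

lemma add_one_rpow_eq_cbrt_pow (k n : ℕ) : ((k : ℝ) + 1) ^ ((n : ℝ) / 3) = cbrt (k + 1) ^ n := by
  rw [cbrt, ← Real.rpow_natCast, ← Real.rpow_mul (Nat.cast_nonneg _)]
  push_cast
  ring_nf

lemma add_one_rpow_two_thirds (k : ℕ) : ((k : ℝ) + 1) ^ (2 / 3 : ℝ) = cbrt (k + 1) ^ 2 := by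
  exact_mod_cast add_one_rpow_eq_cbrt_pow k 2

lemma add_two_rpow_five_thirds (k : ℕ) : ((k : ℝ) + 2) ^ (5 / 3 : ℝ) = cbrt (k + 2) ^ 5 := by
  rw [show ((k : ℝ) + 2) = ((k + 1 : ℕ) : ℝ) + 1 by push_cast; ring]
  exact_mod_cast add_one_rpow_eq_cbrt_pow (k + 1) 5

lemma fastStep_eq (a : ℝ) (k : ℕ) : fastStep a k = a / cbrt (k + 1) ^ 2 := by
  rw [fastStep, add_one_rpow_two_thirds]

lemma slowStep_eq (b : ℝ) (k : ℕ) : slowStep b k = b / cbrt (k + 1) ^ 3 := by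
  rw [slowStep, cbrt_pow_three]; push_cast; rfl

lemma slowStep_div_fastStep (a b : ℝ) (k : ℕ) :
    slowStep b k / fastStep a k = b / (a * cbrt (k + 1)) := by
  have := cbrt_succ_pos k
  rw [slowStep_eq, fastStep_eq]
  rcases eq_or_ne a 0 with rfl | ha
  · simp
  · field_simp

lemma le_mul_cbrt_sq_of_ceil_le {x y : ℝ} (hx : 0 ≤ x) (hy : 0 < y) {K : ℕ}
    (h : ⌈(x / y) ^ (3 / 2 : ℝ)⌉₊ ≤ K) : x ≤ y * cbrt K ^ 2 := by
  have h1 : (x / y) ^ (3 / 2 : ℝ) ≤ K := (Nat.le_ceil _).trans (by exact_mod_cast h)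
  have h2 : x / y ≤ (K : ℝ) ^ (2 / 3 : ℝ) := by
    calc x / y = ((x / y) ^ (3 / 2 : ℝ)) ^ (2 / 3 : ℝ) := by
          rw [← Real.rpow_mul (by positivity)]; norm_num
      _ ≤ _ := by gcongr
  have h3 : (K : ℝ) ^ (2 / 3 : ℝ) = cbrt K ^ 2 := by
    rw [cbrt, ← Real.rpow_natCast, ← Real.rpow_mul (Nat.cast_nonneg _)]
    norm_num
  rw [h3, div_le_iff₀ hy] at h2
  linarith

section

variable {σ α₀ β₀ G : ℝ} {X Y : ℕ → ℝ}

lemma add_le_mul_growth (hσ : 0 ≤ σ) (hβ₀ : 0 ≤ β₀) (hβα : β₀ ≤ α₀) (hG : 0 ≤ G)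
    (hX0 : X 0 = 0) (hY0 : Y 0 = 0) (hX : ∀ k, 0 ≤ X k) (hY : ∀ k, 0 ≤ Y k)
    (hXs : ∀ k, X (k + 1) ≤ σ * X k + fastStep α₀ k * (X k + Y k + G))
    (hYs : ∀ k, Y (k + 1) ≤ σ * Y k + slowStep β₀ k * (X k + Y k + G)) (k : ℕ) :
    X k + Y k + G ≤ G * growth σ α₀ k := by
  induction k with
  | zero => simp [hX0, hY0, growth]
  | succ k ih =>
    have hc := cbrt_succ_pos k
    have h1 := hXs k
    have h2 := hYs k
    have h3 : fastStep α₀ k + slowStep β₀ k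
        ≤ α₀ * (1 / cbrt (k + 1) ^ 2 + 1 / cbrt (k + 1) ^ 3) := by
      rw [fastStep_eq, slowStep_eq, mul_add, mul_one_div, mul_one_div]
      gcongr
    have hρ := rho_nonneg (hβ₀.trans hβα) k
    have h4 := hX k
    have h5 := hY k
    rw [growth]
    set ρ := α₀ * (1 / cbrt (k + 1) ^ 2 + 1 / cbrt (k + 1) ^ 3)
    have h6 : (fastStep α₀ k + slowStep β₀ k) * (X k + Y k + G) ≤ ρ * (X k + Y k + G) := by
      gcongr
    have h7 : (σ + ρ) * (X k + Y k + G) ≤ (σ + ρ) * (G * growth σ α₀ k) := by gcongr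
    nlinarith

/-- Once `X + Y + G ≤ GH`, each error satisfies a linear recursion with known forcing. The factors
`2` and `3` are preserved because for `σ ≤ 1/2` the multipliers beat the decrease of the step from
one index to the next. -/
lemma le_div_cbrt_of_growth_le (hσ : 0 ≤ σ) (hσ2 : σ ≤ 1 / 2) (hβ₀ : 0 ≤ β₀) (hβα : β₀ ≤ α₀)
    (hG : 0 ≤ G) (hX0 : X 0 = 0) (hY0 : Y 0 = 0) (hX : ∀ k, 0 ≤ X k) (hY : ∀ k, 0 ≤ Y k)
    (hXs : ∀ k, X (k + 1) ≤ σ * X k + fastStep α₀ k * (X k + Y k + G))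
    (hYs : ∀ k, Y (k + 1) ≤ σ * Y k + slowStep β₀ k * (X k + Y k + G)) {H : ℝ}
    (hH : ∀ k, growth σ α₀ k ≤ H) (k : ℕ) :
    X k ≤ 2 * α₀ * (G * H) / ((1 - σ) * cbrt (k + 1) ^ 2) ∧
      Y k ≤ 3 * β₀ * (G * H) / ((1 - σ) * cbrt (k + 1) ^ 3) := by
  have hα₀ : 0 ≤ α₀ := hβ₀.trans hβα
  have hH0 : 0 ≤ H := zero_le_one.trans ((one_le_growth hσ hα₀ 0).trans (hH 0))
  have hσ1 : 0 < 1 - σ := by linarith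
  have hS : ∀ k, X k + Y k + G ≤ G * H := fun k =>
    (add_le_mul_growth hσ hβ₀ hβα hG hX0 hY0 hX hY hXs hYs k).trans (by gcongr; exact hH k)
  have hX' : ∀ k, X (k + 1) ≤ σ * X k + α₀ / cbrt (k + 1) ^ 2 * (G * H) := fun k => by
    have := cbrt_succ_pos k
    refine (hXs k).trans ?_
    rw [fastStep_eq]
    gcongr
    exact hS k
  have hY' : ∀ k, Y (k + 1) ≤ σ * Y k + β₀ / cbrt (k + 1) ^ 3 * (G * H) := fun k => by
    have := cbrt_succ_pos k
    refine (hYs k).trans ?_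
    rw [slowStep_eq]
    gcongr
    exact hS k
  rcases k.eq_zero_or_pos with rfl | hk
  · rw [hX0, hY0]
    have := cbrt_succ_pos 0
    constructor <;> positivity
  induction k, hk using Nat.le_induction with
  | base =>
    have h1 := hX' 0
    have h2 := hY' 0
    simp only [hX0, hY0, cbrt_one, zero_add, mul_zero, one_pow, div_one] at h1 h2 ⊢
    have h3 : cbrt 2 ^ 3 = 2 := by rw [cbrt_pow_three]; norm_num
    have h4 : cbrt 2 ^ 2 ≤ 2 := by
      have := one_le_cbrt (n := 2) (by norm_num)
      nlinarith
    have h5 : 0 < cbrt 2 := cbrt_succ_pos 1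
    have hGH : 0 ≤ G * H := by positivity
    rw [h3]
    constructor
    · rw [le_div_iff₀ (by positivity)]
      calc X 1 * ((1 - σ) * cbrt 2 ^ 2) ≤ α₀ * (G * H) * (1 * 2) := by gcongr; linarith
        _ = _ := by ring
    · rw [le_div_iff₀ (by positivity)]
      calc Y 1 * ((1 - σ) * 2) ≤ β₀ * (G * H) * (1 * 3) := by
            gcongr
            · linarith
            · norm_num
        _ = _ := by ring
  | succ k hk ih =>
    obtain ⟨ih1, ih2⟩ := ih
    have hc := cbrt_succ_pos k
    have hc' := cbrt_succ_pos (k + 1)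
    -- This needs `k ≥ 1`, which is why the induction starts at one.
    have hcc : cbrt (k + 1 + 1) ^ 3 ≤ 3 / 2 * cbrt (k + 1) ^ 3 := by
      rw [cbrt_pow_three, cbrt_pow_three]
      have : (1 : ℝ) ≤ k := by exact_mod_cast hk
      push_cast
      linarith
    set c := cbrt (k + 1)
    set c' := cbrt (k + 1 + 1)
    have hcc2 : 3 * c' ^ 2 ≤ 4 * c ^ 2 := by
      by_contra! h
      have h1 : (4 * c ^ 2) ^ 3 < (3 * c' ^ 2) ^ 3 := pow_lt_pow_left₀ h (by positivity) three_ne_zero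
      have h2 : (c' ^ 3) ^ 2 ≤ (3 / 2 * c ^ 3) ^ 2 := by gcongr
      have h3 : 0 < c ^ 6 := by positivity
      nlinarith
    have hGH : 0 ≤ G * H := by positivity
    constructor
    · calc X (k + 1) ≤ σ * (2 * α₀ * (G * H) / ((1 - σ) * c ^ 2)) + α₀ / c ^ 2 * (G * H) :=
            (hX' k).trans (by gcongr)
        _ = α₀ * (G * H) / (1 - σ) * ((1 + σ) / c ^ 2) := by field_simp; ring
        _ ≤ α₀ * (G * H) / (1 - σ) * (2 / c' ^ 2) := by
            gcongr ?_ * ?_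
            rw [div_le_div_iff₀ (by positivity) (by positivity)]
            nlinarith [sq_nonneg c']
        _ = _ := by field_simp
    · calc Y (k + 1) ≤ σ * (3 * β₀ * (G * H) / ((1 - σ) * c ^ 3)) + β₀ / c ^ 3 * (G * H) :=
            (hY' k).trans (by gcongr)
        _ = β₀ * (G * H) / (1 - σ) * ((1 + 2 * σ) / c ^ 3) := by field_simp; ring
        _ ≤ β₀ * (G * H) / (1 - σ) * (3 / c' ^ 3) := by
            gcongr ?_ * ?_
            rw [div_le_div_iff₀ (by positivity) (by positivity)]
            nlinarith [pow_pos hc' 3]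
        _ = _ := by field_simp

/-- Finite-time bound for the scalar recursion satisfied by the consensus errors. -/
theorem consensus_bound (hσ : 0 < σ) (hσ2 : σ ≤ 1 / 2) (hβ₀ : 0 < β₀) (hβα : β₀ ≤ α₀)
    {N K : ℕ} {R C δ : ℝ} (hR : 0 ≤ R) (hC : 0 ≤ C) (hN : 0 < N) (hK0 : 0 < K)
    (hσδ : σ < δ) (hδ : δ < 1) (hK : ⌈(α₀ / (δ - σ)) ^ (3 / 2 : ℝ)⌉₊ ≤ K)
    (hX0 : X 0 = 0) (hY0 : Y 0 = 0) (hX : ∀ k, 0 ≤ X k) (hY : ∀ k, 0 ≤ Y k)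
    (hXs : ∀ k, X (k + 1) ≤ σ * X k + fastStep α₀ k * (X k + Y k + √(N : ℝ) * (R + C)))
    (hYs : ∀ k, Y (k + 1) ≤ σ * Y k + slowStep β₀ k * (X k + Y k + √(N : ℝ) * (R + C)))
    (k : ℕ) :
    1 / (N : ℝ) * (Y k ^ 2 + slowStep β₀ k / fastStep α₀ k * X k ^ 2) ≤
      16 * consensusConst N R C α₀ δ K ^ 2 * β₀ * α₀ * Real.log (K : ℝ) ^ 2
          * σ ^ (-(2 * (K : ℤ))) / ((N : ℝ) * (1 - σ) ^ 2 * ((k : ℝ) + 1) ^ (2 / 3 : ℝ))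
        + 16 * consensusConst N R C α₀ δ K ^ 2 * β₀ * α₀
          / ((N : ℝ) * (1 - σ) ^ 2 * ((k : ℝ) + 2) ^ (5 / 3 : ℝ)) := by
  have hα₀ : 0 < α₀ := hβ₀.trans_le hβα
  have hσ1 : 0 < 1 - σ := by linarith
  have hδ1 : 0 < 1 - δ := by linarith
  have hN0 : (0 : ℝ) < N := by exact_mod_cast hN
  have haK := le_mul_cbrt_sq_of_ceil_le hα₀.le (sub_pos.2 hσδ) hK
  set G := √(N : ℝ) * (R + C) with hG
  have hG0 : 0 ≤ G := by positivity
  have hL := one_le_cbrt hK0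
  have hconst : consensusConst N R C α₀ δ K = 2 * G * (6 * α₀ + 1) * cbrt K / (1 - δ) := by
    simp only [consensusConst, cbrt, hG]; ring
  rw [add_one_rpow_two_thirds, add_two_rpow_five_thirds]
  have hc := cbrt_succ_pos k
  have hc' : 0 < cbrt (k + 2) := cbrt_succ_pos (k + 1)
  have hc1 : 1 ≤ cbrt (k + 1) := one_le_cbrt (by omega)
  have hbound : ∀ H : ℝ, (∀ k, growth σ α₀ k ≤ H) →
      Y k ^ 2 + slowStep β₀ k / fastStep α₀ k * X k ^ 2
        ≤ 13 * β₀ * α₀ * (G * H) ^ 2 / ((1 - σ) ^ 2 * cbrt (k + 1) ^ 5) := by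
    intro H hH
    obtain ⟨h1, h2⟩ := le_div_cbrt_of_growth_le hσ.le hσ2 hβ₀.le hβα hG0 hX0 hY0 hX hY hXs hYs hH k
    rw [slowStep_div_fastStep]
    have h3 := hX k
    have h4 := hY k
    set c := cbrt (k + 1)
    calc _ ≤ (3 * β₀ * (G * H) / ((1 - σ) * c ^ 3)) ^ 2
          + β₀ / (α₀ * c) * (2 * α₀ * (G * H) / ((1 - σ) * c ^ 2)) ^ 2 := by gcongr
      _ = 9 * β₀ * β₀ * (G * H) ^ 2 / ((1 - σ) ^ 2 * (c ^ 5 * c))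
          + 4 * β₀ * α₀ * (G * H) ^ 2 / ((1 - σ) ^ 2 * c ^ 5) := by field_simp; ring
      _ ≤ 9 * β₀ * α₀ * (G * H) ^ 2 / ((1 - σ) ^ 2 * (c ^ 5 * 1))
          + 4 * β₀ * α₀ * (G * H) ^ 2 / ((1 - σ) ^ 2 * c ^ 5) := by gcongr
      _ = _ := by rw [mul_one]; ring
  -- For `K = 1` the factor `log² K` vanishes, so the second term with `(k+2)^{5/3} ≤ 4 (k+1)^{5/3}`
  -- must carry the whole bound. For `K ≥ 2` the first term does.
  rcases (show K = 1 ∨ 2 ≤ K by omega) with rfl | hK2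
  · have hG1 : ∀ k, growth σ α₀ k ≤ (1 + 6 * α₀) / (1 - δ) :=
      growth_le_of_le_sub hσ hσ2 hα₀.le hδ (by simpa [cbrt_one] using haK)
    have h := hbound _ hG1
    have hGH : G * ((1 + 6 * α₀) / (1 - δ)) = consensusConst N R C α₀ δ 1 / 2 := by
      rw [hconst, cbrt_one]; ring
    rw [hGH] at h
    set Q := consensusConst N R C α₀ δ 1
    have hcc : cbrt (k + 2) ^ 5 ≤ 4 * cbrt (k + 1) ^ 5 := by
      have h3 : cbrt (k + 2) ^ 3 ≤ 2 * cbrt (k + 1) ^ 3 := by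
        rw [cbrt_pow_three, cbrt_pow_three]; push_cast; linarith [(Nat.cast_nonneg k : (0 : ℝ) ≤ k)]
      have h4 : cbrt (k + 1) ≤ cbrt (k + 2) := cbrt_mono (by omega)
      have h5 : cbrt (k + 2) ^ 5 * cbrt (k + 2) ≤ 4 * cbrt (k + 1) ^ 5 * cbrt (k + 2) := by
        calc cbrt (k + 2) ^ 5 * cbrt (k + 2) = (cbrt (k + 2) ^ 3) ^ 2 := by ring
          _ ≤ (2 * cbrt (k + 1) ^ 3) ^ 2 := by gcongr
          _ = 4 * cbrt (k + 1) ^ 5 * cbrt (k + 1) := by ring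
          _ ≤ _ := by gcongr
      exact le_of_mul_le_mul_right h5 hc'
    calc _ ≤ 1 / (N : ℝ) * (13 * β₀ * α₀ * (Q / 2) ^ 2 / ((1 - σ) ^ 2 * cbrt (k + 1) ^ 5)) := by
          gcongr
      _ = (13 / 4 * Q ^ 2 * β₀ * α₀) / (N * (1 - σ) ^ 2 * cbrt (k + 1) ^ 5) := by
          field_simp; ring
      _ = (13 * Q ^ 2 * β₀ * α₀) / (N * (1 - σ) ^ 2 * (4 * cbrt (k + 1) ^ 5)) := by
          field_simp
      _ ≤ (16 * Q ^ 2 * β₀ * α₀) / (N * (1 - σ) ^ 2 * cbrt (k + 2) ^ 5) := by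
          gcongr; norm_num
      _ ≤ _ := le_add_of_nonneg_left (by positivity)
  · have h := hbound _ (growth_le hσ hσ2 hα₀.le hσδ hδ hK2 haK)
    have hGH : G * (3 / 2 * (6 * α₀ + 1) * cbrt K * σ⁻¹ ^ K / (1 - δ))
        = 3 / 4 * consensusConst N R C α₀ δ K * σ⁻¹ ^ K := by
      rw [hconst]; ring
    rw [hGH] at h
    set Q := consensusConst N R C α₀ δ K
    have hz : σ ^ (-(2 * (K : ℤ))) = (σ⁻¹ ^ K) ^ 2 := by
      rw [zpow_neg, inv_pow, inv_pow, ← pow_mul, mul_comm K 2]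
      norm_cast
    -- Needed because `13 · (3/4)² = 16 · 117/256`, and `117/256 < 11/24 ≤ log² 2`.
    have hlog : 1 / 2 ≤ Real.log K ^ 2 * (12 / 11) := by
      have h1 : Real.log 2 ≤ Real.log K := Real.log_le_log (by norm_num) (by exact_mod_cast hK2)
      have := Real.log_two_gt_d9
      nlinarith
    rw [hz]
    set τ := σ⁻¹ ^ K
    calc _ ≤ 1 / (N : ℝ) * (13 * β₀ * α₀ * (3 / 4 * Q * τ) ^ 2
            / ((1 - σ) ^ 2 * cbrt (k + 1) ^ 5)) := by gcongr
      _ = (16 * Q ^ 2 * β₀ * α₀ * (117 / 256) * τ ^ 2)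
            / (N * (1 - σ) ^ 2 * cbrt (k + 1) ^ 5) := by field_simp; ring
      _ ≤ (16 * Q ^ 2 * β₀ * α₀ * Real.log K ^ 2 * τ ^ 2)
            / (N * (1 - σ) ^ 2 * cbrt (k + 1) ^ 2) := by
          gcongr
          · linarith
          · norm_num
      _ ≤ _ := le_add_of_nonneg_right (by positivity)

end

/-! ### Deviations of the nodes from their average. -/

section

variable {N d : ℕ}

/-- The stacked deviations of the nodes from their average. -/
noncomputable def deviation (z : Fin N → Vec d) : PiLp 2 (fun _ : Fin N => Vec d) :=
  WithLp.toLp 2 fun i => z i - nodeAvg z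

lemma nodeAvg_add (z w : Fin N → Vec d) :
    nodeAvg (fun i => z i + w i) = nodeAvg z + nodeAvg w := by
  simp [nodeAvg, Finset.sum_add_distrib]

lemma nodeAvg_smul (c : ℝ) (z : Fin N → Vec d) :
    nodeAvg (fun i => c • z i) = c • nodeAvg z := by
  simp [nodeAvg, ← Finset.smul_sum, smul_comm c]

lemma nodeAvg_sub (z w : Fin N → Vec d) :
    nodeAvg (fun i => z i - w i) = nodeAvg z - nodeAvg w := by
  simp [nodeAvg, Finset.sum_sub_distrib, smul_sub]

lemma nodeAvg_act (A : Matrix (Fin d) (Fin d) ℝ) (z : Fin N → Vec d) :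
    nodeAvg (fun i => act A (z i)) = act A (nodeAvg z) := by
  simp [nodeAvg, act_eq_toEuclideanCLM, map_sum]

lemma sum_eq_smul_nodeAvg (hN : 0 < N) (z : Fin N → Vec d) : ∑ i, z i = (N : ℝ) • nodeAvg z := by
  have : (N : ℝ) ≠ 0 := by positivity
  rw [nodeAvg, smul_smul, mul_inv_cancel₀ this, one_smul]

lemma nodeAvg_mix {W : Matrix (Fin N) (Fin N) ℝ} (hW : W ∈ doublyStochastic ℝ (Fin N))
    (z : Fin N → Vec d) : nodeAvg (fun i => ∑ j, W i j • z j) = nodeAvg z := by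
  simp only [nodeAvg]
  rw [Finset.sum_comm]
  congr 1
  refine Finset.sum_congr rfl fun j _ => ?_
  rw [← Finset.sum_smul, sum_col_of_mem_doublyStochastic hW, one_smul]

lemma deviation_add (z w : Fin N → Vec d) :
    deviation (fun i => z i + w i) = deviation z + deviation w := by
  ext1 i
  simp only [deviation, nodeAvg_add, PiLp.add_apply]
  abel

lemma deviation_sub (z w : Fin N → Vec d) :
    deviation (fun i => z i - w i) = deviation z - deviation w := by
  ext1 i
  simp only [deviation, nodeAvg_sub, PiLp.sub_apply]
  abel

lemma deviation_smul (c : ℝ) (z : Fin N → Vec d) :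
    deviation (fun i => c • z i) = c • deviation z := by
  ext1 i
  simp only [deviation, nodeAvg_smul, PiLp.smul_apply, smul_sub]

lemma norm_deviation_sq (z : Fin N → Vec d) :
    ‖deviation z‖ ^ 2 = ∑ i, ‖z i - nodeAvg z‖ ^ 2 :=
  PiLp.norm_sq_eq_of_L2 _ _

lemma sum_norm_sub_sq (hN : 0 < N) (z : Fin N → Vec d) (p : Vec d) :
    ∑ i, ‖z i - p‖ ^ 2 = N * ‖nodeAvg z - p‖ ^ 2 + ‖deviation z‖ ^ 2 := by
  have h : ∀ i, ‖z i - p‖ ^ 2 = ‖z i - nodeAvg z‖ ^ 2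
      + 2 * inner ℝ (z i - nodeAvg z) (nodeAvg z - p) + ‖nodeAvg z - p‖ ^ 2 := by
    intro i
    rw [← norm_add_sq_real]; congr 2; abel
  have h0 : ∑ i, (z i - nodeAvg z) = 0 := by
    rw [Finset.sum_sub_distrib, sum_eq_smul_nodeAvg hN]
    simp [← Nat.cast_smul_eq_nsmul ℝ]
  simp only [h, Finset.sum_add_distrib, ← Finset.mul_sum, ← sum_inner, h0, norm_deviation_sq]
  simp
  ring

lemma norm_deviation_le (hN : 0 < N) {z : Fin N → Vec d} {R : ℝ} (hz : ∀ i, ‖z i‖ ≤ R) :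
    ‖deviation z‖ ≤ √(N : ℝ) * R := by
  have hR : 0 ≤ R := (norm_nonneg _).trans (hz ⟨0, hN⟩)
  refine abs_le_of_sq_le_sq' ?_ (by positivity) |>.2
  have h := sum_norm_sub_sq hN z 0
  simp only [sub_zero] at h
  have h1 : ∑ i, ‖z i‖ ^ 2 ≤ N * R ^ 2 := by
    calc _ ≤ ∑ _i : Fin N, R ^ 2 := Finset.sum_le_sum fun i _ => by gcongr; exact hz i
      _ = _ := by simp
  rw [mul_pow, Real.sq_sqrt (Nat.cast_nonneg N)]
  have : 0 ≤ (N : ℝ) * ‖nodeAvg z‖ ^ 2 := by positivity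
  linarith

lemma norm_deviation_act_le {A : Matrix (Fin d) (Fin d) ℝ} (hA : ‖A‖ ≤ 1) (z : Fin N → Vec d) :
    ‖deviation (fun i => act A (z i))‖ ≤ ‖deviation z‖ := by
  refine abs_le_of_sq_le_sq' ?_ (norm_nonneg _) |>.2
  rw [norm_deviation_sq, norm_deviation_sq]
  refine Finset.sum_le_sum fun i _ => ?_
  have h : act A (z i) - nodeAvg (fun i => act A (z i)) = act A (z i - nodeAvg z) := by
    rw [nodeAvg_act]; simp [act_eq_toEuclideanCLM]
  rw [h]
  gcongr
  refine (norm_act_le A _).trans ?_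
  exact mul_le_of_le_one_left (norm_nonneg _) hA

/-- Mixing acts on each coordinate separately, and the deviations have zero sum over the nodes in
every coordinate. -/
lemma norm_deviation_mix_le (hN : 0 < N) {W : Matrix (Fin N) (Fin N) ℝ}
    (hW : W ∈ doublyStochastic ℝ (Fin N)) {σ : ℝ} (hσ : secondSingularValue W ≤ σ) (hσ1 : σ < 1)
    (z : Fin N → Vec d) :
    ‖deviation (fun i => ∑ j, W i j • z j)‖ ≤ σ * ‖deviation z‖ := by
  have hs0 : 0 ≤ secondSingularValue W := LinearMap.singularValues_nonneg _ _
  refine abs_le_of_sq_le_sq' ?_ (mul_nonneg (hs0.trans hσ) (norm_nonneg _)) |>.2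
  rw [mul_pow, norm_deviation_sq, norm_deviation_sq]
  have h : ∀ i, (∑ j, W i j • z j) - nodeAvg (fun i => ∑ j, W i j • z j)
      = ∑ j, W i j • (z j - nodeAvg z) := by
    intro i
    rw [nodeAvg_mix hW]
    simp only [smul_sub, Finset.sum_sub_distrib]
    rw [← Finset.sum_smul, sum_row_of_mem_doublyStochastic hW, one_smul]
  have h0 : ∑ i, (z i - nodeAvg z) = 0 := by
    rw [Finset.sum_sub_distrib, sum_eq_smul_nodeAvg hN]
    simp [← Nat.cast_smul_eq_nsmul ℝ]
  simp only [h, EuclideanSpace.norm_sq_eq]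
  rw [Finset.sum_comm, Finset.sum_comm (s := Finset.univ) (t := Finset.univ)
    (f := fun i l => ‖(z i - nodeAvg z).ofLp l‖ ^ 2), Finset.mul_sum]
  refine Finset.sum_le_sum fun l _ => ?_
  have hl : ∑ i, (z i - nodeAvg z).ofLp l = 0 := by
    have := congrArg (fun v : Vec d => v l) h0
    simpa using this
  have := mulVec_contract_of_doublyStochastic hW hN (hσ.trans_lt hσ1) hl
  simp only [Real.norm_eq_abs, sq_abs]
  calc _ = ∑ i, (∑ j, W i j * (z j - nodeAvg z).ofLp l) ^ 2 := by simp
    _ ≤ _ := this.trans (by gcongr)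

end

/-! ### Lyapunov function of the two-time-scale recursion. -/

lemma tendsto_cbrt_succ : Filter.Tendsto (fun k : ℕ => cbrt (k + 1)) Filter.atTop Filter.atTop := by
  have h1 : Filter.Tendsto (fun k : ℕ => ((k + 1 : ℕ) : ℝ)) Filter.atTop Filter.atTop :=
    tendsto_natCast_atTop_atTop.comp (Filter.tendsto_add_atTop_nat 1)
  exact (tendsto_rpow_atTop (by norm_num)).comp h1

lemma tendsto_slowStep_div_fastStep (α₀ β₀ : ℝ) :
    Filter.Tendsto (fun k => slowStep β₀ k / fastStep α₀ k) Filter.atTop (nhds 0) := by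
  have h : (fun k => slowStep β₀ k / fastStep α₀ k) = fun k => β₀ / α₀ / cbrt (k + 1) := by
    ext k
    rw [slowStep_div_fastStep, div_div]
  rw [h]
  exact tendsto_cbrt_succ.const_div_atTop _

lemma tendsto_fastStep (α₀ : ℝ) :
    Filter.Tendsto (fun k => fastStep α₀ k) Filter.atTop (nhds 0) := by
  have h : (fun k => fastStep α₀ k) = fun k => α₀ / cbrt (k + 1) ^ 2 := by
    ext k
    rw [fastStep_eq]
  rw [h]
  exact ((Filter.tendsto_pow_atTop two_ne_zero).comp tendsto_cbrt_succ).const_div_atTop _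

/-- One step of the Lyapunov function of a two-time-scale recursion, with `β = r α`. -/
lemma two_time_scale_step {a c κ c₁ c₂ β₀ ε α r w u w' u' M C₂ : ℝ} (ha : 0 < a)
    (hβ₀ : 0 < β₀) (hC₂ : C₂ = c₁ ^ 2 / κ + c₁ ^ 2 * β₀) (hM : M = 4 * C₂ / a) (hM0 : 0 < M)
    (hc₂ : 0 ≤ c₂) (hε : (2 * c - κ) * β₀ = 2 / 3 + 3 * ε) (hε0 : 0 < ε) (hα : 0 < α)
    (hr : 0 < r) (hr1 : r ≤ 1) (hβ : r * α ≤ β₀) (hu : 0 ≤ u) (hw : 0 ≤ w)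
    (s4 : c ^ 2 * β₀ * α ≤ ε) (s5 : M * (c₁ ^ 2 / (3 / 4 * a)) * β₀ * r ≤ ε)
    (s6 : (2 / 3 + ε) / β₀ * r ≤ a / 2)
    (f1 : u' ≤ (1 - 3 / 4 * a * α) * u + c₁ ^ 2 * (r * α) ^ 2 / (3 / 4 * a * α) * w + c₂ * α ^ 2)
    (f2 : w' ≤ (1 - (2 * c - κ) * (r * α) + c ^ 2 * (r * α) ^ 2) * w
      + (c₁ ^ 2 / κ + c₁ ^ 2 * (r * α)) * (r * α) * u + c₂ * (r * α) ^ 2) :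
    w' + M * r * u' ≤ (1 - (2 / 3 + ε) / β₀ * (r * α)) * (w + M * r * u)
      + (c₂ + M * c₂) * (α * (r * α)) := by
  -- The slow rate is `2/3 + 3ε`; one `ε` pays for the quadratic term, one for the feedback through
  -- `u`, leaving `2/3 + ε`.
  have hwc : 1 - (2 * c - κ) * (r * α) + c ^ 2 * (r * α) ^ 2
      + M * r * (c₁ ^ 2 * (r * α) ^ 2 / (3 / 4 * a * α)) ≤ 1 - (2 / 3 + ε) / β₀ * (r * α) := by
    have e1 : M * r * (c₁ ^ 2 * (r * α) ^ 2 / (3 / 4 * a * α)) ≤ ε / β₀ * (r * α) := by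
      have : M * r * (c₁ ^ 2 * (r * α) ^ 2 / (3 / 4 * a * α))
          = (M * (c₁ ^ 2 / (3 / 4 * a)) * β₀ * r) * r / β₀ * (r * α) := by
        field_simp
      rw [this]
      gcongr
      calc _ ≤ ε * 1 := by gcongr
        _ = ε := mul_one _
    have e2 : c ^ 2 * (r * α) ^ 2 ≤ ε / β₀ * (r * α) := by
      have h1 : c ^ 2 * (r * α) ^ 2 = (c ^ 2 * β₀ * α) / β₀ * (r * α) * r := by field_simp
      rw [h1]
      calc _ ≤ ε / β₀ * (r * α) * 1 := by gcongr
        _ = _ := mul_one _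
    have e3 : (2 * c - κ) * (r * α) = (2 / 3 + 3 * ε) / β₀ * (r * α) := by
      rw [← hε]; field_simp
    have e4 : (2 / 3 + 3 * ε) / β₀ * (r * α)
        = (2 / 3 + ε) / β₀ * (r * α) + ε / β₀ * (r * α) + ε / β₀ * (r * α) := by ring
    linarith
  -- The choice `M = 4C₂/a` makes the coupling of `w` to `u` cost a quarter `aα/4` of the fast
  -- contraction; the remaining half dominates the slow rate.
  have huc : M * r * (1 - 3 / 4 * a * α) + (c₁ ^ 2 / κ + c₁ ^ 2 * (r * α)) * (r * α)
      ≤ (1 - (2 / 3 + ε) / β₀ * (r * α)) * (M * r) := by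
    have e1 : (c₁ ^ 2 / κ + c₁ ^ 2 * (r * α)) * (r * α) ≤ M * r * (1 / 4 * a * α) := by
      have : M * r * (1 / 4 * a * α) = C₂ * (r * α) := by
        rw [hM]; field_simp
      rw [this, hC₂]
      gcongr
    have e2 : (2 / 3 + ε) / β₀ * (r * α) ≤ a / 2 * α := by
      rw [← mul_assoc]; gcongr
    have e3 : 0 < M * r := by positivity
    linarith [mul_le_mul_of_nonneg_left e2 e3.le]
  have hnz : c₂ * (r * α) ^ 2 + M * r * (c₂ * α ^ 2) ≤ (c₂ + M * c₂) * (α * (r * α)) := by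
    have e2 : c₂ * (r * α) ^ 2 ≤ c₂ * (α * (r * α)) := by
      rw [show (r * α) ^ 2 = r * (α * (r * α)) by ring]
      exact mul_le_mul_of_nonneg_left (mul_le_of_le_one_left (by positivity) hr1) hc₂
    linarith
  calc w' + M * r * u' ≤ _ := add_le_add f2 (mul_le_mul_of_nonneg_left f1 (by positivity))
    _ = (1 - (2 * c - κ) * (r * α) + c ^ 2 * (r * α) ^ 2
          + M * r * (c₁ ^ 2 * (r * α) ^ 2 / (3 / 4 * a * α))) * w
        + (M * r * (1 - 3 / 4 * a * α) + (c₁ ^ 2 / κ + c₁ ^ 2 * (r * α)) * (r * α)) * u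
        + (c₂ * (r * α) ^ 2 + M * r * (c₂ * α ^ 2)) := by ring
    _ ≤ (1 - (2 / 3 + ε) / β₀ * (r * α)) * w + ((1 - (2 / 3 + ε) / β₀ * (r * α)) * (M * r)) * u
        + (c₂ + M * c₂) * (α * (r * α)) := by gcongr
    _ = _ := by ring

/-- Decay of the mean square errors of a two-time-scale recursion, from the recursive inequalities
satisfied by the fast error `u` and the slow error `w`. -/
theorem exists_two_time_scale_bound {a c κ c₁ c₂ α₀ β₀ e u₀ w₀ : ℝ} (ha : 0 < a) (hκ : 0 < κ)
    (hc : 2 / 3 < (2 * c - κ) * β₀) (hc₁ : 0 < c₁) (hc₂ : 0 ≤ c₂) (hβ₀ : 0 < β₀) (hβα : β₀ ≤ α₀)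
    (he : 0 < e) (hu₀ : 0 ≤ u₀) (hw₀ : 0 ≤ w₀) :
    ∃ D : ℝ, 0 ≤ D ∧ ∀ u w : ℕ → ℝ, (∀ k, 0 ≤ u k) → (∀ k, 0 ≤ w k) → u 0 ≤ u₀ → w 0 ≤ w₀ →
      (∀ k, u (k + 1) ≤ c₂ * (u k + w k) + c₂) → (∀ k, w (k + 1) ≤ c₂ * (u k + w k) + c₂) →
      (∀ k, fastStep α₀ k ≤ e → slowStep β₀ k / fastStep α₀ k ≤ e →
        u (k + 1) ≤ (1 - 3 / 4 * a * fastStep α₀ k) * u k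
            + c₁ ^ 2 * slowStep β₀ k ^ 2 / (3 / 4 * a * fastStep α₀ k) * w k
            + c₂ * fastStep α₀ k ^ 2 ∧
        w (k + 1) ≤ (1 - (2 * c - κ) * slowStep β₀ k + c ^ 2 * slowStep β₀ k ^ 2) * w k
            + (c₁ ^ 2 / κ + c₁ ^ 2 * slowStep β₀ k) * slowStep β₀ k * u k
            + c₂ * slowStep β₀ k ^ 2) →
      ∀ k : ℕ, w k + slowStep β₀ k / fastStep α₀ k * u k ≤ D / ((k : ℝ) + 1) ^ (2 / 3 : ℝ) := by
  have hα₀ : 0 < α₀ := hβ₀.trans_le hβα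
  set ρ : ℕ → ℝ := fun k => slowStep β₀ k / fastStep α₀ k with hρ
  have hρ_eq : ∀ k, ρ k = β₀ / (α₀ * cbrt (k + 1)) := slowStep_div_fastStep α₀ β₀
  have hρ0 : ∀ k, 0 < ρ k := fun k => by
    rw [hρ_eq]; have := cbrt_succ_pos k; positivity
  have hρanti : ∀ k, ρ (k + 1) ≤ ρ k := fun k => by
    rw [hρ_eq, hρ_eq]
    have := cbrt_succ_pos k
    have h2 : cbrt (k + 1) ≤ cbrt (k + 1 + 1) := cbrt_mono (by omega)
    gcongr
  have hρle : ∀ k, ρ k ≤ ρ 0 := fun k => by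
    induction k with
    | zero => exact le_rfl
    | succ k ih => exact (hρanti k).trans ih
  set ε := ((2 * c - κ) * β₀ - 2 / 3) / 3 with hε
  have hε0 : 0 < ε := by rw [hε]; linarith
  set C₂ := c₁ ^ 2 / κ + c₁ ^ 2 * β₀ with hC₂
  have hC₂0 : 0 < C₂ := by positivity
  set M := 4 * C₂ / a with hM
  have hM0 : 0 < M := by positivity
  have hαpos : ∀ k, 0 < fastStep α₀ k := fun k => by
    rw [fastStep_eq]; have := cbrt_succ_pos k; positivity
  have hβpos : ∀ k, 0 < slowStep β₀ k := fun k => by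
    rw [slowStep_eq]; have := cbrt_succ_pos k; positivity
  have hβle : ∀ k, slowStep β₀ k ≤ β₀ := fun k => by
    rw [slowStep_eq]
    exact div_le_self hβ₀.le (one_le_pow₀ (one_le_cbrt (by omega)))
  obtain ⟨k₀, hk₀⟩ : ∃ k₀, ∀ k, k₀ ≤ k → fastStep α₀ k ≤ e ∧ ρ k ≤ e ∧ ρ k ≤ 1 ∧
      c ^ 2 * β₀ * fastStep α₀ k ≤ ε ∧ M * (c₁ ^ 2 / (3 / 4 * a)) * β₀ * ρ k ≤ ε ∧
      (2 / 3 + ε) / β₀ * ρ k ≤ a / 2 := by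
    have t1 := tendsto_fastStep α₀
    have t2 : Filter.Tendsto ρ Filter.atTop (nhds 0) := tendsto_slowStep_div_fastStep α₀ β₀
    have t3 := t1.const_mul (c ^ 2 * β₀)
    have t4 := t2.const_mul (M * (c₁ ^ 2 / (3 / 4 * a)) * β₀)
    have t5 := t2.const_mul ((2 / 3 + ε) / β₀)
    rw [mul_zero] at t3 t4 t5
    have := ((t1.eventually_le_const he).and ((t2.eventually_le_const he).and
      ((t2.eventually_le_const one_pos).and ((t3.eventually_le_const hε0).and
      ((t4.eventually_le_const hε0).and (t5.eventually_le_const (half_pos ha)))))))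
    exact Filter.eventually_atTop.1 this
  -- Crude growth factor for the finitely many early steps; `1/(M ρ k)` recovers `u` from the
  -- weighted sum.
  set G : ℕ → ℝ := fun k => (1 + M * ρ 0) * (c₂ * (1 / (M * ρ k) + 1) + c₂) with hG
  have hG0 : ∀ k, 0 ≤ G k := fun k => by
    have := hρ0 k
    have := hρ0 0
    positivity
  obtain ⟨D, hD, hmain⟩ := exists_decay_bound (s := 2 / 3 + ε) (C := (c₂ + M * c₂) * (α₀ * β₀))
    (z₀ := w₀ + M * ρ 0 * u₀) (by linarith) hG0 (by have := hρ0 0; positivity) k₀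
  refine ⟨(1 + 1 / M) * D, by positivity, fun u w hu hw hu0 hw0 hcu hcw hfine k => ?_⟩
  have hZ := hmain (fun k => w k + M * ρ k * u k)
    (fun k => by have := hρ0 k; have := hu k; have := hw k; positivity)
    (by have := hρ0 0; gcongr) ?_ ?_ k
  · have h1 := hu k
    have h2 := hw k
    have h3 := hρ0 k
    rw [mul_div_assoc]
    calc w k + ρ k * u k ≤ (1 + 1 / M) * (w k + M * ρ k * u k) := by
          have e1 : (1 + 1 / M) * (w k + M * ρ k * u k)
            = w k + ρ k * u k + (w k / M + M * ρ k * u k) := by field_simp; ring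
          rw [e1]
          have : 0 ≤ w k / M + M * ρ k * u k := by positivity
          linarith
      _ ≤ _ := by gcongr
  · intro k
    have h1 := hu k
    have h2 := hw k
    have h3 := hρ0 k
    have h4 : ρ (k + 1) ≤ ρ 0 := hρle _
    have h5 := hu (k + 1)
    have h6 := hρ0 0
    have e1 : u k ≤ 1 / (M * ρ k) * (w k + M * ρ k * u k) := by
      have : 1 / (M * ρ k) * (w k + M * ρ k * u k) = u k + w k / (M * ρ k) := by
        field_simp; ring
      rw [this]
      have : 0 ≤ w k / (M * ρ k) := by positivity
      linarith
    have e2 : w k ≤ w k + M * ρ k * u k := by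
      have : 0 ≤ M * ρ k * u k := by positivity
      linarith
    set z := w k + M * ρ k * u k
    have hz : 0 ≤ z := h2.trans e2
    have e3 : c₂ * (u k + w k) + c₂ ≤ (c₂ * (1 / (M * ρ k) + 1) + c₂) * z
        + (c₂ * (1 / (M * ρ k) + 1) + c₂) := by
      have h7 : c₂ * (u k + w k) ≤ c₂ * (1 / (M * ρ k) * z + z) := by gcongr
      have h8 : 0 ≤ c₂ * (1 / (M * ρ k) + 1) := by positivity
      have h9 : 0 ≤ c₂ * z := by positivity
      nlinarith
    calc w (k + 1) + M * ρ (k + 1) * u (k + 1)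
        ≤ w (k + 1) + M * ρ 0 * u (k + 1) := by gcongr
      _ ≤ (c₂ * (u k + w k) + c₂) + M * ρ 0 * (c₂ * (u k + w k) + c₂) := by
          gcongr
          · exact hcw k
          · exact hcu k
      _ = (1 + M * ρ 0) * (c₂ * (u k + w k) + c₂) := by ring
      _ ≤ (1 + M * ρ 0) * ((c₂ * (1 / (M * ρ k) + 1) + c₂) * z
        + (c₂ * (1 / (M * ρ k) + 1) + c₂)) := by gcongr
      _ = _ := by simp only [hG]; ring
  · intro k hk
    obtain ⟨s1, s2, s3, s4, s5, s6⟩ := hk₀ k hk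
    obtain ⟨f1, f2⟩ := hfine k s1 s2
    have h1 := hu k
    have h2 := hw k
    have h3 := hρ0 k
    have hαk := hαpos k
    have hβk := hβpos k
    have hβkle := hβle k
    have hβρ : slowStep β₀ k = ρ k * fastStep α₀ k := by
      simp only [hρ]; field_simp
    have hαβ : (c₂ + M * c₂) * (α₀ * β₀) / (((k : ℝ) + 1) * ((k : ℝ) + 1) ^ (2 / 3 : ℝ))
        = (c₂ + M * c₂) * (fastStep α₀ k * slowStep β₀ k) := by
      simp only [fastStep, slowStep]; field_simp
    have hsβ : (2 / 3 + ε) / ((k : ℝ) + 1) = (2 / 3 + ε) / β₀ * slowStep β₀ k := by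
      simp only [slowStep]; field_simp
    rw [hαβ, hsβ]
    have h5 := hu (k + 1)
    have hstep := two_time_scale_step (w' := w (k + 1)) (u' := u (k + 1)) ha hβ₀ hC₂ hM hM0 hc₂
      (by rw [hε]; ring) hε0 hαk h3 s3 (by rw [← hβρ]; exact hβkle) h1 h2 s4 s5 s6
      (by rw [← hβρ]; exact f1) (by rw [← hβρ]; exact f2)
    rw [← hβρ] at hstep
    refine le_trans ?_ hstep
    gcongr
    exact hρanti k

/-- Young's inequality in the form of convexity of the square. -/
lemma sq_add_le_of_convex {t x y : ℝ} (ht : 0 < t) (ht1 : t ≤ 1) :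
    ((1 - t) * x + y) ^ 2 ≤ (1 - t) * x ^ 2 + y ^ 2 / t := by
  have h : (1 - t) * x ^ 2 + y ^ 2 / t - ((1 - t) * x + y) ^ 2 = (1 - t) * (t * x - y) ^ 2 / t := by
    field_simp; ring
  have : 0 ≤ (1 - t) * (t * x - y) ^ 2 / t := by
    have : 0 ≤ 1 - t := by linarith
    positivity
  linarith

/-! ### One-step estimates in the adapted norms. -/

section Deterministic

variable {E H₁ H₂ : Type*} [NormedAddCommGroup E] [NormedSpace ℝ E] [NormedAddCommGroup H₁]
  [NormedSpace ℝ H₁] [NormedAddCommGroup H₂] [NormedSpace ℝ H₂]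

lemma norm_fast_step_le {A D B L : E →L[ℝ] E} {Φ₁ : E →L[ℝ] H₁} {Φ₂ : E →L[ℝ] H₂} {a e c₁ : ℝ}
    (hΦ₁ : ∀ v, ‖v‖ ≤ ‖Φ₁ v‖) (hΦ₂ : ∀ v, ‖v‖ ≤ ‖Φ₂ v‖)
    (hA : ∀ t, 0 ≤ t → t ≤ e → ∀ v, ‖Φ₁ (v - t • A v)‖ ≤ (1 - t * a) * ‖Φ₁ v‖)
    (hc₁ : ‖Φ₁‖ * ‖L‖ * (‖D‖ + ‖B‖) ≤ c₁) {α β : ℝ} (hα : 0 ≤ α) (hαe : α ≤ e) (hβ : 0 ≤ β)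
    (x y : E) :
    ‖Φ₁ (x - α • A x - β • L (D y + B x))‖
      ≤ (1 - α * a) * ‖Φ₁ x‖ + β * c₁ * (‖Φ₁ x‖ + ‖Φ₂ y‖) := by
  have h1 : ‖Φ₁ (L (D y + B x))‖ ≤ c₁ * (‖Φ₁ x‖ + ‖Φ₂ y‖) := by
    have h2 : ‖D y + B x‖ ≤ (‖D‖ + ‖B‖) * (‖Φ₁ x‖ + ‖Φ₂ y‖) := by
      have hd : ‖D y‖ ≤ ‖D‖ * ‖Φ₂ y‖ := (D.le_opNorm y).trans (by gcongr; exact hΦ₂ y)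
      have hb : ‖B x‖ ≤ ‖B‖ * ‖Φ₁ x‖ := (B.le_opNorm x).trans (by gcongr; exact hΦ₁ x)
      calc _ ≤ ‖D‖ * ‖Φ₂ y‖ + ‖B‖ * ‖Φ₁ x‖ := (norm_add_le _ _).trans (add_le_add hd hb)
        _ ≤ _ := by
          have : 0 ≤ ‖D‖ * ‖Φ₁ x‖ + ‖B‖ * ‖Φ₂ y‖ := by positivity
          nlinarith
    calc _ ≤ ‖Φ₁‖ * (‖L‖ * ((‖D‖ + ‖B‖) * (‖Φ₁ x‖ + ‖Φ₂ y‖))) := by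
          refine (Φ₁.le_opNorm _).trans ?_
          gcongr
          exact (L.le_opNorm _).trans (by gcongr)
      _ = ‖Φ₁‖ * ‖L‖ * (‖D‖ + ‖B‖) * (‖Φ₁ x‖ + ‖Φ₂ y‖) := by ring
      _ ≤ _ := by gcongr
  rw [map_sub, map_smul Φ₁ β]
  refine (norm_sub_le _ _).trans (add_le_add (hA α hα hαe x) ?_)
  rw [norm_smul, Real.norm_of_nonneg hβ, mul_assoc]
  gcongr

lemma norm_slow_step_le {D B : E →L[ℝ] E} {Φ₁ : E →L[ℝ] H₁} {Φ₂ : E →L[ℝ] H₂} {c e c₁ : ℝ}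
    (hΦ₁ : ∀ v, ‖v‖ ≤ ‖Φ₁ v‖)
    (hD : ∀ t, 0 ≤ t → t ≤ e → ∀ v, ‖Φ₂ (v - t • D v)‖ ≤ (1 - t * c) * ‖Φ₂ v‖)
    (hc₁ : ‖Φ₂‖ * ‖B‖ ≤ c₁) {β : ℝ} (hβ : 0 ≤ β) (hβe : β ≤ e) (x y : E) :
    ‖Φ₂ (y - β • (D y + B x))‖ ≤ (1 - β * c) * ‖Φ₂ y‖ + β * c₁ * ‖Φ₁ x‖ := by
  have e1 : y - β • (D y + B x) = (y - β • D y) - β • B x := by rw [smul_add]; abel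
  rw [e1, map_sub, map_smul Φ₂ β]
  refine (norm_sub_le _ _).trans (add_le_add (hD β hβ hβe y) ?_)
  rw [norm_smul, Real.norm_of_nonneg hβ, mul_assoc]
  gcongr
  calc _ ≤ ‖Φ₂‖ * (‖B‖ * ‖Φ₁ x‖) := by
        refine (Φ₂.le_opNorm _).trans ?_
        gcongr
        exact (B.le_opNorm _).trans (by gcongr; exact hΦ₁ x)
    _ = ‖Φ₂‖ * ‖B‖ * ‖Φ₁ x‖ := by ring
    _ ≤ _ := by gcongr

/-- Valid for every admissible step, not only for small ones; it controls the finitely many times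
before the contraction sets in. -/
lemma norm_fast_step_le_crude {A D B L : E →L[ℝ] E} {Φ₁ : E →L[ℝ] H₁} {Φ₂ : E →L[ℝ] H₂}
    {a e c₁ : ℝ} (hΦ₁ : ∀ v, ‖v‖ ≤ ‖Φ₁ v‖) (hΦ₂ : ∀ v, ‖v‖ ≤ ‖Φ₂ v‖) (he : 0 ≤ e)
    (hA : ∀ t, 0 ≤ t → t ≤ e → ∀ v, ‖Φ₁ (v - t • A v)‖ ≤ (1 - t * a) * ‖Φ₁ v‖)
    (hc₁ : ‖Φ₁‖ * ‖L‖ * (‖D‖ + ‖B‖) ≤ c₁) (hc₁0 : 0 ≤ c₁) {α β α₀ β₀ : ℝ} (hα : 0 ≤ α)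
    (hα₀ : α ≤ α₀) (hβ : 0 ≤ β) (hβ₀ : β ≤ β₀) (v w : E) :
    ‖Φ₁ (v - α • A v - β • L (D w + B v))‖ ^ 2
      ≤ 2 * (1 + α₀ * (‖Φ₁‖ * ‖A‖) + β₀ * c₁) ^ 2 * ‖Φ₁ v‖ ^ 2
        + 2 * (1 + α₀ * (‖Φ₁‖ * ‖A‖) + β₀ * c₁) ^ 2 * ‖Φ₂ w‖ ^ 2 := by
  have hα₀0 := hα.trans hα₀
  have hβ₀0 := hβ.trans hβ₀
  -- The contraction estimate is applied with fast step zero; the actual fast drift is then bounded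
  -- by its operator norm.
  have h2 := norm_fast_step_le (e := e) hΦ₁ hΦ₂ hA hc₁ le_rfl he hβ v w
  simp only [zero_smul, sub_zero, zero_mul, one_mul] at h2
  have h3 : ‖Φ₁ (α • A v)‖ ≤ α₀ * (‖Φ₁‖ * ‖A‖) * ‖Φ₁ v‖ := by
    rw [map_smul, norm_smul, Real.norm_of_nonneg hα]
    calc _ ≤ α₀ * (‖Φ₁‖ * (‖A‖ * ‖Φ₁ v‖)) := by
          gcongr
          refine (Φ₁.le_opNorm _).trans ?_
          gcongr
          exact (A.le_opNorm _).trans (by gcongr; exact hΦ₁ v)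
      _ = _ := by ring
  have h4 : ‖Φ₁ (v - α • A v - β • L (D w + B v))‖
      ≤ (1 + α₀ * (‖Φ₁‖ * ‖A‖) + β₀ * c₁) * (‖Φ₁ v‖ + ‖Φ₂ w‖) := by
    have e1 : v - α • A v - β • L (D w + B v) = (v - β • L (D w + B v)) - α • A v := by abel
    rw [e1, map_sub Φ₁]
    have h5 : β * c₁ * (‖Φ₁ v‖ + ‖Φ₂ w‖) ≤ β₀ * c₁ * (‖Φ₁ v‖ + ‖Φ₂ w‖) := by gcongr
    have h6 : 0 ≤ (1 + α₀ * (‖Φ₁‖ * ‖A‖)) * ‖Φ₂ w‖ := by positivity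
    calc _ ≤ _ := norm_sub_le _ _
      _ ≤ _ := add_le_add h2 h3
      _ ≤ _ := by linarith
  set C := 1 + α₀ * (‖Φ₁‖ * ‖A‖) + β₀ * c₁
  calc _ ≤ (C * (‖Φ₁ v‖ + ‖Φ₂ w‖)) ^ 2 := by gcongr
    _ ≤ _ := by nlinarith [mul_nonneg (sq_nonneg C) (sq_nonneg (‖Φ₁ v‖ - ‖Φ₂ w‖))]

lemma norm_slow_step_le_crude {D B : E →L[ℝ] E} {Φ₁ : E →L[ℝ] H₁} {Φ₂ : E →L[ℝ] H₂} {c₁ : ℝ}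
    (hΦ₁ : ∀ v, ‖v‖ ≤ ‖Φ₁ v‖) (hΦ₂ : ∀ v, ‖v‖ ≤ ‖Φ₂ v‖) (hc₁ : ‖Φ₂‖ * ‖B‖ ≤ c₁)
    (hc₁0 : 0 ≤ c₁) {β β₀ : ℝ} (hβ : 0 ≤ β) (hβ₀ : β ≤ β₀) (v w : E) :
    ‖Φ₂ (w - β • (D w + B v))‖ ^ 2
      ≤ 2 * (1 + β₀ * (‖Φ₂‖ * ‖D‖) + β₀ * c₁) ^ 2 * ‖Φ₁ v‖ ^ 2
        + 2 * (1 + β₀ * (‖Φ₂‖ * ‖D‖) + β₀ * c₁) ^ 2 * ‖Φ₂ w‖ ^ 2 := by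
  have hβ₀0 := hβ.trans hβ₀
  have hd : ‖Φ₂ (D w)‖ ≤ ‖Φ₂‖ * ‖D‖ * ‖Φ₂ w‖ := by
    rw [mul_assoc]
    refine (Φ₂.le_opNorm _).trans ?_
    gcongr
    exact (D.le_opNorm _).trans (by gcongr; exact hΦ₂ w)
  have hb : ‖Φ₂ (B v)‖ ≤ c₁ * ‖Φ₁ v‖ := by
    calc _ ≤ ‖Φ₂‖ * (‖B‖ * ‖Φ₁ v‖) := by
          refine (Φ₂.le_opNorm _).trans ?_
          gcongr
          exact (B.le_opNorm _).trans (by gcongr; exact hΦ₁ v)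
      _ = ‖Φ₂‖ * ‖B‖ * ‖Φ₁ v‖ := by ring
      _ ≤ _ := by gcongr
  have h4 : ‖Φ₂ (w - β • (D w + B v))‖
      ≤ (1 + β₀ * (‖Φ₂‖ * ‖D‖) + β₀ * c₁) * (‖Φ₁ v‖ + ‖Φ₂ w‖) := by
    rw [map_sub, map_smul Φ₂, map_add]
    calc _ ≤ ‖Φ₂ w‖ + β₀ * (‖Φ₂‖ * ‖D‖ * ‖Φ₂ w‖ + c₁ * ‖Φ₁ v‖) := by
          refine (norm_sub_le _ _).trans ?_
          rw [norm_smul, Real.norm_of_nonneg hβ]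
          gcongr
          exact (norm_add_le _ _).trans (add_le_add hd hb)
      _ ≤ _ := by
          have h6 : 0 ≤ (1 + β₀ * (‖Φ₂‖ * ‖D‖)) * ‖Φ₁ v‖ := by positivity
          have h7 : 0 ≤ β₀ * c₁ * ‖Φ₂ w‖ := by positivity
          linarith
  set C := 1 + β₀ * (‖Φ₂‖ * ‖D‖) + β₀ * c₁
  calc _ ≤ (C * (‖Φ₁ v‖ + ‖Φ₂ w‖)) ^ 2 := by gcongr
    _ ≤ _ := by nlinarith [mul_nonneg (sq_nonneg C) (sq_nonneg (‖Φ₁ v‖ - ‖Φ₂ w‖))]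

/-- A quarter of the contraction absorbs the coupling `βc₁` of `p` to itself; the coupling to `q` is
split off by convexity with `t = 3/4 · aα`. -/
lemma sq_fast_le {a c₁ α β p q N : ℝ} (hα : 0 < α) (ha : 0 < a) (hp : 0 ≤ p) (hN : 0 ≤ N)
    (hβc : β * c₁ ≤ 1 / 4 * a * α) (hαa : α * a ≤ 1)
    (h : N ≤ (1 - α * a) * p + β * c₁ * (p + q)) :
    N ^ 2 ≤ (1 - 3 / 4 * a * α) * p ^ 2 + c₁ ^ 2 * β ^ 2 / (3 / 4 * a * α) * q ^ 2 := by
  have h3 : N ≤ (1 - 3 / 4 * a * α) * p + β * c₁ * q := by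
    have := mul_le_mul_of_nonneg_right hβc hp
    linarith
  calc _ ≤ ((1 - 3 / 4 * a * α) * p + β * c₁ * q) ^ 2 := by gcongr
    _ ≤ _ := sq_add_le_of_convex (by positivity) (by linarith)
    _ = _ := by ring

/-- The cross term is split with weight `κ`. Here `κ` is part of the rate, so it has to be small
enough to leave `2c - κ` above the threshold. -/
lemma sq_slow_le {c κ c₁ β p q N : ℝ} (hβ : 0 ≤ β) (hc : 0 ≤ c) (hκ : 0 < κ) (hc₁ : 0 ≤ c₁)
    (hp : 0 ≤ p) (hq : 0 ≤ q) (hN : 0 ≤ N) (h : N ≤ (1 - β * c) * q + β * c₁ * p) :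
    N ^ 2 ≤ (c₁ ^ 2 / κ + c₁ ^ 2 * β) * β * p ^ 2
      + (1 - (2 * c - κ) * β + c ^ 2 * β ^ 2) * q ^ 2 := by
  have h3 : 2 * (c₁ * p) * q ≤ c₁ ^ 2 / κ * p ^ 2 + κ * q ^ 2 := by
    have e1 : c₁ ^ 2 / κ * p ^ 2 + κ * q ^ 2 - 2 * (c₁ * p) * q = (c₁ * p - κ * q) ^ 2 / κ := by
      field_simp; ring
    have : 0 ≤ (c₁ * p - κ * q) ^ 2 / κ := by positivity
    linarith
  have h5 : 0 ≤ β * c * (2 * (β * (c₁ * p * q))) := by positivity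
  calc _ ≤ ((1 - β * c) * q + β * c₁ * p) ^ 2 := by gcongr
    _ = (1 - 2 * (β * c) + (β * c) ^ 2) * q ^ 2 + β * (2 * (c₁ * p) * q)
        - β * c * (2 * (β * (c₁ * p * q))) + c₁ ^ 2 * β * β * p ^ 2 := by ring
    _ ≤ (1 - 2 * (β * c) + (β * c) ^ 2) * q ^ 2 + β * (c₁ ^ 2 / κ * p ^ 2 + κ * q ^ 2) - 0
        + c₁ ^ 2 * β * β * p ^ 2 := by gcongr
    _ = _ := by ring

end Deterministic

/-! ### Mean square recursions under independent centered noise. -/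

section Probability

variable {Ω : Type*} [MeasurableSpace Ω] {P : Measure Ω} {d : ℕ}
  {H : Type*} [NormedAddCommGroup H] [InnerProductSpace ℝ H]

/-- Expanding the square needs an inner product on the target; the cross term is bilinear, so
independence and zero mean of `g` annihilate it. -/
lemma integral_norm_sq_map_add [IsProbabilityMeasure P] {f g : Ω → Vec d} (hf : MemLp f 2 P) (hg : MemLp g 2 P)
    (hfg : IndepFun f g P) (hg0 : ∫ ω, g ω ∂P = 0) (Φ : Vec d →L[ℝ] H) :
    ∫ ω, ‖Φ (f ω + g ω)‖ ^ 2 ∂P = ∫ ω, ‖Φ (f ω)‖ ^ 2 ∂P + ∫ ω, ‖Φ (g ω)‖ ^ 2 ∂P := by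
  have hcross : ∫ ω, inner ℝ (Φ (f ω)) (Φ (g ω)) ∂P = 0 := by
    have := hfg.integral_bilin (hf.integrable one_le_two) (hg.integrable one_le_two)
      ((innerSL ℝ).bilinearComp Φ Φ)
    rw [hg0, map_zero] at this
    exact this
  have hΦf : MemLp (fun ω => Φ (f ω)) 2 P := Φ.comp_memLp' hf
  have hΦg : MemLp (fun ω => Φ (g ω)) 2 P := Φ.comp_memLp' hg
  have h1 : ∀ ω, ‖Φ (f ω + g ω)‖ ^ 2
      = ‖Φ (f ω)‖ ^ 2 + 2 * inner ℝ (Φ (f ω)) (Φ (g ω)) + ‖Φ (g ω)‖ ^ 2 := fun ω => by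
    rw [map_add, norm_add_sq_real]
  have hi1 : Integrable (fun ω => ‖Φ (f ω)‖ ^ 2) P := hΦf.integrable_norm_pow two_ne_zero
  have hi2 : Integrable (fun ω => ‖Φ (g ω)‖ ^ 2) P := hΦg.integrable_norm_pow two_ne_zero
  have hi3 : Integrable (fun ω => inner ℝ (Φ (f ω)) (Φ (g ω))) P := by
    have hi4 : Integrable (fun ω => ‖Φ (f ω + g ω)‖ ^ 2) P :=
      (Φ.comp_memLp' (hf.add hg)).integrable_norm_pow two_ne_zero
    have : (fun ω => inner ℝ (Φ (f ω)) (Φ (g ω)))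
        = fun ω => (1 / 2) * (‖Φ (f ω + g ω)‖ ^ 2 - ‖Φ (f ω)‖ ^ 2 - ‖Φ (g ω)‖ ^ 2) := by
      ext ω; rw [h1]; ring
    rw [this]
    exact ((hi4.sub hi1).sub hi2).const_mul _
  simp only [h1]
  have hi5 : Integrable (fun ω => ‖Φ (f ω)‖ ^ 2 + 2 * inner ℝ (Φ (f ω)) (Φ (g ω))) P :=
    hi1.add (hi3.const_mul 2)
  rw [integral_add hi5 hi2, integral_add hi1 (hi3.const_mul 2),
    integral_const_mul, hcross]
  ring

lemma integral_norm_sq_map_le {g : Ω → Vec d} (hg : MemLp g 2 P) (Φ : Vec d →L[ℝ] H) :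
    ∫ ω, ‖Φ (g ω)‖ ^ 2 ∂P ≤ ‖Φ‖ ^ 2 * ∫ ω, ‖g ω‖ ^ 2 ∂P := by
  rw [← integral_const_mul]
  refine integral_mono ((Φ.comp_memLp' hg).integrable_norm_pow two_ne_zero)
    ((hg.integrable_norm_pow two_ne_zero).const_mul _) fun ω => ?_
  simp only
  rw [← mul_pow]
  gcongr
  exact Φ.le_opNorm _

end Probability

/-- A linear two-time-scale stochastic recursion driven by independent centered noise, written in
the coordinates in which the slow drift `D` and the fast drift `A` are decoupled to first order. -/
structure IsTwoTimeScale {Ω : Type*} [MeasurableSpace Ω] (P : Measure Ω) {d : ℕ}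
    (A D B L : Vec d →L[ℝ] Vec d) (α β : ℕ → ℝ) (x₀ y₀ : Vec d) (s : ℝ)
    (x y ξ ψ : ℕ → Ω → Vec d) : Prop where
  init_fast : ∀ ω, x 0 ω = x₀
  init_slow : ∀ ω, y 0 ω = y₀
  step_fast : ∀ k ω, x (k + 1) ω = (x k ω - α k • A (x k ω) - β k • L (D (y k ω) + B (x k ω)))
    + -(α k • ξ k ω + β k • L (ψ k ω))
  step_slow : ∀ k ω, y (k + 1) ω = (y k ω - β k • (D (y k ω) + B (x k ω))) + -(β k • ψ k ω)
  indep : ∀ k, IndepFun (fun ω => (x k ω, y k ω)) (fun ω => (ξ k ω, ψ k ω)) P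
  memLp_fast : ∀ k, MemLp (x k) 2 P
  memLp_slow : ∀ k, MemLp (y k) 2 P
  memLp_noise_fast : ∀ k, MemLp (ξ k) 2 P
  memLp_noise_slow : ∀ k, MemLp (ψ k) 2 P
  mean_fast : ∀ k, ∫ ω, ξ k ω ∂P = 0
  mean_slow : ∀ k, ∫ ω, ψ k ω ∂P = 0
  moment_fast : ∀ k, ∫ ω, ‖ξ k ω‖ ^ 2 ∂P ≤ s
  moment_slow : ∀ k, ∫ ω, ‖ψ k ω‖ ^ 2 ∂P ≤ s

namespace IsTwoTimeScale

variable {Ω : Type*} [MeasurableSpace Ω] {P : Measure Ω} {d : ℕ}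
  {A D B L : Vec d →L[ℝ] Vec d} {α β : ℕ → ℝ} {x₀ y₀ : Vec d} {s : ℝ} {x y ξ ψ : ℕ → Ω → Vec d}
  {H : Type*} [NormedAddCommGroup H] [InnerProductSpace ℝ H]

lemma integral_fast_succ [IsProbabilityMeasure P]
    (h : IsTwoTimeScale P A D B L α β x₀ y₀ s x y ξ ψ)
    (Φ : Vec d →L[ℝ] H) (k : ℕ) (hβ : 0 ≤ β k) (hβα : β k ≤ α k) :
    ∫ ω, ‖Φ (x (k + 1) ω)‖ ^ 2 ∂P
      ≤ ∫ ω, ‖Φ (x k ω - α k • A (x k ω) - β k • L (D (y k ω) + B (x k ω)))‖ ^ 2 ∂P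
        + 2 * ‖Φ‖ ^ 2 * (1 + ‖L‖ ^ 2) * s * α k ^ 2 := by
  have hx := h.memLp_fast k
  have hy := h.memLp_slow k
  have hξ := h.memLp_noise_fast k
  have hψ := h.memLp_noise_slow k
  have hm : MemLp (fun ω => x k ω - α k • A (x k ω) - β k • L (D (y k ω) + B (x k ω))) 2 P :=
    (hx.sub ((A.comp_memLp' hx).const_smul (α k))).sub
      ((L.comp_memLp' ((D.comp_memLp' hy).add (B.comp_memLp' hx))).const_smul (β k))
  have hn : MemLp (fun ω => -(α k • ξ k ω + β k • L (ψ k ω))) 2 P :=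
    ((hξ.const_smul (α k)).add ((L.comp_memLp' hψ).const_smul (β k))).neg
  have hn0 : ∫ ω, -(α k • ξ k ω + β k • L (ψ k ω)) ∂P = 0 := by
    have h1 : Integrable (fun ω => α k • ξ k ω) P :=
      (hξ.const_smul (α k)).integrable one_le_two
    have h2 : Integrable (fun ω => β k • L (ψ k ω)) P :=
      ((L.comp_memLp' hψ).const_smul (β k)).integrable one_le_two
    rw [integral_neg, integral_add h1 h2, integral_smul, integral_smul,
      L.integral_comp_comm (hψ.integrable one_le_two), h.mean_fast, h.mean_slow]
    simp
  have hind : IndepFun (fun ω => x k ω - α k • A (x k ω) - β k • L (D (y k ω) + B (x k ω)))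
      (fun ω => -(α k • ξ k ω + β k • L (ψ k ω))) P :=
    (h.indep k).comp (φ := fun p : Vec d × Vec d => p.1 - α k • A p.1 - β k • L (D p.2 + B p.1))
      (ψ := fun p : Vec d × Vec d => -(α k • p.1 + β k • L p.2)) (by fun_prop) (by fun_prop)
  simp only [h.step_fast]
  rw [integral_norm_sq_map_add hm hn hind hn0 Φ]
  gcongr
  refine (integral_norm_sq_map_le hn Φ).trans ?_
  have h3 : ∫ ω, ‖-(α k • ξ k ω + β k • L (ψ k ω))‖ ^ 2 ∂P
      ≤ 2 * α k ^ 2 * s + 2 * (α k ^ 2 * ‖L‖ ^ 2) * s := by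
    have i1 := (hξ.integrable_norm_pow two_ne_zero).const_mul (2 * α k ^ 2)
    have i2 := (hψ.integrable_norm_pow two_ne_zero).const_mul (2 * (α k ^ 2 * ‖L‖ ^ 2))
    calc _ ≤ ∫ ω, (2 * α k ^ 2 * ‖ξ k ω‖ ^ 2 + 2 * (α k ^ 2 * ‖L‖ ^ 2) * ‖ψ k ω‖ ^ 2) ∂P := by
          refine integral_mono (hn.integrable_norm_pow two_ne_zero) (i1.add i2) fun ω => ?_
          have hα : 0 ≤ α k := hβ.trans hβα
          have n1 : ‖-(α k • ξ k ω + β k • L (ψ k ω))‖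
              ≤ α k * ‖ξ k ω‖ + α k * ‖L‖ * ‖ψ k ω‖ := by
            rw [norm_neg]
            refine (norm_add_le _ _).trans ?_
            rw [norm_smul, norm_smul, Real.norm_of_nonneg hα, Real.norm_of_nonneg hβ, mul_assoc]
            gcongr
            exact L.le_opNorm _
          calc _ ≤ (α k * ‖ξ k ω‖ + α k * ‖L‖ * ‖ψ k ω‖) ^ 2 := by gcongr
            _ ≤ _ := by nlinarith [sq_nonneg (α k * ‖ξ k ω‖ - α k * ‖L‖ * ‖ψ k ω‖)]
      _ = 2 * α k ^ 2 * ∫ ω, ‖ξ k ω‖ ^ 2 ∂P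
          + 2 * (α k ^ 2 * ‖L‖ ^ 2) * ∫ ω, ‖ψ k ω‖ ^ 2 ∂P := by
          rw [integral_add i1 i2, integral_const_mul, integral_const_mul]
      _ ≤ _ := by
          gcongr
          · exact h.moment_fast k
          · exact h.moment_slow k
  calc _ ≤ ‖Φ‖ ^ 2 * (2 * α k ^ 2 * s + 2 * (α k ^ 2 * ‖L‖ ^ 2) * s) := by gcongr
    _ = _ := by ring

lemma integral_slow_succ [IsProbabilityMeasure P]
    (h : IsTwoTimeScale P A D B L α β x₀ y₀ s x y ξ ψ)
    (Φ : Vec d →L[ℝ] H) (k : ℕ) :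
    ∫ ω, ‖Φ (y (k + 1) ω)‖ ^ 2 ∂P
      ≤ ∫ ω, ‖Φ (y k ω - β k • (D (y k ω) + B (x k ω)))‖ ^ 2 ∂P + ‖Φ‖ ^ 2 * s * β k ^ 2 := by
  have hx := h.memLp_fast k
  have hy := h.memLp_slow k
  have hψ := h.memLp_noise_slow k
  have hm : MemLp (fun ω => y k ω - β k • (D (y k ω) + B (x k ω))) 2 P :=
    hy.sub (((D.comp_memLp' hy).add (B.comp_memLp' hx)).const_smul (β k))
  have hn : MemLp (fun ω => -(β k • ψ k ω)) 2 P := (hψ.const_smul (β k)).neg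
  have hn0 : ∫ ω, -(β k • ψ k ω) ∂P = 0 := by
    rw [integral_neg, integral_smul, h.mean_slow]
    simp
  have hind : IndepFun (fun ω => y k ω - β k • (D (y k ω) + B (x k ω)))
      (fun ω => -(β k • ψ k ω)) P :=
    (h.indep k).comp (φ := fun p : Vec d × Vec d => p.2 - β k • (D p.2 + B p.1))
      (ψ := fun p : Vec d × Vec d => -(β k • p.2)) (by fun_prop) (by fun_prop)
  simp only [h.step_slow]
  rw [integral_norm_sq_map_add hm hn hind hn0 Φ]
  gcongr
  refine (integral_norm_sq_map_le hn Φ).trans ?_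
  have h3 : ∫ ω, ‖-(β k • ψ k ω)‖ ^ 2 ∂P ≤ β k ^ 2 * s := by
    have : ∀ ω, ‖-(β k • ψ k ω)‖ ^ 2 = β k ^ 2 * ‖ψ k ω‖ ^ 2 := fun ω => by
      rw [norm_neg, norm_smul, mul_pow, Real.norm_eq_abs, sq_abs]
    simp only [this]
    rw [integral_const_mul]
    gcongr
    exact h.moment_slow k
  calc _ ≤ ‖Φ‖ ^ 2 * (β k ^ 2 * s) := by gcongr
    _ = _ := by ring

/-- Packaging one deterministic step as a linear map `T` of the pair lets all pointwise estimates,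
fine and crude, be integrated at once. -/
lemma integral_le_of_pointwise (h : IsTwoTimeScale P A D B L α β x₀ y₀ s x y ξ ψ)
    {H₁ H₂ : Type*} [NormedAddCommGroup H₁] [NormedSpace ℝ H₁] [NormedAddCommGroup H₂]
    [NormedSpace ℝ H₂] {Φ₁ : Vec d →L[ℝ] H₁} {Φ₂ : Vec d →L[ℝ] H₂} {T : Vec d × Vec d →L[ℝ] H}
    {c₁ c₂ : ℝ} (hT : ∀ v w, ‖T (v, w)‖ ^ 2 ≤ c₁ * ‖Φ₁ v‖ ^ 2 + c₂ * ‖Φ₂ w‖ ^ 2) (k : ℕ) :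
    ∫ ω, ‖T (x k ω, y k ω)‖ ^ 2 ∂P
      ≤ c₁ * ∫ ω, ‖Φ₁ (x k ω)‖ ^ 2 ∂P + c₂ * ∫ ω, ‖Φ₂ (y k ω)‖ ^ 2 ∂P := by
  have i1 : Integrable (fun ω => c₁ * ‖Φ₁ (x k ω)‖ ^ 2) P :=
    ((Φ₁.comp_memLp' (h.memLp_fast k)).integrable_norm_pow two_ne_zero).const_mul c₁
  have i2 : Integrable (fun ω => c₂ * ‖Φ₂ (y k ω)‖ ^ 2) P :=
    ((Φ₂.comp_memLp' (h.memLp_slow k)).integrable_norm_pow two_ne_zero).const_mul c₂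
  have i3 : MemLp (fun ω => T (x k ω, y k ω)) 2 P := by
    have e : (fun ω => T (x k ω, y k ω))
        = fun ω => (T.comp (.inl ℝ _ _)) (x k ω) + (T.comp (.inr ℝ _ _)) (y k ω) := by
      ext ω
      simp [← map_add]
    rw [e]
    exact ((T.comp (.inl ℝ _ _)).comp_memLp' (h.memLp_fast k)).add
      ((T.comp (.inr ℝ _ _)).comp_memLp' (h.memLp_slow k))
  rw [← integral_const_mul, ← integral_const_mul, ← integral_add i1 i2]
  exact integral_mono (i3.integrable_norm_pow two_ne_zero) (i1.add i2) fun ω => hT _ _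

end IsTwoTimeScale

/-- Mean square decay for two-time-scale stochastic recursions with the steps `α₀/(k+1)^{2/3}` and
`β₀/(k+1)`, uniformly over the probability space and the law of the noise. -/
theorem exists_integral_bound_of_isTwoTimeScale {d : ℕ} {A D B L : Vec d →L[ℝ] Vec d}
    {H₁ H₂ : Type*} [NormedAddCommGroup H₁] [InnerProductSpace ℝ H₁]
    [NormedAddCommGroup H₂] [InnerProductSpace ℝ H₂]
    {Φ₁ : Vec d →L[ℝ] H₁} {Φ₂ : Vec d →L[ℝ] H₂} {a c e₁ e₂ α₀ β₀ : ℝ}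
    (hΦ₁ : ∀ v, ‖v‖ ≤ ‖Φ₁ v‖) (hΦ₂ : ∀ v, ‖v‖ ≤ ‖Φ₂ v‖) (ha : 0 < a) (hc : 1 / 3 < c * β₀)
    (he₁ : 0 < e₁) (he₂ : 0 < e₂)
    (hA : ∀ t, 0 ≤ t → t ≤ e₁ → ∀ v, ‖Φ₁ (v - t • A v)‖ ≤ (1 - t * a) * ‖Φ₁ v‖)
    (hD : ∀ t, 0 ≤ t → t ≤ e₂ → ∀ v, ‖Φ₂ (v - t • D v)‖ ≤ (1 - t * c) * ‖Φ₂ v‖)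
    (hβ₀ : 0 < β₀) (hβα : β₀ ≤ α₀) (x₀ y₀ : Vec d) {s : ℝ} (hs : 0 ≤ s) :
    ∃ Q : ℝ, 0 ≤ Q ∧ ∀ (Ω : Type*) [MeasurableSpace Ω] (P : Measure Ω) [IsProbabilityMeasure P]
      (x y ξ ψ : ℕ → Ω → Vec d),
      IsTwoTimeScale P A D B L (fastStep α₀) (slowStep β₀) x₀ y₀ s x y ξ ψ →
      ∀ k : ℕ, ∫ ω, ‖Φ₂ (y k ω)‖ ^ 2 ∂P
        + slowStep β₀ k / fastStep α₀ k * ∫ ω, ‖Φ₁ (x k ω)‖ ^ 2 ∂P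
        ≤ Q / ((k : ℝ) + 1) ^ (2 / 3 : ℝ) := by
  have hα₀ : 0 < α₀ := hβ₀.trans_le hβα
  have hc0 : 0 < c := by
    by_contra! h
    nlinarith
  -- With this choice `(2c - κ)β₀ = cβ₀ + 1/3`, which exceeds `2/3`.
  set κ := c - 1 / (3 * β₀) with hκ
  have hκ0 : 0 < κ := by
    rw [hκ, sub_pos, div_lt_iff₀ (by positivity)]; linarith
  have hcκ : 2 / 3 < (2 * c - κ) * β₀ := by
    have : (2 * c - κ) * β₀ = c * β₀ + 1 / 3 := by rw [hκ]; field_simp; ring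
    linarith
  set c₁ := ‖Φ₁‖ * ‖L‖ * (‖D‖ + ‖B‖) + ‖Φ₂‖ * ‖B‖ + 1 with hc₁
  have hc₁0 : 0 < c₁ := by positivity
  have hc₁a : ‖Φ₁‖ * ‖L‖ * (‖D‖ + ‖B‖) ≤ c₁ := by
    have : 0 ≤ ‖Φ₂‖ * ‖B‖ := by positivity
    linarith
  have hc₁b : ‖Φ₂‖ * ‖B‖ ≤ c₁ := by
    have : 0 ≤ ‖Φ₁‖ * ‖L‖ * (‖D‖ + ‖B‖) := by positivity
    linarith
  -- Below `e`, both contractions apply, `αa ≤ 1`, and `β/α ≤ a/(4c₁)` gives `βc₁ ≤ aα/4`.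
  set e := min (min e₁ e₂) (min (min (1 / a) (a / (4 * c₁))) 1) with he
  have he0 : 0 < e := by positivity
  set n₁ := 2 * ‖Φ₁‖ ^ 2 * (1 + ‖L‖ ^ 2) * s with hn₁
  set n₂ := ‖Φ₂‖ ^ 2 * s with hn₂
  have hn₁0 : 0 ≤ n₁ := by positivity
  have hn₂0 : 0 ≤ n₂ := by positivity
  set C₁ := 1 + α₀ * (‖Φ₁‖ * ‖A‖) + β₀ * c₁ with hC₁
  set C₂ := 1 + β₀ * (‖Φ₂‖ * ‖D‖) + β₀ * c₁ with hC₂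
  have hC₁0 : 0 ≤ C₁ := by positivity
  have hC₂0 : 0 ≤ C₂ := by positivity
  set c₂ := 2 * C₁ ^ 2 + 2 * C₂ ^ 2 + n₁ + n₂ + n₁ * α₀ ^ 2 + n₂ * β₀ ^ 2 with hc₂
  have hpos : 0 ≤ 2 * C₁ ^ 2 ∧ 0 ≤ 2 * C₂ ^ 2 ∧ 0 ≤ n₁ * α₀ ^ 2 ∧ 0 ≤ n₂ * β₀ ^ 2 := by
    refine ⟨?_, ?_, ?_, ?_⟩ <;> positivity
  obtain ⟨p₁, p₂, p₃, p₄⟩ := hpos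
  obtain ⟨Q, hQ, hmain⟩ := exists_two_time_scale_bound (a := a) (c := c) (κ := κ) (c₁ := c₁)
    (c₂ := c₂) (α₀ := α₀) (β₀ := β₀) (e := e) (u₀ := ‖Φ₁ x₀‖ ^ 2) (w₀ := ‖Φ₂ y₀‖ ^ 2)
    ha hκ0 hcκ hc₁0 (by positivity) hβ₀ hβα he0 (by positivity) (by positivity)
  refine ⟨Q, hQ, fun Ω _ P _ x y ξ ψ h => ?_⟩
  have hα0 : ∀ k, 0 < fastStep α₀ k := fun k => by
    rw [fastStep_eq]; have := cbrt_succ_pos k; positivity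
  have hβ0 : ∀ k, 0 < slowStep β₀ k := fun k => by
    rw [slowStep_eq]; have := cbrt_succ_pos k; positivity
  have hαle : ∀ k, fastStep α₀ k ≤ α₀ := fun k => by
    rw [fastStep_eq]; exact div_le_self hα₀.le (one_le_pow₀ (one_le_cbrt (by omega)))
  have hβle : ∀ k, slowStep β₀ k ≤ β₀ := fun k => by
    rw [slowStep_eq]; exact div_le_self hβ₀.le (one_le_pow₀ (one_le_cbrt (by omega)))
  have hβα' : ∀ k, slowStep β₀ k ≤ fastStep α₀ k := fun k => by
    rw [fastStep_eq, slowStep_eq]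
    have := cbrt_succ_pos k
    have h1 := one_le_cbrt (n := k + 1) (by omega)
    gcongr
    norm_num
  let F : ℕ → Vec d × Vec d →L[ℝ] Vec d := fun k =>
    .fst ℝ _ _ - fastStep α₀ k • A.comp (.fst ℝ _ _)
      - slowStep β₀ k • L.comp (D.comp (.snd ℝ _ _) + B.comp (.fst ℝ _ _))
  let S : ℕ → Vec d × Vec d →L[ℝ] Vec d := fun k =>
    .snd ℝ _ _ - slowStep β₀ k • (D.comp (.snd ℝ _ _) + B.comp (.fst ℝ _ _))
  have hfast : ∀ (k : ℕ) (q₁ q₂ : ℝ), (∀ v w, ‖Φ₁ (v - fastStep α₀ k • A v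
        - slowStep β₀ k • L (D w + B v))‖ ^ 2 ≤ q₁ * ‖Φ₁ v‖ ^ 2 + q₂ * ‖Φ₂ w‖ ^ 2) →
      ∫ ω, ‖Φ₁ (x (k + 1) ω)‖ ^ 2 ∂P ≤ q₁ * ∫ ω, ‖Φ₁ (x k ω)‖ ^ 2 ∂P
        + q₂ * ∫ ω, ‖Φ₂ (y k ω)‖ ^ 2 ∂P + n₁ * fastStep α₀ k ^ 2 := fun k q₁ q₂ hq =>
    (h.integral_fast_succ Φ₁ k (hβ0 k).le (hβα' k)).trans
      (add_le_add (h.integral_le_of_pointwise (T := Φ₁.comp (F k)) hq k) le_rfl)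
  have hslow : ∀ (k : ℕ) (q₁ q₂ : ℝ), (∀ v w, ‖Φ₂ (w - slowStep β₀ k • (D w + B v))‖ ^ 2
        ≤ q₁ * ‖Φ₁ v‖ ^ 2 + q₂ * ‖Φ₂ w‖ ^ 2) →
      ∫ ω, ‖Φ₂ (y (k + 1) ω)‖ ^ 2 ∂P ≤ q₁ * ∫ ω, ‖Φ₁ (x k ω)‖ ^ 2 ∂P
        + q₂ * ∫ ω, ‖Φ₂ (y k ω)‖ ^ 2 ∂P + n₂ * slowStep β₀ k ^ 2 := fun k q₁ q₂ hq =>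
    (h.integral_slow_succ Φ₂ k).trans
      (add_le_add (h.integral_le_of_pointwise (T := Φ₂.comp (S k)) hq k) le_rfl)
  refine hmain (fun k => ∫ ω, ‖Φ₁ (x k ω)‖ ^ 2 ∂P) (fun k => ∫ ω, ‖Φ₂ (y k ω)‖ ^ 2 ∂P)
    (fun k => integral_nonneg fun ω => sq_nonneg _) (fun k => integral_nonneg fun ω => sq_nonneg _)
    (by simp [h.init_fast]) (by simp [h.init_slow]) ?_ ?_ ?_
  · intro k
    have hu : 0 ≤ ∫ ω, ‖Φ₁ (x k ω)‖ ^ 2 ∂P := integral_nonneg fun ω => sq_nonneg _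
    have hw : 0 ≤ ∫ ω, ‖Φ₂ (y k ω)‖ ^ 2 ∂P := integral_nonneg fun ω => sq_nonneg _
    have h1 := hfast k (2 * C₁ ^ 2) (2 * C₁ ^ 2) (norm_fast_step_le_crude hΦ₁ hΦ₂ he₁.le hA hc₁a
      hc₁0.le (hα0 k).le (hαle k) (hβ0 k).le (hβle k))
    have h3 : n₁ * fastStep α₀ k ^ 2 ≤ n₁ * α₀ ^ 2 := by
      have := hα0 k
      gcongr; exact hαle k
    calc _ ≤ _ := h1
      _ = 2 * C₁ ^ 2 * (∫ ω, ‖Φ₁ (x k ω)‖ ^ 2 ∂P + ∫ ω, ‖Φ₂ (y k ω)‖ ^ 2 ∂P)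
          + n₁ * fastStep α₀ k ^ 2 := by ring
      _ ≤ _ := by
        gcongr
        · rw [hc₂]; linarith
        · rw [hc₂]; linarith
  · intro k
    have hu : 0 ≤ ∫ ω, ‖Φ₁ (x k ω)‖ ^ 2 ∂P := integral_nonneg fun ω => sq_nonneg _
    have hw : 0 ≤ ∫ ω, ‖Φ₂ (y k ω)‖ ^ 2 ∂P := integral_nonneg fun ω => sq_nonneg _
    have h1 := hslow k (2 * C₂ ^ 2) (2 * C₂ ^ 2) (norm_slow_step_le_crude hΦ₁ hΦ₂ hc₁b
      hc₁0.le (hβ0 k).le (hβle k))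
    have h3 : n₂ * slowStep β₀ k ^ 2 ≤ n₂ * β₀ ^ 2 := by
      have := hβ0 k
      gcongr; exact hβle k
    calc _ ≤ _ := h1
      _ = 2 * C₂ ^ 2 * (∫ ω, ‖Φ₁ (x k ω)‖ ^ 2 ∂P + ∫ ω, ‖Φ₂ (y k ω)‖ ^ 2 ∂P)
          + n₂ * slowStep β₀ k ^ 2 := by ring
      _ ≤ _ := by
        gcongr
        · rw [hc₂]; linarith
        · rw [hc₂]; linarith
  · intro k hαe hρe
    have hαk := hα0 k
    have hβk := hβ0 k
    simp only [he, le_min_iff] at hαe hρe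
    obtain ⟨⟨q₁, q₂⟩, ⟨q₃, -⟩, -⟩ := hαe
    obtain ⟨-, ⟨-, r₄⟩, -⟩ := hρe
    have hn₁c : n₁ ≤ c₂ := by rw [hc₂]; linarith
    have hn₂c : n₂ ≤ c₂ := by rw [hc₂]; linarith
    have hβαk := hβα' k
    set α := fastStep α₀ k
    set β := slowStep β₀ k
    have hβc : β * c₁ ≤ 1 / 4 * a * α := by
      rw [div_le_div_iff₀ hαk (by positivity)] at r₄
      linarith
    have hαa : α * a ≤ 1 := by rwa [le_div_iff₀ ha] at q₃
    constructor
    · have h1 := hfast k (1 - 3 / 4 * a * α) (c₁ ^ 2 * β ^ 2 / (3 / 4 * a * α)) fun v w =>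
        sq_fast_le hαk ha (norm_nonneg _) (norm_nonneg _) hβc hαa
          (norm_fast_step_le hΦ₁ hΦ₂ hA hc₁a hαk.le q₁ hβk.le v w)
      refine h1.trans ?_
      gcongr
    · have h1 := hslow k ((c₁ ^ 2 / κ + c₁ ^ 2 * β) * β)
        (1 - (2 * c - κ) * β + c ^ 2 * β ^ 2) fun v w =>
        sq_slow_le hβk.le hc0.le hκ0 hc₁0.le (norm_nonneg _) (norm_nonneg _) (norm_nonneg _)
          (norm_slow_step_le (B := B) hΦ₁ hD hc₁b hβk.le (hβαk.trans q₂) v w)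
      refine h1.trans ?_
      have h2 : n₂ * β ^ 2 ≤ c₂ * β ^ 2 := by gcongr
      linarith

/-! ### Information carried by the noise, and averages over the nodes. -/

lemma measurable_act {d : ℕ} (A : Matrix (Fin d) (Fin d) ℝ) : Measurable (act A) :=
  (Matrix.toEuclideanCLM (𝕜 := ℝ) A).continuous.measurable

lemma measurable_nodeAvg {Ω : Type*} {m : MeasurableSpace Ω} {N d : ℕ} {z : Fin N → Ω → Vec d}
    (hz : ∀ i, Measurable (z i)) : Measurable fun ω => nodeAvg fun i => z i ω := by
  unfold nodeAvg
  exact (Finset.measurable_sum _ fun i _ => hz i).const_smul ((N : ℝ)⁻¹)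

lemma measurable_mix_sub {Ω : Type*} {m : MeasurableSpace Ω} {N d : ℕ}
    (A B : Matrix (Fin d) (Fin d) ℝ) (b : Vec d) (w : Fin N → ℝ) (a : ℝ) {z : Fin N → Ω → Vec d} {f g n : Ω → Vec d}
    (hz : ∀ i, Measurable (z i)) (hf : Measurable f) (hg : Measurable g) (hn : Measurable n) :
    Measurable fun ω => ∑ j, w j • z j ω - a • (act A (f ω) + act B (g ω) - b + n ω) := by
  have h1 : Measurable fun ω => ∑ j, w j • z j ω :=
    Finset.measurable_sum _ fun j _ => (hz j).const_smul (w j)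
  have h2 : Measurable fun ω => act A (f ω) + act B (g ω) - b + n ω :=
    ((((measurable_act A).comp hf).add ((measurable_act B).comp hg)).sub_const b).add hn
  exact h1.sub (h2.const_smul a)

lemma norm_nodeAvg_sq_le {N d : ℕ} (hN : 0 < N) (z : Fin N → Vec d) :
    ‖nodeAvg z‖ ^ 2 ≤ (N : ℝ)⁻¹ * ∑ i, ‖z i‖ ^ 2 := by
  have h := sum_norm_sub_sq hN z 0
  simp only [sub_zero] at h
  rw [← div_eq_inv_mul, le_div_iff₀ (by positivity), h]
  have : 0 ≤ ‖deviation z‖ ^ 2 := by positivity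
  linarith

section Noise

variable {Ω : Type*} [MeasurableSpace Ω] {P : Measure Ω} {N d : ℕ}
  {ξ ψ : ℕ → Fin N → Ω → Vec d} {C Γ₁₁ Γ₁₂ Γ₂₂ : ℝ}

/-- The information carried by the noise at the times in `T`. -/
@[reducible] def noiseInfo (ξ ψ : ℕ → Fin N → Ω → Vec d) (T : Set ℕ) : MeasurableSpace Ω :=
  ⨆ p ∈ {p : ℕ × Fin N | p.1 ∈ T},
    MeasurableSpace.comap (fun ω => (ξ p.1 p.2 ω, ψ p.1 p.2 ω)) inferInstance

omit [MeasurableSpace Ω] in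
lemma noiseInfo_mono {S T : Set ℕ} (h : S ⊆ T) : noiseInfo ξ ψ S ≤ noiseInfo ξ ψ T :=
  biSup_mono fun _ hp => h hp

omit [MeasurableSpace Ω] in
lemma measurable_noise_noiseInfo {T : Set ℕ} {k : ℕ} (hk : k ∈ T) (i : Fin N) :
    Measurable[noiseInfo ξ ψ T] fun ω => (ξ k i ω, ψ k i ω) :=
  Measurable.mono (comap_measurable _) (le_biSup (fun p : ℕ × Fin N =>
    MeasurableSpace.comap (fun ω => (ξ p.1 p.2 ω, ψ p.1 p.2 ω)) inferInstance)
      (show (k, i) ∈ {p : ℕ × Fin N | p.1 ∈ T} from hk)) le_rfl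

namespace IsNoise

lemma indep_noiseInfo (h : IsNoise P ξ ψ C Γ₁₁ Γ₁₂ Γ₂₂) {S T : Set ℕ} (hST : Disjoint S T) :
    Indep (noiseInfo ξ ψ S) (noiseInfo ξ ψ T) P := by
  have hle : ∀ p : ℕ × Fin N, MeasurableSpace.comap (fun ω => (ξ p.1 p.2 ω, ψ p.1 p.2 ω))
      inferInstance ≤ (inferInstance : MeasurableSpace Ω) :=
    fun p => ((h.measurable_fst p.1 p.2).prodMk (h.measurable_snd p.1 p.2)).comap_le
  have hdisj : Disjoint {p : ℕ × Fin N | p.1 ∈ S} {p : ℕ × Fin N | p.1 ∈ T} :=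
    Set.disjoint_left.2 fun _ hp hq => Set.disjoint_left.1 hST hp hq
  have hi : iIndep (fun p : ℕ × Fin N => MeasurableSpace.comap
      (fun ω => (ξ p.1 p.2 ω, ψ p.1 p.2 ω)) inferInstance) P := h.indep.iIndep
  exact indep_iSup_of_disjoint hle hi hdisj

variable [IsProbabilityMeasure P]

lemma memLp_fst (h : IsNoise P ξ ψ C Γ₁₁ Γ₁₂ Γ₂₂) (k : ℕ) (i : Fin N) : MemLp (ξ k i) 2 P :=
  MemLp.of_bound (h.measurable_fst k i).aestronglyMeasurable C
    ((h.bounded k i).mono fun _ hω => (le_max_left _ _).trans hω)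

lemma memLp_snd (h : IsNoise P ξ ψ C Γ₁₁ Γ₁₂ Γ₂₂) (k : ℕ) (i : Fin N) : MemLp (ψ k i) 2 P :=
  MemLp.of_bound (h.measurable_snd k i).aestronglyMeasurable C
    ((h.bounded k i).mono fun _ hω => (le_max_right _ _).trans hω)

end IsNoise

end Noise

section Averages

variable {Ω : Type*} [MeasurableSpace Ω] {P : Measure Ω} {N d : ℕ}

lemma memLp_nodeAvg {z : Fin N → Ω → Vec d} (hz : ∀ i, MemLp (z i) 2 P) :
    MemLp (fun ω => nodeAvg fun i => z i ω) 2 P := by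
  unfold nodeAvg
  exact (memLp_finsetSum _ fun i _ => hz i).const_smul ((N : ℝ)⁻¹)

lemma integral_nodeAvg_eq_zero [IsProbabilityMeasure P] {z : Fin N → Ω → Vec d} (hz : ∀ i, MemLp (z i) 2 P)
    (h0 : ∀ i, ∫ ω, z i ω ∂P = 0) : ∫ ω, nodeAvg (fun i => z i ω) ∂P = 0 := by
  unfold nodeAvg
  rw [integral_smul, integral_finsetSum _ fun i _ => (hz i).integrable one_le_two]
  simp [h0]

/-- Convexity of the square gives a bound independent of `N`; the gain `1/N` from independence is
not needed. -/
lemma integral_norm_nodeAvg_sq_le (hN : 0 < N) {z : Fin N → Ω → Vec d} {s : ℝ}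
    (hz : ∀ i, MemLp (z i) 2 P) (hs : ∀ i, ∫ ω, inner ℝ (z i ω) (z i ω) ∂P = s) :
    ∫ ω, ‖nodeAvg (fun i => z i ω)‖ ^ 2 ∂P ≤ s := by
  have hi : ∀ i, Integrable (fun ω => ‖z i ω‖ ^ 2) P :=
    fun i => (hz i).integrable_norm_pow two_ne_zero
  calc _ ≤ ∫ ω, (N : ℝ)⁻¹ * ∑ i, ‖z i ω‖ ^ 2 ∂P :=
        integral_mono ((memLp_nodeAvg hz).integrable_norm_pow two_ne_zero)
          ((integrable_finsetSum _ fun i _ => hi i).const_mul _) fun ω => norm_nodeAvg_sq_le hN _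
    _ = (N : ℝ)⁻¹ * ∑ _i : Fin N, s := by
        rw [integral_const_mul, integral_finsetSum _ fun i _ => hi i]
        simp only [← real_inner_self_eq_norm_sq, hs]
    _ = s := by
        have : (N : ℝ) ≠ 0 := by positivity
        simp; field_simp

end Averages

/-! ### The distributed iteration: adaptedness, averages and deviations. -/

namespace IsDistributedSA

variable {Ω : Type*} {N d : ℕ} {A₁₁ A₁₂ A₂₁ A₂₂ : Matrix (Fin d) (Fin d) ℝ}
  {b₁ b₂ : Fin N → Vec d} {W V : Matrix (Fin N) (Fin N) ℝ} {α β : ℕ → ℝ}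
  {ξ ψ x y : ℕ → Fin N → Ω → Vec d}

/-- The iterates at time `k` use only noise strictly before `k`, hence are independent of the noise
at time `k`. -/
lemma measurable_noiseInfo (h : IsDistributedSA A₁₁ A₁₂ A₂₁ A₂₂ b₁ b₂ W V α β ξ ψ x y)
    (k : ℕ) : ∀ i, Measurable[noiseInfo ξ ψ (Set.Iio k)] (x k i) ∧
      Measurable[noiseInfo ξ ψ (Set.Iio k)] (y k i) := by
  induction k with
  | zero =>
    intro i
    rw [show x 0 i = fun _ => 0 from funext (h.init_fst i),
      show y 0 i = fun _ => 0 from funext (h.init_snd i)]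
    exact ⟨measurable_const, measurable_const⟩
  | succ k ih =>
    intro i
    have hle : noiseInfo ξ ψ (Set.Iio k) ≤ noiseInfo ξ ψ (Set.Iio (k + 1)) :=
      noiseInfo_mono (Set.Iio_subset_Iio (Nat.le_succ k))
    have hx : ∀ j, Measurable[noiseInfo ξ ψ (Set.Iio (k + 1))] (x k j) :=
      fun j => (ih j).1.mono hle le_rfl
    have hy : ∀ j, Measurable[noiseInfo ξ ψ (Set.Iio (k + 1))] (y k j) :=
      fun j => (ih j).2.mono hle le_rfl
    have hn := measurable_noise_noiseInfo (ξ := ξ) (ψ := ψ)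
      (show k ∈ Set.Iio (k + 1) from Nat.lt_succ_self k) i
    rw [funext (h.step_fst k i), funext (h.step_snd k i)]
    constructor
    · exact measurable_mix_sub A₁₁ A₁₂ (b₁ i) (W i) (α k) hx (hx i) (hy i)
        (measurable_fst.comp hn)
    · exact measurable_mix_sub A₂₁ A₂₂ (b₂ i) (V i) (β k) hy (hx i) (hy i)
        (measurable_snd.comp hn)

lemma memLp [MeasurableSpace Ω] {P : Measure Ω} [IsProbabilityMeasure P]
    (h : IsDistributedSA A₁₁ A₁₂ A₂₁ A₂₂ b₁ b₂ W V α β ξ ψ x y)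
    (hξ : ∀ k i, MemLp (ξ k i) 2 P) (hψ : ∀ k i, MemLp (ψ k i) 2 P) (k : ℕ) :
    ∀ i, MemLp (x k i) 2 P ∧ MemLp (y k i) 2 P := by
  have hact : ∀ (A : Matrix (Fin d) (Fin d) ℝ) {f : Ω → Vec d}, MemLp f 2 P →
      MemLp (fun ω => act A (f ω)) 2 P :=
    fun A f hf => (Matrix.toEuclideanCLM (𝕜 := ℝ) A).comp_memLp' hf
  induction k with
  | zero =>
    intro i
    rw [show x 0 i = fun _ => 0 from funext (h.init_fst i),
      show y 0 i = fun _ => 0 from funext (h.init_snd i)]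
    exact ⟨memLp_const 0, memLp_const 0⟩
  | succ k ih =>
    intro i
    rw [funext (h.step_fst k i), funext (h.step_snd k i)]
    constructor
    · exact (memLp_finsetSum _ fun j _ => (ih j).1.const_smul (W i j)).sub
        (((((hact _ (ih i).1).add (hact _ (ih i).2)).sub (memLp_const (b₁ i))).add
          (hξ k i)).const_smul (α k))
    · exact (memLp_finsetSum _ fun j _ => (ih j).2.const_smul (V i j)).sub
        (((((hact _ (ih i).1).add (hact _ (ih i).2)).sub (memLp_const (b₂ i))).add
          (hψ k i)).const_smul (β k))

lemma nodeAvg_fst_succ (h : IsDistributedSA A₁₁ A₁₂ A₂₁ A₂₂ b₁ b₂ W V α β ξ ψ x y)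
    (hW : W ∈ doublyStochastic ℝ (Fin N)) (k : ℕ) (ω : Ω) :
    nodeAvg (fun i => x (k + 1) i ω) = nodeAvg (fun i => x k i ω)
      - α k • (act A₁₁ (nodeAvg fun i => x k i ω) + act A₁₂ (nodeAvg fun i => y k i ω)
        - nodeAvg b₁ + nodeAvg fun i => ξ k i ω) := by
  simp only [h.step_fst]
  rw [nodeAvg_sub, nodeAvg_mix hW, nodeAvg_smul, nodeAvg_add, nodeAvg_sub, nodeAvg_add,
    nodeAvg_act, nodeAvg_act]

lemma nodeAvg_snd_succ (h : IsDistributedSA A₁₁ A₁₂ A₂₁ A₂₂ b₁ b₂ W V α β ξ ψ x y)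
    (hV : V ∈ doublyStochastic ℝ (Fin N)) (k : ℕ) (ω : Ω) :
    nodeAvg (fun i => y (k + 1) i ω) = nodeAvg (fun i => y k i ω)
      - β k • (act A₂₁ (nodeAvg fun i => x k i ω) + act A₂₂ (nodeAvg fun i => y k i ω)
        - nodeAvg b₂ + nodeAvg fun i => ψ k i ω) := by
  simp only [h.step_snd]
  rw [nodeAvg_sub, nodeAvg_mix hV, nodeAvg_smul, nodeAvg_add, nodeAvg_sub, nodeAvg_add,
    nodeAvg_act, nodeAvg_act]

lemma norm_deviation_fst_succ_le (h : IsDistributedSA A₁₁ A₁₂ A₂₁ A₂₂ b₁ b₂ W V α β ξ ψ x y)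
    (hN : 0 < N) (hW : W ∈ doublyStochastic ℝ (Fin N)) {σ : ℝ} (hσ : secondSingularValue W ≤ σ)
    (hσ1 : σ < 1) (h₁₁ : ‖A₁₁‖ ≤ 1) (h₁₂ : ‖A₁₂‖ ≤ 1) {R C : ℝ} (hb : ∀ i, ‖b₁ i‖ ≤ R) {k : ℕ}
    {ω : Ω} (hξ : ∀ i, ‖ξ k i ω‖ ≤ C) (hα : 0 ≤ α k) :
    ‖deviation (fun i => x (k + 1) i ω)‖ ≤ σ * ‖deviation (fun i => x k i ω)‖
      + α k * (‖deviation (fun i => x k i ω)‖ + ‖deviation (fun i => y k i ω)‖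
        + √(N : ℝ) * (R + C)) := by
  have e : (fun i => x (k + 1) i ω) = fun i => (∑ j, W i j • x k j ω)
      - α k • ((act A₁₁ (x k i ω) + act A₁₂ (y k i ω)) - (b₁ i - ξ k i ω)) := by
    ext1 i
    rw [h.step_fst]
    congr 2
    abel
  rw [e, deviation_sub, deviation_smul, deviation_sub, deviation_add]
  refine (norm_sub_le _ _).trans ?_
  rw [norm_smul, Real.norm_of_nonneg hα]
  gcongr
  · exact norm_deviation_mix_le hN hW hσ hσ1 _
  · refine (norm_sub_le _ _).trans ?_
    gcongr
    · refine (norm_add_le _ _).trans ?_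
      gcongr
      · exact norm_deviation_act_le h₁₁ _
      · exact norm_deviation_act_le h₁₂ _
    · exact norm_deviation_le hN fun i => (norm_sub_le _ _).trans (add_le_add (hb i) (hξ i))

lemma norm_deviation_snd_succ_le (h : IsDistributedSA A₁₁ A₁₂ A₂₁ A₂₂ b₁ b₂ W V α β ξ ψ x y)
    (hN : 0 < N) (hV : V ∈ doublyStochastic ℝ (Fin N)) {σ : ℝ} (hσ : secondSingularValue V ≤ σ)
    (hσ1 : σ < 1) (h₂₁ : ‖A₂₁‖ ≤ 1) (h₂₂ : ‖A₂₂‖ ≤ 1) {R C : ℝ} (hb : ∀ i, ‖b₂ i‖ ≤ R) {k : ℕ}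
    {ω : Ω} (hψ : ∀ i, ‖ψ k i ω‖ ≤ C) (hβ : 0 ≤ β k) :
    ‖deviation (fun i => y (k + 1) i ω)‖ ≤ σ * ‖deviation (fun i => y k i ω)‖
      + β k * (‖deviation (fun i => x k i ω)‖ + ‖deviation (fun i => y k i ω)‖
        + √(N : ℝ) * (R + C)) := by
  have e : (fun i => y (k + 1) i ω) = fun i => (∑ j, V i j • y k j ω)
      - β k • ((act A₂₁ (x k i ω) + act A₂₂ (y k i ω)) - (b₂ i - ψ k i ω)) := by
    ext1 i
    rw [h.step_snd]
    congr 2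
    abel
  rw [e, deviation_sub, deviation_smul, deviation_sub, deviation_add]
  refine (norm_sub_le _ _).trans ?_
  rw [norm_smul, Real.norm_of_nonneg hβ]
  gcongr
  · exact norm_deviation_mix_le hN hV hσ hσ1 _
  · refine (norm_sub_le _ _).trans ?_
    gcongr
    · refine (norm_add_le _ _).trans ?_
      gcongr
      · exact norm_deviation_act_le h₂₁ _
      · exact norm_deviation_act_le h₂₂ _
    · exact norm_deviation_le hN fun i => (norm_sub_le _ _).trans (add_le_add (hb i) (hψ i))

end IsDistributedSA

/-- A singular matrix would have the eigenvalue zero. -/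
lemma EigenvaluesReGT.mul_inv_cancel {d : ℕ} {A : Matrix (Fin d) (Fin d) ℝ}
    (hA : EigenvaluesReGT A 0) : A * A⁻¹ = 1 := by
  apply Matrix.mul_nonsing_inv
  by_contra hdet
  have h0 : A.det = 0 := by simpa [isUnit_iff_ne_zero] using hdet
  have hs : (0 : ℂ) ∈ spectrum ℂ (A.map (algebraMap ℝ ℂ)) := by
    rw [spectrum.zero_mem_iff, Matrix.isUnit_iff_isUnit_det, ← RingHom.mapMatrix_apply,
      ← RingHom.map_det, h0]
    simp
  simpa using hA 0 hs

namespace IsDistributedSA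

variable {Ω : Type*} [MeasurableSpace Ω] {P : Measure Ω} {N d : ℕ}
  {A₁₁ A₁₂ A₂₁ A₂₂ : Matrix (Fin d) (Fin d) ℝ}
  {b₁ b₂ : Fin N → Vec d} {W V : Matrix (Fin N) (Fin N) ℝ} {α β : ℕ → ℝ}
  {ξ ψ x y : ℕ → Fin N → Ω → Vec d} {C Γ₁₁ Γ₁₂ Γ₂₂ : ℝ}

lemma indepFun_nodeAvg (h : IsDistributedSA A₁₁ A₁₂ A₂₁ A₂₂ b₁ b₂ W V α β ξ ψ x y)
    (hn : IsNoise P ξ ψ C Γ₁₁ Γ₁₂ Γ₂₂) (k : ℕ) :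
    IndepFun (fun ω => (nodeAvg fun i => x k i ω, nodeAvg fun i => y k i ω))
      (fun ω => (nodeAvg fun i => ξ k i ω, nodeAvg fun i => ψ k i ω)) P := by
  have hm := h.measurable_noiseInfo k
  have hk := fun i => measurable_noise_noiseInfo (ξ := ξ) (ψ := ψ) (Set.mem_singleton k) i
  have hx := measurable_nodeAvg fun i => (hm i).1
  have hy := measurable_nodeAvg fun i => (hm i).2
  have hξ := measurable_nodeAvg fun i => measurable_fst.comp (hk i)
  have hψ := measurable_nodeAvg fun i => measurable_snd.comp (hk i)
  rw [IndepFun_iff_Indep]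
  exact indep_of_indep_of_le_left (indep_of_indep_of_le_right
    (hn.indep_noiseInfo (S := Set.Iio k) (T := {k})
      (Set.disjoint_singleton_right.2 (lt_irrefl k)))
    (hξ.prodMk hψ).comap_le) (hx.prodMk hy).comap_le

/-- Block elimination: shifting the fast error by `A₁₁⁻¹A₁₂(ȳ - y*)` removes `y` from the fast drift
and turns `A₂₂` into the Schur complement. The absolute values keep the variance bound nonnegative
for arbitrary real `Γ`. -/
lemma isTwoTimeScale [IsProbabilityMeasure P]
    (h : IsDistributedSA A₁₁ A₁₂ A₂₁ A₂₂ b₁ b₂ W V α β ξ ψ x y)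
    (hn : IsNoise P ξ ψ C Γ₁₁ Γ₁₂ Γ₂₂) (hN : 0 < N) (hW : W ∈ doublyStochastic ℝ (Fin N))
    (hV : V ∈ doublyStochastic ℝ (Fin N)) (hA : A₁₁ * A₁₁⁻¹ = 1) {xs ys : Vec d}
    (h₁ : act A₁₁ xs + act A₁₂ ys = nodeAvg b₁) (h₂ : act A₂₁ xs + act A₂₂ ys = nodeAvg b₂) :
    IsTwoTimeScale P (Matrix.toEuclideanCLM (𝕜 := ℝ) A₁₁)
      (Matrix.toEuclideanCLM (𝕜 := ℝ) (schurCompl A₁₁ A₁₂ A₂₁ A₂₂))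
      (Matrix.toEuclideanCLM (𝕜 := ℝ) A₂₁) (Matrix.toEuclideanCLM (𝕜 := ℝ) (A₁₁⁻¹ * A₁₂)) α β
      (-xs + act (A₁₁⁻¹ * A₁₂) (-ys)) (-ys) (|Γ₁₁| + |Γ₂₂|)
      (fun k ω => nodeAvg (fun i => x k i ω) - xs
        + act (A₁₁⁻¹ * A₁₂) (nodeAvg (fun i => y k i ω) - ys))
      (fun k ω => nodeAvg (fun i => y k i ω) - ys)
      (fun k ω => nodeAvg fun i => ξ k i ω) (fun k ω => nodeAvg fun i => ψ k i ω) := by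
  have hm := h.memLp hn.memLp_fst hn.memLp_snd
  have hmy : ∀ k, MemLp (fun ω => nodeAvg (fun i => y k i ω) - ys) 2 P :=
    fun k => (memLp_nodeAvg fun i => (hm k i).2).sub (memLp_const ys)
  have hmx : ∀ k, MemLp (fun ω => nodeAvg (fun i => x k i ω) - xs) 2 P :=
    fun k => (memLp_nodeAvg fun i => (hm k i).1).sub (memLp_const xs)
  have hL : A₁₁ * (A₁₁⁻¹ * A₁₂) = A₁₂ := by rw [← mul_assoc, hA, one_mul]
  have hD : schurCompl A₁₁ A₁₂ A₂₁ A₂₂ = A₂₂ - A₂₁ * (A₁₁⁻¹ * A₁₂) := by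
    rw [schurCompl, mul_assoc]
  have hact₁ : ∀ u v : Vec d, act A₁₁ u + act A₁₂ v - nodeAvg b₁
      = act A₁₁ (u - xs + act (A₁₁⁻¹ * A₁₂) (v - ys)) := by
    intro u v
    rw [← h₁]
    conv_lhs => rw [← hL]
    simp only [act_eq_toEuclideanCLM, map_mul, mul_apply_eq_comp, map_add, map_sub]
    abel
  have hact₂ : ∀ u v : Vec d, act A₂₁ u + act A₂₂ v - nodeAvg b₂
      = act (schurCompl A₁₁ A₁₂ A₂₁ A₂₂) (v - ys)
        + act A₂₁ (u - xs + act (A₁₁⁻¹ * A₁₂) (v - ys)) := by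
    intro u v
    rw [← h₂, hD]
    simp only [act_eq_toEuclideanCLM, map_mul, mul_apply_eq_comp, map_add, map_sub,
      sub_apply]
    abel
  have hy : ∀ k ω, nodeAvg (fun i => y (k + 1) i ω) - ys
      = (nodeAvg (fun i => y k i ω) - ys)
        - β k • (act (schurCompl A₁₁ A₁₂ A₂₁ A₂₂) (nodeAvg (fun i => y k i ω) - ys)
          + act A₂₁ (nodeAvg (fun i => x k i ω) - xs
            + act (A₁₁⁻¹ * A₁₂) (nodeAvg (fun i => y k i ω) - ys)))
        + -(β k • nodeAvg fun i => ψ k i ω) := by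
    intro k ω
    rw [h.nodeAvg_snd_succ hV, hact₂, smul_add]
    abel
  refine
    { init_fast := ?_
      init_slow := ?_
      step_fast := ?_
      step_slow := ?_
      indep := ?_
      memLp_fast := ?_
      memLp_slow := hmy
      memLp_noise_fast := fun k => memLp_nodeAvg (hn.memLp_fst k)
      memLp_noise_slow := fun k => memLp_nodeAvg (hn.memLp_snd k)
      mean_fast := fun k => integral_nodeAvg_eq_zero (hn.memLp_fst k) (hn.mean_fst k)
      mean_slow := fun k => integral_nodeAvg_eq_zero (hn.memLp_snd k) (hn.mean_snd k)
      moment_fast := fun k => (integral_norm_nodeAvg_sq_le hN (hn.memLp_fst k)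
        (hn.moment_fst k)).trans ((le_abs_self _).trans (le_add_of_nonneg_right (abs_nonneg _)))
      moment_slow := fun k => (integral_norm_nodeAvg_sq_le hN (hn.memLp_snd k)
        (hn.moment_snd k)).trans ((le_abs_self _).trans (le_add_of_nonneg_left (abs_nonneg _))) }
  · intro ω
    simp [h.init_fst, h.init_snd, nodeAvg]
  · intro ω
    simp [h.init_snd, nodeAvg]
  · intro k ω
    rw [hy, h.nodeAvg_fst_succ hW, hact₁]
    simp only [act_eq_toEuclideanCLM, map_add, map_sub, map_neg, map_smul, smul_add]
    abel
  · exact hy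
  · intro k
    exact (h.indepFun_nodeAvg hn k).comp
      (φ := fun p : Vec d × Vec d => (p.1 - xs + act (A₁₁⁻¹ * A₁₂) (p.2 - ys), p.2 - ys))
      (ψ := id) (by simp only [act_eq_toEuclideanCLM]; fun_prop) measurable_id
  · intro k
    exact (hmx k).add ((Matrix.toEuclideanCLM (𝕜 := ℝ) (A₁₁⁻¹ * A₁₂)).comp_memLp' (hmy k))

end IsDistributedSA

/-! ### Assembly of the averaged and nodewise bounds. -/

section NodeBounds

variable {Ω : Type*} [MeasurableSpace Ω] {P : Measure Ω} {d : ℕ}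

/-- Passage from the error in decoupled coordinates, measured in adapted norms, to the error of the
averages. -/
lemma integral_sq_add_mul_le {H₁ H₂ : Type*} [NormedAddCommGroup H₁] [InnerProductSpace ℝ H₁]
    [NormedAddCommGroup H₂] [InnerProductSpace ℝ H₂]
    {Φ₁ : Vec d →L[ℝ] H₁} {Φ₂ : Vec d →L[ℝ] H₂} (hΦ₁ : ∀ v, ‖v‖ ≤ ‖Φ₁ v‖)
    (hΦ₂ : ∀ v, ‖v‖ ≤ ‖Φ₂ v‖) (L : Vec d →L[ℝ] Vec d) {u v : Ω → Vec d} (hu : MemLp u 2 P)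
    (hv : MemLp v 2 P) {ρ : ℝ} (hρ0 : 0 ≤ ρ) (hρ1 : ρ ≤ 1) :
    ∫ ω, ‖v ω‖ ^ 2 ∂P + ρ * ∫ ω, ‖u ω‖ ^ 2 ∂P ≤ (2 + 2 * ‖L‖ ^ 2)
      * (∫ ω, ‖Φ₂ (v ω)‖ ^ 2 ∂P + ρ * ∫ ω, ‖Φ₁ (u ω + L (v ω))‖ ^ 2 ∂P) := by
  have hi : Integrable (fun ω => ‖Φ₁ (u ω + L (v ω))‖ ^ 2) P :=
    (Φ₁.comp_memLp' (hu.add (L.comp_memLp' hv))).integrable_norm_pow two_ne_zero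
  have hi₂ : Integrable (fun ω => ‖Φ₂ (v ω)‖ ^ 2) P :=
    (Φ₂.comp_memLp' hv).integrable_norm_pow two_ne_zero
  have hiu : Integrable (fun ω => ‖u ω‖ ^ 2) P := hu.integrable_norm_pow two_ne_zero
  have hiv : Integrable (fun ω => ‖v ω‖ ^ 2) P := hv.integrable_norm_pow two_ne_zero
  rw [← integral_const_mul, ← integral_const_mul, ← integral_add hiv (hiu.const_mul ρ),
    ← integral_add hi₂ (hi.const_mul ρ), ← integral_const_mul]
  refine integral_mono (hiv.add (hiu.const_mul ρ)) ((hi₂.add (hi.const_mul ρ)).const_mul _)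
    fun ω => ?_
  have h1 : ‖u ω‖ ≤ ‖Φ₁ (u ω + L (v ω))‖ + ‖L‖ * ‖v ω‖ := by
    calc ‖u ω‖ = ‖(u ω + L (v ω)) - L (v ω)‖ := by rw [add_sub_cancel_right]
      _ ≤ ‖u ω + L (v ω)‖ + ‖L (v ω)‖ := norm_sub_le _ _
      _ ≤ _ := add_le_add (hΦ₁ _) (L.le_opNorm _)
  have h2 := hΦ₂ (v ω)
  set p := ‖Φ₁ (u ω + L (v ω))‖
  set q := ‖Φ₂ (v ω)‖
  have hv2 : ‖v ω‖ ^ 2 ≤ q ^ 2 := by gcongr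
  have hu2 : ‖u ω‖ ^ 2 ≤ 2 * p ^ 2 + 2 * ‖L‖ ^ 2 * q ^ 2 := by
    calc ‖u ω‖ ^ 2 ≤ (p + ‖L‖ * q) ^ 2 := by gcongr; exact h1.trans (by gcongr)
      _ ≤ _ := by nlinarith [sq_nonneg (p - ‖L‖ * q)]
  have hρu : ρ * ‖u ω‖ ^ 2 ≤ 2 * (ρ * p ^ 2) + 2 * ‖L‖ ^ 2 * q ^ 2 := by
    calc ρ * ‖u ω‖ ^ 2 ≤ ρ * (2 * p ^ 2 + 2 * ‖L‖ ^ 2 * q ^ 2) := by gcongr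
      _ = 2 * (ρ * p ^ 2) + ρ * (2 * ‖L‖ ^ 2 * q ^ 2) := by ring
      _ ≤ 2 * (ρ * p ^ 2) + 1 * (2 * ‖L‖ ^ 2 * q ^ 2) := by gcongr
      _ = _ := by ring
  have hp : 0 ≤ ‖L‖ ^ 2 * (ρ * p ^ 2) := by positivity
  have hq : 0 ≤ q ^ 2 := by positivity
  dsimp only
  linarith

/-- The error at the nodes is the error of the averages plus the consensus error. -/
lemma sum_integral_norm_sub_sq_le [IsProbabilityMeasure P] {N : ℕ} (hN : 0 < N) {x y : Fin N → Ω → Vec d}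
    (hx : ∀ i, MemLp (x i) 2 P) (hy : ∀ i, MemLp (y i) 2 P) (xs ys : Vec d) {ρ c : ℝ}
    (hc : ∀ᵐ ω ∂P, 1 / (N : ℝ) * (‖deviation fun i => y i ω‖ ^ 2
      + ρ * ‖deviation fun i => x i ω‖ ^ 2) ≤ c) :
    1 / (N : ℝ) * ∑ i, (∫ ω, ‖y i ω - ys‖ ^ 2 ∂P + ρ * ∫ ω, ‖x i ω - xs‖ ^ 2 ∂P)
      ≤ c + (∫ ω, ‖nodeAvg (fun i => y i ω) - ys‖ ^ 2 ∂P
        + ρ * ∫ ω, ‖nodeAvg (fun i => x i ω) - xs‖ ^ 2 ∂P) := by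
  have hix : ∀ i, Integrable (fun ω => ‖x i ω - xs‖ ^ 2) P :=
    fun i => ((hx i).sub (memLp_const xs)).integrable_norm_pow two_ne_zero
  have hiy : ∀ i, Integrable (fun ω => ‖y i ω - ys‖ ^ 2) P :=
    fun i => ((hy i).sub (memLp_const ys)).integrable_norm_pow two_ne_zero
  have hax : Integrable (fun ω => ‖nodeAvg (fun i => x i ω) - xs‖ ^ 2) P :=
    ((memLp_nodeAvg hx).sub (memLp_const xs)).integrable_norm_pow two_ne_zero
  have hay : Integrable (fun ω => ‖nodeAvg (fun i => y i ω) - ys‖ ^ 2) P :=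
    ((memLp_nodeAvg hy).sub (memLp_const ys)).integrable_norm_pow two_ne_zero
  have hii : ∀ i ∈ Finset.univ, Integrable (fun ω => ‖y i ω - ys‖ ^ 2 + ρ * ‖x i ω - xs‖ ^ 2) P :=
    fun i _ => (hiy i).add ((hix i).const_mul ρ)
  have e : ∀ i, ∫ ω, ‖y i ω - ys‖ ^ 2 ∂P + ρ * ∫ ω, ‖x i ω - xs‖ ^ 2 ∂P
      = ∫ ω, (‖y i ω - ys‖ ^ 2 + ρ * ‖x i ω - xs‖ ^ 2) ∂P := fun i => by
    rw [integral_add (hiy i) ((hix i).const_mul ρ), integral_const_mul]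
  simp only [e]
  rw [← integral_finsetSum _ hii, ← integral_const_mul, ← integral_const_mul,
    ← integral_add hay (hax.const_mul ρ)]
  have hav : Integrable (fun ω => ‖nodeAvg (fun i => y i ω) - ys‖ ^ 2
      + ρ * ‖nodeAvg (fun i => x i ω) - xs‖ ^ 2) P := hay.add (hax.const_mul ρ)
  calc _ ≤ ∫ ω, (c + (‖nodeAvg (fun i => y i ω) - ys‖ ^ 2
        + ρ * ‖nodeAvg (fun i => x i ω) - xs‖ ^ 2)) ∂P := by
        refine integral_mono_ae ((integrable_finsetSum _ hii).const_mul _)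
          ((integrable_const c).add hav) ?_
        filter_upwards [hc] with ω hω
        rw [Finset.sum_add_distrib, ← Finset.mul_sum, sum_norm_sub_sq hN, sum_norm_sub_sq hN]
        have hN0 : (N : ℝ) ≠ 0 := by positivity
        refine le_trans (le_of_eq ?_) (add_le_add_left hω _)
        field_simp
        ring
    _ = _ := by
        rw [integral_add (integrable_const c) hav]
        simp

end NodeBounds

lemma IsDistributedSA.ae_consensus_le {Ω : Type*} [MeasurableSpace Ω] {P : Measure Ω} {N d : ℕ}
    {A₁₁ A₁₂ A₂₁ A₂₂ : Matrix (Fin d) (Fin d) ℝ} {b₁ b₂ : Fin N → Vec d}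
    {W V : Matrix (Fin N) (Fin N) ℝ} {ξ ψ x y : ℕ → Fin N → Ω → Vec d}
    {R C Γ₁₁ Γ₁₂ Γ₂₂ α₀ β₀ σ δ : ℝ} {K : ℕ}
    (h : IsDistributedSA A₁₁ A₁₂ A₂₁ A₂₂ b₁ b₂ W V (fastStep α₀) (slowStep β₀) ξ ψ x y)
    (hn : IsNoise P ξ ψ C Γ₁₁ Γ₁₂ Γ₂₂) (hN : 0 < N) (hW : W ∈ doublyStochastic ℝ (Fin N))
    (hV : V ∈ doublyStochastic ℝ (Fin N)) (hWσ : secondSingularValue W ≤ σ)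
    (hVσ : secondSingularValue V ≤ σ)
    (hn₁₁ : ‖A₁₁‖ ≤ 1) (hn₁₂ : ‖A₁₂‖ ≤ 1) (hn₂₁ : ‖A₂₁‖ ≤ 1) (hn₂₂ : ‖A₂₂‖ ≤ 1)
    (hβ₀ : 0 < β₀) (hβα : β₀ ≤ α₀) (hR : 0 ≤ R) (hC : 0 ≤ C)
    (hb : ∀ i, max ‖b₁ i‖ ‖b₂ i‖ ≤ R) (hσ : 0 < σ) (hσ2 : σ ≤ 1 / 2) (hσδ : σ < δ) (hδ : δ < 1)
    (hK0 : 0 < K) (hK : ⌈(α₀ / (δ - σ)) ^ (3 / 2 : ℝ)⌉₊ ≤ K) (k : ℕ) :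
    ∀ᵐ ω ∂P, 1 / (N : ℝ) * (‖deviation fun i => y k i ω‖ ^ 2
        + slowStep β₀ k / fastStep α₀ k * ‖deviation fun i => x k i ω‖ ^ 2) ≤
      16 * consensusConst N R C α₀ δ K ^ 2 * β₀ * α₀ * Real.log (K : ℝ) ^ 2
          * σ ^ (-(2 * (K : ℤ))) / ((N : ℝ) * (1 - σ) ^ 2 * ((k : ℝ) + 1) ^ (2 / 3 : ℝ))
        + 16 * consensusConst N R C α₀ δ K ^ 2 * β₀ * α₀
          / ((N : ℝ) * (1 - σ) ^ 2 * ((k : ℝ) + 2) ^ (5 / 3 : ℝ)) := by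
  have hα₀ : 0 < α₀ := hβ₀.trans_le hβα
  have hbdd : ∀ᵐ ω ∂P, ∀ k i, max ‖ξ k i ω‖ ‖ψ k i ω‖ ≤ C :=
    ae_all_iff.2 fun k => ae_all_iff.2 fun i => hn.bounded k i
  filter_upwards [hbdd] with ω hω
  have h0 : ‖deviation (N := N) (d := d) fun _ => 0‖ = 0 := by
    simpa using norm_deviation_le (z := fun _ : Fin N => (0 : Vec d)) (R := 0) hN (by simp)
  exact consensus_bound (X := fun k => ‖deviation fun i => x k i ω‖)
    (Y := fun k => ‖deviation fun i => y k i ω‖) hσ hσ2 hβ₀ hβα hR hC hN hK0 hσδ hδ hK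
    (by simpa only [h.init_fst] using h0) (by simpa only [h.init_snd] using h0)
    (fun _ => norm_nonneg _) (fun _ => norm_nonneg _)
    (fun k => h.norm_deviation_fst_succ_le hN hW hWσ (by linarith) hn₁₁ hn₁₂
      (fun i => (le_max_left _ _).trans (hb i)) (fun i => (le_max_left _ _).trans (hω k i))
      (by unfold fastStep; positivity))
    (fun k => h.norm_deviation_snd_succ_le hN hV hVσ (by linarith) hn₂₁ hn₂₂
      (fun i => (le_max_right _ _).trans (hb i)) (fun i => (le_max_right _ _).trans (hω k i))
      (by unfold slowStep; positivity)) k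

theorem theorem1 {d : ℕ} (A₁₁ A₁₂ A₂₁ A₂₂ : Matrix (Fin d) (Fin d) ℝ) (xs ys : Vec d)
    (Γ₁₁ Γ₁₂ Γ₂₂ α₀ β₀ : ℝ)
    -- eigenvalue condition on `A₁₁` and on the Schur complement
    (hA₁₁ : EigenvaluesReGT A₁₁ 0)
    (hΔ : EigenvaluesReGT (schurCompl A₁₁ A₁₂ A₂₁ A₂₂) 0)
    -- spectral norms
    (hn₁₁ : ‖A₁₁‖ ≤ 1) (hn₁₂ : ‖A₁₂‖ ≤ 1) (hn₂₁ : ‖A₂₁‖ ≤ 1) (hn₂₂ : ‖A₂₂‖ ≤ 1)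
    -- choice of the step sizes
    (hβ₀ : 0 < β₀) (hβα : β₀ ≤ α₀)
    (hβΔ : EigenvaluesReGT (schurCompl A₁₁ A₁₂ A₂₁ A₂₂) (1 / (3 * β₀))) :
    ∃ D₀ D₁ : ℝ, 0 ≤ D₀ ∧ 0 ≤ D₁ ∧
      ∀ (N : ℕ) (b₁ b₂ : Fin N → Vec d) (R C : ℝ) (W V : Matrix (Fin N) (Fin N) ℝ)
        (Ω : Type*) [MeasurableSpace Ω] (P : Measure Ω) [IsProbabilityMeasure P]
        (ξ ψ x y : ℕ → Fin N → Ω → Vec d) (δ : ℝ) (K : ℕ),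
        0 < R → (∀ i, max ‖b₁ i‖ ‖b₂ i‖ ≤ R) →
        -- `(xs, ys)` is the solution of the averaged linear system
        act A₁₁ xs + act A₁₂ ys = nodeAvg b₁ →
        act A₂₁ xs + act A₂₂ ys = nodeAvg b₂ →
        IsCommMatrix W → IsCommMatrix V →
        0 < mixingRate W V →
        (∀ k : ℕ, mixingRate W V ^ k ≤ 1 / ((k : ℝ) + 1)) →
        0 < C → IsNoise P ξ ψ C Γ₁₁ Γ₁₂ Γ₂₂ →
        IsDistributedSA A₁₁ A₁₂ A₂₁ A₂₂ b₁ b₂ W V (fastStep α₀) (slowStep β₀) ξ ψ x y →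
        mixingRate W V < δ → δ < 1 →
        0 < K → ⌈(α₀ / (δ - mixingRate W V)) ^ (3 / 2 : ℝ)⌉₊ ≤ K →
        -- all second moments below are finite
        (∀ k i, MemLp (x k i) 2 P ∧ MemLp (y k i) 2 P) ∧
        -- `D₀`, `D₁` are constants for the averaged iterates
        (∀ k : ℕ,
          ∫ ω, ‖nodeAvg (fun i => y k i ω) - ys‖ ^ 2 ∂P
            + slowStep β₀ k / fastStep α₀ k * ∫ ω, ‖nodeAvg (fun i => x k i ω) - xs‖ ^ 2 ∂P
          ≤ D₀ / ((k : ℝ) + 1) ^ (2 / 3 : ℝ)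
            + D₁ * Real.log ((k : ℝ) + 1) / ((k : ℝ) + 1)) ∧
        -- the finite-time bound at the nodes
        (∀ k : ℕ,
          1 / (N : ℝ) * ∑ i, (∫ ω, ‖y k i ω - ys‖ ^ 2 ∂P
            + slowStep β₀ k / fastStep α₀ k * ∫ ω, ‖x k i ω - xs‖ ^ 2 ∂P)
          ≤ 16 * consensusConst N R C α₀ δ K ^ 2 * β₀ * α₀ * Real.log (K : ℝ) ^ 2
                * mixingRate W V ^ (-(2 * (K : ℤ)))
                / ((N : ℝ) * (1 - mixingRate W V) ^ 2 * ((k : ℝ) + 1) ^ (2 / 3 : ℝ))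
            + 16 * consensusConst N R C α₀ δ K ^ 2 * β₀ * α₀
                / ((N : ℝ) * (1 - mixingRate W V) ^ 2 * ((k : ℝ) + 2) ^ (5 / 3 : ℝ))
            + 2 * D₀ / ((k : ℝ) + 1) ^ (2 / 3 : ℝ)
            + 2 * D₁ * Real.log ((k : ℝ) + 1) / ((k : ℝ) + 1)) := by
  have hα₀ : 0 < α₀ := hβ₀.trans_le hβα
  obtain ⟨m₁, Φ₁, a, e₁, ha, he₁, hΦ₁, hA⟩ := exists_contracting_norm hA₁₁
  obtain ⟨m₂, Φ₂, c, e₂, hc, he₂, hΦ₂, hD⟩ := exists_contracting_norm hβΔ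
  have hcβ : 1 / 3 < c * β₀ := by
    rw [div_lt_iff₀ (by positivity)] at hc
    linarith
  set L := Matrix.toEuclideanCLM (𝕜 := ℝ) (A₁₁⁻¹ * A₁₂)
  obtain ⟨Q, hQ0, hQ⟩ := exists_integral_bound_of_isTwoTimeScale
    (A := Matrix.toEuclideanCLM (𝕜 := ℝ) A₁₁)
    (D := Matrix.toEuclideanCLM (𝕜 := ℝ) (schurCompl A₁₁ A₁₂ A₂₁ A₂₂))
    (B := Matrix.toEuclideanCLM (𝕜 := ℝ) A₂₁) (L := L)
    hΦ₁ hΦ₂ ha hcβ he₁ he₂ hA hD hβ₀ hβα (-xs + act (A₁₁⁻¹ * A₁₂) (-ys)) (-ys)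
    (s := |Γ₁₁| + |Γ₂₂|) (by positivity)
  have hρ0 : ∀ k, 0 ≤ slowStep β₀ k / fastStep α₀ k := fun k => by
    unfold slowStep fastStep; positivity
  have hρ1 : ∀ k, slowStep β₀ k / fastStep α₀ k ≤ 1 := fun k => by
    have hk : (1 : ℝ) ≤ cbrt (k + 1) := one_le_cbrt k.succ_pos
    rw [slowStep_div_fastStep]
    exact div_le_one_of_le₀ (hβα.trans (le_mul_of_one_le_right hα₀.le hk)) (by positivity)
  -- No logarithmic term is needed, so `D₁ = 0`. The factor undoes the change of coordinates and the
  -- adapted norms.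
  refine ⟨(2 + 2 * ‖L‖ ^ 2) * Q, 0, by positivity, le_rfl, ?_⟩
  intro N b₁ b₂ R C W V Ω _ P _ ξ ψ x y δ K hR hb h₁ h₂ hW hV hσ hσk hC hn h hσδ hδ hK0 hK
  have hN : 0 < N := by
    obtain ⟨i⟩ := hW.connected.nonempty
    exact i.pos
  -- The decay condition on `σ` enters only through `k = 1`.
  have hσ2 : mixingRate W V ≤ 1 / 2 := by
    have := hσk 1
    norm_num at this ⊢
    exact this
  have hm := h.memLp hn.memLp_fst hn.memLp_snd
  have havg : ∀ k : ℕ, ∫ ω, ‖nodeAvg (fun i => y k i ω) - ys‖ ^ 2 ∂P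
      + slowStep β₀ k / fastStep α₀ k * ∫ ω, ‖nodeAvg (fun i => x k i ω) - xs‖ ^ 2 ∂P
      ≤ (2 + 2 * ‖L‖ ^ 2) * Q / ((k : ℝ) + 1) ^ (2 / 3 : ℝ) := fun k => by
    rw [mul_div_assoc]
    refine (integral_sq_add_mul_le hΦ₁ hΦ₂ L
      ((memLp_nodeAvg fun i => (hm k i).1).sub (memLp_const xs))
      ((memLp_nodeAvg fun i => (hm k i).2).sub (memLp_const ys)) (hρ0 k) (hρ1 k)).trans ?_
    exact mul_le_mul_of_nonneg_left (hQ Ω P _ _ _ _ (h.isTwoTimeScale hn hN hW.doublyStochastic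
      hV.doublyStochastic hA₁₁.mul_inv_cancel h₁ h₂) k) (by positivity)
  refine ⟨hm, fun k => ?_, fun k => ?_⟩
  · simpa using havg k
  · refine (sum_integral_norm_sub_sq_le hN (fun i => (hm k i).1) (fun i => (hm k i).2) xs ys
      (h.ae_consensus_le (σ := mixingRate W V) hn hN hW.doublyStochastic hV.doublyStochastic (le_max_left _ _)
        (le_max_right _ _) hn₁₁ hn₁₂ hn₂₁ hn₂₂ hβ₀ hβα hR.le hC.le hb hσ hσ2 hσδ hδ hK0 hK
        k)).trans ?_
    have h3 : (2 + 2 * ‖L‖ ^ 2) * Q / ((k : ℝ) + 1) ^ (2 / 3 : ℝ)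
        ≤ 2 * ((2 + 2 * ‖L‖ ^ 2) * Q) / ((k : ℝ) + 1) ^ (2 / 3 : ℝ) := by
      have : 0 ≤ (2 + 2 * ‖L‖ ^ 2) * Q := by positivity
      exact div_le_div_of_nonneg_right (by linarith) (by positivity)
    rw [mul_zero, zero_mul, zero_div, add_zero]
    have := (havg k).trans h3
    linarith
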